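/- Let $\hat\rho_{\boldsymbol\epsilon}$ be a family of density matrices on $\mathbb{C}^d$, indexed by the points $\boldsymbol\epsilon=(\epsilon_1,\dots,\epsilon_n)$ of an open set $U\subseteq\mathbb{R}^n$, with entries of class $C^2$. Let $p_k(\boldsymbol\epsilon)$, $|\psi_k\rangle$ be the eigenvalues (with multiplicity, in decreasing order) and an orthonormal eigenbasis of $\hat\rho_{\boldsymbol\epsilon}$, and let $$H^{ij}(\boldsymbol\epsilon)=2\sum_{k,l:\;p_k+p_l>0}\frac{\mathrm{Re}\big(\langle\psi_k|\partial_i\hat\rho_{\boldsymbol\epsilon}|\psi_l\rangle\langle\psi_l|\partial_j\hat\rho_{\boldsymbol\epsilon}|\psi_k\rangle\big)}{p_k+p_l}$$ be the quantum Fisher information matrix; equivalently $H^{ij}=\mathrm{tr}\big[\tfrac12(L_iL_j+L_jL_i)\hat\rho_{\boldsymbol\epsilon}\big]$ for any Hermitian solutions $L_i$ (which exist) of $\tfrac12(L_i\hat\rho_{\boldsymbol\epsilon}+\hat\rho_{\boldsymbol\epsilon}L_i)=\partial_i\hat\rho_{\boldsymbol\epsilon}$. The Bures metric at $\boldsymbol\epsilon$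 is the symmetric matrix $g(\boldsymbol\epsilon)$ with $$d_B^2(\hat\rho_{\boldsymbol\epsilon},\hat\rho_{\boldsymbol\epsilon+v})=\sum_{i,j}g^{ij}(\boldsymbol\epsilon)v_iv_j+o(|v|^2)\quad(v\to0),$$ where $d_B^2(\rho_1,\rho_2)=2\big(1-\sqrt{\mathcal F(\rho_1,\rho_2)}\big)$ and $\mathcal F(\rho_1,\rho_2)=\big(\mathrm{tr}\sqrt{\sqrt{\rho_1}\,\rho_2\sqrt{\rho_1}}\big)^2$. The continuous quantum Fisher information matrix is $$H_c^{ij}(\boldsymbol\epsilon)=\lim_{d\epsilon_i\to0}\ \lim_{d\epsilon_j\to0}\ \lim_{d\epsilon_r\to0,\ r\ne i,j}H^{ij}(\boldsymbol\epsilon+d\boldsymbol\epsilon),$$ where $d\epsilon_i,d\epsilon_j\neq0$ (only one of these two limits is taken if $i=j$), and the iterated limit equals $a$ if for every $\eta>0$, for all sufficiently small $d\epsilon_i$, for all $d\epsilon_j$ sufficiently small depending on $d\epsilon_i$, and for all $d\epsilon_r$ sufficiently small depending on both, $|H^{ij}(\boldsymbol\epsilon+d\boldsymbol\epsilon)-a|<\eta$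 (this is the usual nested limit whenever the inner limits exist). Then for every $\boldsymbol\epsilon\in U$: 1. $g(\boldsymbol\epsilon)$ and $H_c(\boldsymbol\epsilon)$ exist and are unique, the function $S=\sum_{k:\,p_k(\boldsymbol\epsilon)=0}p_k(\cdot)$ (the index set being fixed by $\boldsymbol\epsilon$) is $C^2$ at $\boldsymbol\epsilon$, and $$H_c^{ij}(\boldsymbol\epsilon)=4g^{ij}(\boldsymbol\epsilon)=H^{ij}(\boldsymbol\epsilon)+2\,\partial_i\partial_jS(\boldsymbol\epsilon).$$ 2. If the eigenvalues are labelled on $U$, in any order at each point, as $p_1,\dots,p_d$ in such a way that every $p_k$ with $p_k(\boldsymbol\epsilon)=0$ is twice differentiable at $\boldsymbol\epsilon$, then $$g^{ij}(\boldsymbol\epsilon)=\frac14\Big(H^{ij}(\boldsymbol\epsilon)+2\sum_{k:\,p_k(\boldsymbol\epsilon)=0}\partial_i\partial_jp_k(\boldsymbol\epsilon)\Big),$$ the Hessians $\big(\partial_i\partial_jp_k(\boldsymbol\epsilon)\big)_{i,j}$ of the vanishing eigenvalues are positive semidefinite, and $4g(\boldsymbol\epsilon)=H(\boldsymbol\epsilon)$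 if and only if all of these Hessians are zero. 3. $4g(\boldsymbol\epsilon)\ge H(\boldsymbol\epsilon)$ as symmetric matrices, with equality if and only if every (ordered) eigenvalue $p_k$ with $p_k(\boldsymbol\epsilon)=0$ satisfies $p_k(\boldsymbol\epsilon+v)=o(|v|^2)$ as $v\to0$. 4. For all $i,j$ and for $r\in\{i,j\}$, with all parameters other than $\epsilon_r$ kept fixed: $H^{ij}$ tends to $H_c^{ij}(\boldsymbol\epsilon)$ as the parameter $\epsilon_r$ tends to its value at $\boldsymbol\epsilon$ through other values, and $H_c^{ij}$ is continuous in $\epsilon_r$ at $\boldsymbol\epsilon$. -/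

import Mathlib

open Filter Topology Asymptotics
open scoped MatrixOrder ComplexOrder

/-- A density matrix on `ℂ^d`: a positive semidefinite matrix of trace one. -/
structure DensityMatrix (d : ℕ) where
  mat : Matrix (Fin d) (Fin d) ℂ
  posSemidef : mat.PosSemidef
  trace_eq_one : mat.trace = 1

namespace DensityMatrix

/-- Uhlmann fidelity `(tr √(√ρ₁ ρ₂ √ρ₁))²`; `CFC.sqrt` is the positive semidefinite square root
(the trace below is real and nonnegative). -/
noncomputable def fidelity {d : ℕ} (ρ₁ ρ₂ : DensityMatrix d) : ℝ :=
  (CFC.sqrt (CFC.sqrt ρ₁.mat * ρ₂.mat * CFC.sqrt ρ₁.mat)).trace.re ^ 2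

/-- Squared Bures distance `d_B² = 2 (1 - √F)`. -/
noncomputable def buresDistSq {d : ℕ} (ρ₁ ρ₂ : DensityMatrix d) : ℝ :=
  2 * (1 - Real.sqrt (fidelity ρ₁ ρ₂))

/-- Eigenvalues with multiplicity, listed in the decreasing order of Mathlib's
`Matrix.IsHermitian.eigenvalues₀` (up to one fixed relabelling of the indices, the same for all
density matrices), so that each `fun x => (ρ x).eigenvalue k` is a single continuous branch. -/
noncomputable def eigenvalue {d : ℕ} (ρ : DensityMatrix d) (k : Fin d) : ℝ :=
  ρ.posSemidef.isHermitian.eigenvalues k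

/-- The matrix element `⟨ψ_k| A |ψ_l⟩` in the orthonormal eigenbasis `ψ` of `ρ`
(`ψ_k` belongs to `ρ.eigenvalue k`). -/
noncomputable def element {d : ℕ} (ρ : DensityMatrix d) (A : Matrix (Fin d) (Fin d) ℂ)
    (k l : Fin d) : ℂ :=
  star (⇑(ρ.posSemidef.isHermitian.eigenvectorBasis k)) ⬝ᵥ
    (A.mulVec (⇑(ρ.posSemidef.isHermitian.eigenvectorBasis l)))

end DensityMatrix

/-- The entrywise partial derivative `∂_i ρ` at `x`. -/
noncomputable def partialState {n d : ℕ} (ρ : (Fin n → ℝ) → DensityMatrix d)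
    (x : Fin n → ℝ) (i : Fin n) : Matrix (Fin d) (Fin d) ℂ :=
  Matrix.of fun a b => fderiv ℝ (fun y => (ρ y).mat a b) x (Pi.single i 1)

/-- `L` is a symmetric logarithmic derivative of `ρ` at `x` for the `i`-th parameter. -/
def IsSLD {n d : ℕ} (ρ : (Fin n → ℝ) → DensityMatrix d) (x : Fin n → ℝ) (i : Fin n)
    (L : Matrix (Fin d) (Fin d) ℂ) : Prop :=
  L.IsHermitian ∧ (1 / 2 : ℂ) • (L * (ρ x).mat + (ρ x).mat * L) = partialState ρ x i

/-- The quantum Fisher information matrix,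
`H^{ij} = 2 ∑_{p_k + p_l > 0} Re(⟨ψ_k|∂_iρ|ψ_l⟩⟨ψ_l|∂_jρ|ψ_k⟩) / (p_k + p_l)`. -/
noncomputable def qfi {n d : ℕ} (ρ : (Fin n → ℝ) → DensityMatrix d) (x : Fin n → ℝ) :
    Matrix (Fin n) (Fin n) ℝ :=
  Matrix.of fun i j => 2 * ∑ k, ∑ l,
    if 0 < (ρ x).eigenvalue k + (ρ x).eigenvalue l then
      ((ρ x).element (partialState ρ x i) k l * (ρ x).element (partialState ρ x j) l k).re /
        ((ρ x).eigenvalue k + (ρ x).eigenvalue l)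
    else 0

/-- The Hessian matrix `∂_i ∂_j f (x)`. -/
noncomputable def hessian {n : ℕ} (f : (Fin n → ℝ) → ℝ) (x : Fin n → ℝ) :
    Matrix (Fin n) (Fin n) ℝ :=
  Matrix.of fun i j =>
    fderiv ℝ (fun y => fderiv ℝ f y (Pi.single j 1)) x (Pi.single i 1)

/-- `f` is twice differentiable at `x`, so that `hessian f x` is meaningful. -/
def TwiceDifferentiableAt {n : ℕ} (f : (Fin n → ℝ) → ℝ) (x : Fin n → ℝ) : Prop :=
  (∀ᶠ y in 𝓝 x, DifferentiableAt ℝ f y) ∧ DifferentiableAt ℝ (fderiv ℝ f) x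

/-- `g` is the Bures metric of the family `ρ` at `x`: the symmetric matrix of the line element
`d_B²(ρ_x, ρ_{x+v}) = ∑ g^{ij} v_i v_j + o(|v|²)` as `v → 0`. -/
def IsBuresMetricAt {n d : ℕ} (ρ : (Fin n → ℝ) → DensityMatrix d) (x : Fin n → ℝ)
    (g : Matrix (Fin n) (Fin n) ℝ) : Prop :=
  g.IsSymm ∧
    (fun v : Fin n → ℝ => (ρ x).buresDistSq (ρ (x + v)) - ∑ i, ∑ j, g i j * v i * v j)
      =o[𝓝 0] fun v => ‖v‖ ^ 2

/-- The displacement with `i`-th entry `s`, `j`-th entry `t` (if `j ≠ i`), and the remaining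
entries those of `u`. -/
def displacement {n : ℕ} (i j : Fin n) (s t : ℝ) (u : Fin n → ℝ) : Fin n → ℝ :=
  fun r => if r = i then s else if r = j then t else u r

/-- `lim_{s → 0} lim_{t → 0} lim_{u → 0} F (x + displacement i j s t u) = a`, as a limit along
Mathlib's filter of iterated limits: for every `η > 0`, for all small `s ≠ 0`, for all `t ≠ 0`
that are small depending on `s`, and for all `u` that are small depending on `s` and `t`, the value
is `η`-close to `a`. It does not require the inner limits to exist; where they do exist it is the
nested limit, see `HasIteratedLimit.tendsto_of_inner`. -/
def HasIteratedLimit {n : ℕ} (F : (Fin n → ℝ) → ℝ) (x : Fin n → ℝ) (i j : Fin n) (a : ℝ) : Prop :=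
  Tendsto (fun w : ℝ × ℝ × (Fin n → ℝ) => F (x + displacement i j w.1 w.2.1 w.2.2))
    ((𝓝[≠] (0 : ℝ)).curry ((𝓝[≠] (0 : ℝ)).curry (𝓝 (0 : Fin n → ℝ)))) (𝓝 a)

/-- Where the inner limits exist, `HasIteratedLimit` gives the literal nested limit. -/
theorem HasIteratedLimit.tendsto_of_inner {n : ℕ} {F : (Fin n → ℝ) → ℝ} {x : Fin n → ℝ}
    {i j : Fin n} {a : ℝ} (h : HasIteratedLimit F x i j a) (G₁ : ℝ → ℝ → ℝ) (G₂ : ℝ → ℝ)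
    (h₁ : ∀ᶠ s in 𝓝[≠] (0 : ℝ), ∀ᶠ t in 𝓝[≠] (0 : ℝ),
      Tendsto (fun u => F (x + displacement i j s t u)) (𝓝 0) (𝓝 (G₁ s t)))
    (h₂ : ∀ᶠ s in 𝓝[≠] (0 : ℝ), Tendsto (G₁ s) (𝓝[≠] 0) (𝓝 (G₂ s))) :
    Tendsto G₂ (𝓝[≠] 0) (𝓝 a) := by
  rw [Metric.nhds_basis_closedBall.tendsto_right_iff]
  intro η hη
  have h' := h.eventually (Metric.closedBall_mem_nhds a hη)
  rw [eventually_curry_iff] at h'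
  filter_upwards [h', h₁, h₂] with s hs hs₁ hs₂
  rw [eventually_curry_iff] at hs
  refine Metric.isClosed_closedBall.mem_of_tendsto hs₂ ?_
  filter_upwards [hs, hs₁] with t ht ht₁
  exact Metric.isClosed_closedBall.mem_of_tendsto ht₁ ht

/-- `h` is the continuous quantum Fisher information matrix at `x`:
`h^{ij} = lim_{dε_i → 0} lim_{dε_j → 0} lim_{dε_r → 0, r ≠ i, j} H^{ij}(x + dε)`. -/
def IsContinuousQFIAt {n d : ℕ} (ρ : (Fin n → ℝ) → DensityMatrix d) (x : Fin n → ℝ)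
    (h : Matrix (Fin n) (Fin n) ℝ) : Prop :=
  ∀ i j, HasIteratedLimit (fun y => qfi ρ y i j) x i j (h i j)

/-- The sum, as a function of `y`, of those eigenvalue branches `p_k` that vanish at `x`. -/
noncomputable def vanishingSum {n d : ℕ} (ρ : (Fin n → ℝ) → DensityMatrix d) (x y : Fin n → ℝ) :
    ℝ :=
  ∑ k with (ρ x).eigenvalue k = 0, (ρ y).eigenvalue k

/-- `p` lists, at every point of `U`, the eigenvalues of `ρ` with multiplicity. -/
def IsEigenvalueLabelling {n d : ℕ} (ρ : (Fin n → ℝ) → DensityMatrix d) (U : Set (Fin n → ℝ))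
    (p : Fin d → (Fin n → ℝ) → ℝ) : Prop :=
  ∀ x ∈ U, (ρ x).mat.charpoly = ∏ k, (Polynomial.X - Polynomial.C ((p k x : ℝ) : ℂ))

/-! Fix `x`, let `p_k` be the eigenvalues of `ρ x`, let `Z` be the set of indices with `p_k = 0`,
and let `S` be the sum over `Z` of the eigenvalue branches. Both `H_c` and `4g` are shown,
independently of each other, to equal `H + 2 ∂∂S` at `x`.

Smoothness. Single eigenvalues need not be differentiable, but the kernel of `ρ x` is separated from
the rest of the spectrum by a gap. The inverse function theorem gives a unitary `V`, of class `C²`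
at `x`, with `ρ = V N V*` near `x` and `N` block-diagonal for `Z` and its complement
(`exists_blockDiagonalization`, `exists_isBlockFrame`). Then `S` is the trace of the `Z`-block of
`N`, hence `C²`.

Limit of `H`. The terms of `H(y)` with `k` or `l` outside `Z` tend to `H(x)`, because limits of
eigenbases are eigenbases and the sum does not depend on the eigenbasis. The terms with `k, l ∈ Z`
are of type `0/0`. A nonnegative `C²` function `f` satisfies `f'² ≤ C f` locally, so matrix elements
of `∂_j ρ` are `O(√(p_k + p_l))`. If moreover `f` and `f'` nearly vanish at `0`, then `f'(s) = (2/s)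
f(s) + o(√f(s))` (`sq_deriv_sub_le`). Applied to the quadratic forms of the kernel block and
polarized, this says that near `x + s e_i` the `Z`-block of `∂_i ρ` in the eigenbasis is `(2/s)
diag(p_k)` up to `o(√(p_k + p_l))`. The singular terms thus sum to about `(2/s) ∂_j S`, which tends
to `2 ∂_i ∂_j S` since `∂_j S (x) = 0`. The estimate holds on a whole neighbourhood of `x + s e_i`
(`eventually_abs_qfi_sub_lt`), so it yields the iterated limit, the one-parameter limit and the
continuity of `H_c` together.

Bures distance. In the eigenbasis of `ρ x`, with `D = diag p` and `δ` the deviation of `ρ (x + v)`,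
the square root in the fidelity is `D + Δ` where `DΔ + ΔD + Δ² = √D δ √D`. Reading off the diagonal
gives exactly `d_B² = ∑_{k ∈ Z} δ_kk + ∑ |Δ_kl|² / p_k` (`exists_buresDistSq_eq`). To leading order
`Δ_kl` is `√(p_k p_l) / (p_k + p_l)` times `δ_kl`, while the kernel trace of `δ` is `S(x + v)` plus
a second-order rotation term coming from `V`. The two quadratic contributions combine into a quarter
of the form of `H`, and `S` contributes half the form of its Hessian.

Finally `S ≥ 0 = S(x)`, so the Hessian of `S` is positive semidefinite, and it vanishes exactly when
every eigenvalue in `Z` is `o(|v|²)`. -/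

/-! ### Nonnegative functions of one variable with bounded second derivative -/

/-- First and second order Taylor bounds from a bound on the second derivative. -/
theorem taylor_bound_of_second_deriv {f f₁ f₂ : ℝ → ℝ} {t r c η : ℝ}
    (h₁ : ∀ τ, |τ - t| ≤ r → HasDerivAt f (f₁ τ) τ)
    (h₂ : ∀ τ, |τ - t| ≤ r → HasDerivAt f₁ (f₂ τ) τ)
    (hη : ∀ τ, |τ - t| ≤ r → |f₂ τ - c| ≤ η) {τ : ℝ} (hτ : |τ - t| ≤ r) :
    |f₁ τ - f₁ t - c * (τ - t)| ≤ η * |τ - t| ∧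
      |f τ - f t - f₁ t * (τ - t) - c * (τ - t) ^ 2 / 2| ≤ η * (τ - t) ^ 2 := by
  have hη0 : 0 ≤ η := (abs_nonneg _).trans (hη τ hτ)
  have key : ∀ ρ : ℝ, |ρ - t| ≤ r → |f₁ ρ - f₁ t - c * (ρ - t)| ≤ η * |ρ - t| := by
    intro ρ hρ
    have := (convex_closedBall t |ρ - t|).norm_image_sub_le_of_norm_hasDerivWithin_le
      (f := fun τ => f₁ τ - c * (τ - t)) (f' := fun τ => f₂ τ - c) (C := η) (x := t) (y := ρ)
      (fun z hz => by
        rw [Metric.mem_closedBall, Real.dist_eq] at hz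
        have h := ((h₂ z (hz.trans hρ)).sub (((hasDerivAt_id z).sub_const t).const_mul c))
        exact (h.congr_deriv (by simp)).hasDerivWithinAt)
      (fun z hz => by
        rw [Metric.mem_closedBall, Real.dist_eq] at hz
        exact hη z (hz.trans hρ))
      (by simp) (by simp [Real.dist_eq])
    rw [Real.norm_eq_abs, Real.norm_eq_abs] at this
    convert this using 2
    ring
  refine ⟨key τ hτ, ?_⟩
  -- On the ball of radius `|τ - t|` the derivative of the remainder is at most `η |τ - t|`; the
  -- mean value inequality then costs the factor `1/2` of the sharp bound.
  have := (convex_closedBall t |τ - t|).norm_image_sub_le_of_norm_hasDerivWithin_le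
      (f := fun z => f z - f₁ t * (z - t) - c * (z - t) ^ 2 / 2)
      (f' := fun z => f₁ z - f₁ t - c * (z - t)) (C := η * |τ - t|) (x := t) (y := τ)
      (fun z hz => by
        rw [Metric.mem_closedBall, Real.dist_eq] at hz
        have h := ((h₁ z (hz.trans hτ)).sub (((hasDerivAt_id z).sub_const t).const_mul (f₁ t))).sub
          (((((hasDerivAt_id z).sub_const t).pow 2).const_mul c).div_const 2)
        refine (h.congr_deriv ?_).hasDerivWithinAt
        simp
        ring)
      (fun z hz => by
        rw [Metric.mem_closedBall, Real.dist_eq] at hz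
        exact (key z (hz.trans hτ)).trans (by gcongr))
      (by simp) (by simp [Real.dist_eq])
  rw [Real.norm_eq_abs, Real.norm_eq_abs, mul_assoc, abs_mul_abs_self, ← pow_two] at this
  convert this using 2
  ring

/-- The gradient of a nonnegative function with bounded second derivative is controlled by the
square root of the function. -/
theorem sq_deriv_le_of_nonneg {f f₁ f₂ : ℝ → ℝ} {t r L : ℝ} (hr : 0 < r) (hL : 0 < L)
    (h₁ : ∀ τ, |τ - t| ≤ r → HasDerivAt f (f₁ τ) τ)
    (h₂ : ∀ τ, |τ - t| ≤ r → HasDerivAt f₁ (f₂ τ) τ)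
    (hf₂ : ∀ τ, |τ - t| ≤ r → |f₂ τ| ≤ L)
    (hf : ∀ τ, |τ - t| ≤ r → 0 ≤ f τ) (hft : f t ≤ L * r ^ 2) :
    f₁ t ^ 2 ≤ 4 * L * f t := by
  have key : ∀ h : ℝ, |h| ≤ r → 0 ≤ f t + f₁ t * h + L * h ^ 2 := by
    intro h hh
    have hτ : |t + h - t| ≤ r := by simpa using hh
    have := (taylor_bound_of_second_deriv (c := 0) (η := L) h₁ h₂ (by simpa using hf₂) hτ).2
    have h0 := hf _ hτ
    simp only [add_sub_cancel_left] at this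
    have := (abs_le.1 this).2
    linarith
  -- If the vertex `-f₁ t / (2 L)` of the parabola in `key` lies within the radius, nonnegativity
  -- there is the discriminant inequality. Otherwise `h = ± r` contradicts `f t ≤ L r²`.
  rcases le_or_gt |f₁ t| (2 * L * r) with hcase | hcase
  · have h1 : |-(f₁ t) / (2 * L)| ≤ r := by
      rw [abs_div, abs_neg, abs_of_pos (by positivity : 0 < 2 * L), div_le_iff₀ (by positivity)]
      linarith
    have := key _ h1
    have e : f t + f₁ t * (-(f₁ t) / (2 * L)) + L * (-(f₁ t) / (2 * L)) ^ 2
        = f t - f₁ t ^ 2 / (4 * L) := by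
      field_simp
      ring
    rw [e, sub_nonneg, div_le_iff₀ (by positivity)] at this
    linarith
  · exfalso
    have a := key r (abs_of_pos hr).le
    have b := key (-r) (by rw [abs_neg, abs_of_pos hr])
    rcases abs_cases (f₁ t) with ⟨h, _⟩ | ⟨h, _⟩ <;> rw [h] at hcase <;> nlinarith

/-- If `f ≥ 0` nearly vanishes to first order at `0` and `f''` is nearly constant, then
`f' s - (2 / s) f s` is small compared with the square root of `f s`. -/
theorem sq_deriv_sub_le {f f₁ f₂ : ℝ → ℝ} {s κ c : ℝ} (hs : s ≠ 0) (hκ : 0 < κ) (hκ1 : κ ≤ 1)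
    (h₁ : ∀ τ, |τ| ≤ 2 * |s| → HasDerivAt f (f₁ τ) τ)
    (h₂ : ∀ τ, |τ| ≤ 2 * |s| → HasDerivAt f₁ (f₂ τ) τ)
    (hf₂ : ∀ τ, |τ| ≤ 2 * |s| → |f₂ τ - c| ≤ κ ^ 2)
    (hf : ∀ τ, |τ| ≤ 2 * |s| → 0 ≤ f τ) (hf0 : |f 0| ≤ κ ^ 2 * s ^ 2)
    (hf10 : |f₁ 0| ≤ κ ^ 2 * |s|) :
    (f₁ s - 2 / s * f s) ^ 2 ≤ 128 * κ * f s := by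
  have hs0 : 0 < |s| := abs_pos.2 hs
  have hs2 : 0 < s ^ 2 := by positivity
  have hsa : |s| ≤ 2 * |s| := by linarith
  obtain ⟨t1, t2⟩ := taylor_bound_of_second_deriv (t := 0) (r := 2 * |s|) (τ := s) (c := c)
    (by simpa using h₁) (by simpa using h₂) (by simpa using hf₂) (by simpa using hsa)
  simp only [sub_zero] at t1 t2
  have hfs := hf s hsa
  have hκκ : κ ^ 2 ≤ κ := by nlinarith
  have b1 : |f₁ 0 * s| ≤ κ ^ 2 * s ^ 2 := by
    rw [abs_mul, ← sq_abs s]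
    nlinarith
  have u2 : |f s - c * s ^ 2 / 2| ≤ 3 * κ ^ 2 * s ^ 2 := by
    rw [abs_le] at *
    constructor <;> linarith
  have u1 : |f₁ s - c * s| ≤ 2 * κ ^ 2 * |s| := by
    rw [abs_le] at t1 hf10 ⊢
    constructor <;> linarith
  have hκ2 : 0 < κ ^ 2 := by positivity
  -- For `c ≥ 8κ`, `f s` is at least `κ s²`, and the difference is small because `f₁ s ≈ c s` and `f
  -- s ≈ c s² / 2`. For `c < 8κ`, the two terms are small separately.
  rcases le_or_gt (8 * κ) c with hc | hc
  · have hlow : κ * s ^ 2 ≤ f s := by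
      have := (abs_le.1 u2).1
      nlinarith
    have he : |f₁ s - 2 / s * f s| ≤ 8 * κ ^ 2 * |s| := by
      have e : f₁ s - 2 / s * f s = (f₁ s - c * s) - 2 / s * (f s - c * s ^ 2 / 2) := by
        field_simp
        ring
      have : |2 / s * (f s - c * s ^ 2 / 2)| ≤ 6 * κ ^ 2 * |s| := by
        rw [abs_mul, abs_div, abs_two]
        calc 2 / |s| * |f s - c * s ^ 2 / 2| ≤ 2 / |s| * (3 * κ ^ 2 * s ^ 2) := by gcongr
          _ = 6 * κ ^ 2 * |s| := by
            rw [← sq_abs s]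
            field_simp
            ring
      rw [e]
      exact (abs_sub _ _).trans (by linarith)
    calc (f₁ s - 2 / s * f s) ^ 2 = |f₁ s - 2 / s * f s| ^ 2 := (sq_abs _).symm
      _ ≤ (8 * κ ^ 2 * |s|) ^ 2 := by gcongr
      _ = 64 * κ ^ 3 * (κ * s ^ 2) := by
        rw [← sq_abs s]
        ring
      _ ≤ 64 * κ ^ 3 * f s := by gcongr
      _ ≤ 128 * κ * f s := by
        gcongr
        · norm_num
        · nlinarith
  · have hclow : -(6 * κ ^ 2) ≤ c := by
      have := (abs_le.1 u2).2
      nlinarith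
    have hup : f s ≤ 7 * κ * s ^ 2 := by
      have := (abs_le.1 u2).2
      nlinarith
    have hmem : ∀ τ, |τ - s| ≤ |s| → |τ| ≤ 2 * |s| := fun τ hτ => by
      have := abs_add_le (τ - s) s
      rw [sub_add_cancel] at this
      linarith
    -- Since `-6κ² ≤ c < 8κ`, the second derivative is at most `9κ` in absolute value; the ball of
    -- radius `|s|` around `s` stays inside `|τ| ≤ 2|s|`. Together with `hq` this gives `2 (36 + 28)
    -- κ = 128 κ`.
    have hg : f₁ s ^ 2 ≤ 4 * (9 * κ) * f s := by
      refine sq_deriv_le_of_nonneg hs0 (by positivity) (fun τ hτ => h₁ τ (hmem τ hτ))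
        (fun τ hτ => h₂ τ (hmem τ hτ)) (fun τ hτ => ?_) (fun τ hτ => hf τ (hmem τ hτ)) ?_
      · have := abs_le.1 (hf₂ τ (hmem τ hτ))
        rw [abs_le]
        constructor <;> linarith
      · rw [sq_abs]
        nlinarith
    have hq : (2 / s * f s) ^ 2 ≤ 28 * κ * f s := by
      have : (2 / s * f s) ^ 2 = 4 * f s * (f s / s ^ 2) := by
        field_simp
        ring
      rw [this]
      have h7 : f s / s ^ 2 ≤ 7 * κ := by rwa [div_le_iff₀ hs2]
      nlinarith
    nlinarith [sq_nonneg (f₁ s + 2 / s * f s)]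

/-! ### Hessians and second-order Taylor expansion -/

section Hessian

variable {n : ℕ} {f : (Fin n → ℝ) → ℝ} {x : Fin n → ℝ}

theorem ContDiffAt.twiceDifferentiableAt (hf : ContDiffAt ℝ 2 f x) : TwiceDifferentiableAt f x :=
  ⟨(hf.eventually (by simp)).mono fun _ hy => hy.differentiableAt (by simp),
    (hf.fderiv_right (m := 1) (by norm_num)).differentiableAt (by simp)⟩

namespace TwiceDifferentiableAt

theorem hessian_apply (hf : TwiceDifferentiableAt f x) (i j : Fin n) :
    hessian f x i j = fderiv ℝ (fderiv ℝ f) x (Pi.single i 1) (Pi.single j 1) := by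
  simp only [hessian, Matrix.of_apply]
  rw [fderiv_clm_apply hf.2 (differentiableAt_const _)]
  simp

theorem second_fderiv_symm (hf : TwiceDifferentiableAt f x) (v w : Fin n → ℝ) :
    fderiv ℝ (fderiv ℝ f) x v w = fderiv ℝ (fderiv ℝ f) x w v :=
  second_derivative_symmetric_of_eventually_of_real
    (hf.1.mono fun _ hy => hy.hasFDerivAt) hf.2.hasFDerivAt v w

theorem hessian_isSymm (hf : TwiceDifferentiableAt f x) : (hessian f x).IsSymm := by
  ext i j
  rw [Matrix.transpose_apply, hf.hessian_apply, hf.hessian_apply, hf.second_fderiv_symm]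

theorem sum_hessian (hf : TwiceDifferentiableAt f x) (v : Fin n → ℝ) :
    ∑ i, ∑ j, hessian f x i j * v i * v j = fderiv ℝ (fderiv ℝ f) x v v := by
  have hv : v = ∑ i, v i • (Pi.single i (1 : ℝ) : Fin n → ℝ) := by
    conv_lhs => rw [← Finset.univ_sum_single v]
    refine Finset.sum_congr rfl fun i _ => ?_
    rw [← Pi.single_smul, smul_eq_mul, mul_one]
  conv_rhs => rw [hv]
  simp only [map_sum, sum_apply, map_smul, smul_apply,
    smul_eq_mul, hf.hessian_apply, Finset.mul_sum]
  refine Finset.sum_congr rfl fun i _ => Finset.sum_congr rfl fun j _ => ?_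
  rw [hf.second_fderiv_symm]
  ring

/-- Second order Taylor expansion with Peano remainder. -/
theorem taylor_isLittleO (hf : TwiceDifferentiableAt f x) :
    (fun v => f (x + v) - f x - fderiv ℝ f x v - 1 / 2 * ∑ i, ∑ j, hessian f x i j * v i * v j)
      =o[𝓝 0] fun v => ‖v‖ ^ 2 := by
  simp only [hf.sum_hessian]
  set B := fderiv ℝ (fderiv ℝ f) x with hB
  rw [isLittleO_iff]
  intro ε hε
  have h1 := (hasFDerivAt_iff_isLittleO_nhds_zero.1 hf.2.hasFDerivAt)
  rw [isLittleO_iff] at h1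
  have h2 : ∀ᶠ v in 𝓝 (0 : Fin n → ℝ), DifferentiableAt ℝ f (x + v) := by
    have : Tendsto (fun v : Fin n → ℝ => x + v) (𝓝 0) (𝓝 x) := by
      simpa using (tendsto_const_nhds (x := x)).add (tendsto_id (x := 𝓝 (0 : Fin n → ℝ)))
    exact this.eventually hf.1
  obtain ⟨δ, hδ, hball⟩ := Metric.eventually_nhds_iff_ball.1 ((h1 hε).and h2)
  filter_upwards [Metric.ball_mem_nhds (0 : Fin n → ℝ) hδ] with v hv
  have hsub : ∀ z ∈ Metric.closedBall (0 : Fin n → ℝ) ‖v‖, z ∈ Metric.ball (0 : Fin n → ℝ) δ := by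
    intro z hz
    rw [mem_closedBall_zero_iff] at hz
    rw [mem_ball_zero_iff] at hv ⊢
    exact hz.trans_lt hv
  -- By symmetry of `B`, the derivative of the Taylor remainder at `z` is `f'(x + z) - f'(x) - B z`,
  -- of norm at most `ε ‖v‖` on the ball of radius `‖v‖`.
  have := (convex_closedBall (0 : Fin n → ℝ) ‖v‖).norm_image_sub_le_of_norm_hasFDerivWithin_le
    (f := fun z => f (x + z) - f x - fderiv ℝ f x z - 1 / 2 * B z z)
    (f' := fun z => fderiv ℝ f (x + z) - fderiv ℝ f x - B z) (C := ε * ‖v‖) (x := 0) (y := v)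
    (fun z hz => by
      have hz' := (hball z (hsub z hz)).2.hasFDerivAt
      have e1 : HasFDerivAt (fun z => f (x + z)) (fderiv ℝ f (x + z)) z :=
        (hasFDerivAt_comp_add_left x).2 hz'
      have e2 : HasFDerivAt (fun z => B z z) (B z + B.flip z) z := by
        have := B.hasFDerivAt.clm_apply (hasFDerivAt_id z)
        refine this.congr_fderiv ?_
        ext w
        simp
      have e3 := ((e1.sub_const (f x)).sub (fderiv ℝ f x).hasFDerivAt).sub
        (e2.const_mul (1 / 2 : ℝ))
      refine (e3.congr_fderiv ?_).hasFDerivWithinAt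
      ext w
      have := hf.second_fderiv_symm z w
      simp only [sub_apply, smul_apply,
        add_apply, ContinuousLinearMap.flip_apply, smul_eq_mul, hB]
      rw [← this]
      ring)
    (fun z hz => by
      refine (hball z (hsub z hz)).1.trans ?_
      rw [mem_closedBall_zero_iff] at hz
      gcongr)
    (by simp) (by simp)
  simp only [sub_zero, add_zero, sub_self, map_zero, mul_zero] at this
  rw [norm_pow, norm_norm]
  calc _ ≤ _ := this
    _ = _ := by ring

end TwiceDifferentiableAt

/-- A quadratic form that is `o(|v|²)` vanishes. -/
theorem quadratic_eq_zero_of_isLittleO {g : Matrix (Fin n) (Fin n) ℝ}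
    (h : (fun v : Fin n → ℝ => ∑ i, ∑ j, g i j * v i * v j) =o[𝓝 0] fun v => ‖v‖ ^ 2)
    (v : Fin n → ℝ) : ∑ i, ∑ j, g i j * v i * v j = 0 := by
  have ht : Tendsto (fun t : ℝ => t • v) (𝓝[≠] 0) (𝓝 0) := by
    have : Continuous fun t : ℝ => t • v := by fun_prop
    simpa using (this.tendsto 0).mono_left nhdsWithin_le_nhds
  have h1 := h.comp_tendsto ht
  have h2 : (fun t : ℝ => t ^ 2 * ∑ i, ∑ j, g i j * v i * v j) =o[𝓝[≠] 0] fun t : ℝ => t ^ 2 := by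
    refine IsLittleO.trans_isBigO (h1.congr_left fun t => ?_) (g := (fun v : Fin n → ℝ => ‖v‖ ^ 2) ∘ fun t : ℝ => t • v) ?_
    · simp only [Function.comp, Pi.smul_apply, smul_eq_mul, Finset.mul_sum]
      refine Finset.sum_congr rfl fun i _ => Finset.sum_congr rfl fun j _ => ?_
      ring
    · refine IsBigO.of_bound (‖v‖ ^ 2) (Eventually.of_forall fun t => ?_)
      simp only [Function.comp, norm_smul, norm_pow, norm_mul, norm_norm]
      apply le_of_eq
      ring
  have h3 := h2.tendsto_div_nhds_zero
  refine tendsto_nhds_unique (h3.congr' ?_) tendsto_const_nhds |>.symm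
  filter_upwards [self_mem_nhdsWithin] with t ht
  have : t ≠ 0 := ht
  field_simp

theorem eq_zero_of_isSymm_of_quadratic {g : Matrix (Fin n) (Fin n) ℝ} (hg : g.IsSymm)
    (h : ∀ v : Fin n → ℝ, ∑ i, ∑ j, g i j * v i * v j = 0) : g = 0 := by
  have hq : ∀ v : Fin n → ℝ, v ⬝ᵥ g.mulVec v = 0 := by
    intro v
    rw [← h v]
    simp only [dotProduct, Matrix.mulVec, Finset.mul_sum]
    refine Finset.sum_congr rfl fun i _ => Finset.sum_congr rfl fun j _ => ?_
    ring
  ext i j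
  have hij : g j i = g i j := by conv_lhs => rw [← hg, Matrix.transpose_apply]
  have h0 := hq (Pi.single i 1 + Pi.single j 1)
  have h1 := hq (Pi.single i 1)
  have h2 := hq (Pi.single j 1)
  simp [Matrix.mulVec_add] at h0 h1 h2
  simp only [Matrix.zero_apply]
  linarith

/-- The Hessian at a minimum where the function vanishes describes it to second order. -/
theorem TwiceDifferentiableAt.isLittleO_of_nonneg (hf : TwiceDifferentiableAt f x)
    (hmin : ∀ᶠ y in 𝓝 x, 0 ≤ f y) (h0 : f x = 0) :
    (fun v => f (x + v) - 1 / 2 * ∑ i, ∑ j, hessian f x i j * v i * v j)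
      =o[𝓝 0] fun v => ‖v‖ ^ 2 := by
  have hloc : IsLocalMin f x := by
    filter_upwards [hmin] with y hy
    rwa [h0]
  simpa [hloc.fderiv_eq_zero, h0] using hf.taylor_isLittleO

/-- The gradient vanishes at the minimum, so `f (x + t v) / t²` tends to half the Hessian form at
`v`, and these quotients are eventually nonnegative. -/
theorem TwiceDifferentiableAt.hessian_posSemidef (hf : TwiceDifferentiableAt f x)
    (hmin : ∀ᶠ y in 𝓝 x, 0 ≤ f y) (h0 : f x = 0) : (hessian f x).PosSemidef := by
  refine Matrix.PosSemidef.of_dotProduct_mulVec_nonneg ?_ fun v => ?_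
  · rw [Matrix.IsHermitian, Matrix.conjTranspose_eq_transpose_of_trivial]
    exact hf.hessian_isSymm
  · have e : star v ⬝ᵥ (hessian f x).mulVec v = ∑ i, ∑ j, hessian f x i j * v i * v j := by
      simp only [dotProduct, Matrix.mulVec, Finset.mul_sum, Pi.star_apply, star_trivial]
      refine Finset.sum_congr rfl fun i _ => Finset.sum_congr rfl fun j _ => ?_
      ring
    rw [e]
    have ht : Tendsto (fun t : ℝ => t • v) (𝓝[≠] 0) (𝓝 0) := by
      have : Continuous fun t : ℝ => t • v := by fun_prop
      simpa using (this.tendsto 0).mono_left nhdsWithin_le_nhds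
    have h1 := (hf.isLittleO_of_nonneg hmin h0).comp_tendsto ht
    have h2 := h1.trans_isBigO (IsBigO.of_bound (g := fun t : ℝ => t ^ 2) (‖v‖ ^ 2)
      (Eventually.of_forall fun t => by
        simp only [Function.comp, norm_smul, norm_pow, norm_mul, norm_norm]
        apply le_of_eq
        ring))
    have h3 := h2.tendsto_div_nhds_zero
    have h4 : Tendsto (fun t : ℝ => f (x + t • v) / t ^ 2) (𝓝[≠] 0)
        (𝓝 (1 / 2 * ∑ i, ∑ j, hessian f x i j * v i * v j)) := by
      have := h3.add_const (1 / 2 * ∑ i, ∑ j, hessian f x i j * v i * v j)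
      rw [zero_add] at this
      refine this.congr' ?_
      filter_upwards [self_mem_nhdsWithin] with t ht
      have ht' : t ≠ 0 := ht
      have : ∑ i, ∑ j, hessian f x i j * (t • v) i * (t • v) j
          = t ^ 2 * ∑ i, ∑ j, hessian f x i j * v i * v j := by
        simp only [Pi.smul_apply, smul_eq_mul, Finset.mul_sum]
        refine Finset.sum_congr rfl fun i _ => Finset.sum_congr rfl fun j _ => ?_
        ring
      simp only [Function.comp, this]
      field_simp
      ring
    have h5 := ge_of_tendsto h4 (b := 0) ?_
    · linarith
    · have hx : Tendsto (fun t : ℝ => x + t • v) (𝓝[≠] 0) (𝓝 x) := by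
        simpa using tendsto_const_nhds.add ht
      filter_upwards [hx.eventually hmin] with t ht
      positivity

theorem hessian_congr {g : (Fin n → ℝ) → ℝ} (h : f =ᶠ[𝓝 x] g) : hessian f x = hessian g x := by
  ext i j
  simp only [hessian, Matrix.of_apply]
  have : (fun y => fderiv ℝ f y (Pi.single j 1)) =ᶠ[𝓝 x] fun y => fderiv ℝ g y (Pi.single j 1) :=
    h.eventuallyEq_nhds.mono fun y hy => by simp only [hy.fderiv_eq]
  rw [this.fderiv_eq]

theorem TwiceDifferentiableAt.sum {ι : Type*} {s : Finset ι} {F : ι → (Fin n → ℝ) → ℝ}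
    (h : ∀ k ∈ s, TwiceDifferentiableAt (F k) x) :
    TwiceDifferentiableAt (fun y => ∑ k ∈ s, F k y) x ∧
      hessian (fun y => ∑ k ∈ s, F k y) x = ∑ k ∈ s, hessian (F k) x := by
  have h1 : ∀ᶠ y in 𝓝 x, ∀ k ∈ s, DifferentiableAt ℝ (F k) y :=
    (Filter.eventually_all_finset s).2 fun k hk => (h k hk).1
  have h2 : fderiv ℝ (fun y => ∑ k ∈ s, F k y) =ᶠ[𝓝 x] fun y => ∑ k ∈ s, fderiv ℝ (F k) y := by
    filter_upwards [h1] with y hy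
    exact fderiv_fun_sum hy
  have h3 : TwiceDifferentiableAt (fun y => ∑ k ∈ s, F k y) x := by
    refine ⟨?_, ?_⟩
    · filter_upwards [h1] with y hy
      exact DifferentiableAt.fun_sum hy
    · exact (DifferentiableAt.fun_sum fun k hk => (h k hk).2).congr_of_eventuallyEq h2
  refine ⟨h3, ?_⟩
  ext i j
  rw [h3.hessian_apply, h2.fderiv_eq, fderiv_fun_sum fun k hk => (h k hk).2, Matrix.sum_apply]
  simp only [sum_apply]
  exact Finset.sum_congr rfl fun k hk => ((h k hk).hessian_apply i j).symm

end Hessian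

/-! ### Quadratic forms of complex matrices and polarization -/

open Matrix in
/-- The real quadratic form `Re ⟨w|A|w⟩` of a complex matrix. -/
noncomputable def Matrix.reQuad {ι : Type*} [Fintype ι] (A : Matrix ι ι ℂ) (w : ι → ℂ) : ℝ :=
  (star w ⬝ᵥ A *ᵥ w).re

section Polarization

open Matrix

variable {ι : Type*} [Fintype ι]

theorem Matrix.IsHermitian.star_dotProduct_mulVec {A : Matrix ι ι ℂ} (hA : A.IsHermitian)
    (a b : ι → ℂ) : star b ⬝ᵥ A *ᵥ a = star (star a ⬝ᵥ A *ᵥ b) := by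
  rw [Matrix.star_dotProduct, star_mulVec, hA.eq, dotProduct_mulVec]

theorem Matrix.reQuad_add_reQuad_sub (A : Matrix ι ι ℂ) (a b : ι → ℂ) :
    A.reQuad (a + b) + A.reQuad (a - b) = 2 * A.reQuad a + 2 * A.reQuad b := by
  simp only [reQuad, star_add, star_sub, mulVec_add, mulVec_sub, add_dotProduct, sub_dotProduct,
    dotProduct_add, dotProduct_sub, Complex.add_re, Complex.sub_re]
  ring

theorem Matrix.IsHermitian.reQuad_add_sub_reQuad_sub {A : Matrix ι ι ℂ} (hA : A.IsHermitian)
    (a b : ι → ℂ) : A.reQuad (a + b) - A.reQuad (a - b) = 4 * (star a ⬝ᵥ A *ᵥ b).re := by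
  have h : (star b ⬝ᵥ A *ᵥ a).re = (star a ⬝ᵥ A *ᵥ b).re := by
    rw [hA.star_dotProduct_mulVec]
    simp
  simp only [reQuad, star_add, star_sub, mulVec_add, mulVec_sub, add_dotProduct, sub_dotProduct,
    dotProduct_add, dotProduct_sub, Complex.add_re, Complex.sub_re, h]
  ring

theorem Matrix.reQuad_smul (A : Matrix ι ι ℂ) (c : ℂ) (a : ι → ℂ) :
    A.reQuad (c • a) = ‖c‖ ^ 2 * A.reQuad a := by
  simp only [reQuad, star_smul, mulVec_smul, smul_dotProduct, dotProduct_smul, smul_eq_mul]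
  rw [← mul_assoc, Complex.star_def, Complex.mul_conj, Complex.re_ofReal_mul,
    Complex.normSq_eq_norm_sq]

theorem Matrix.reQuad_sub_left (A B : Matrix ι ι ℂ) (w : ι → ℂ) :
    (A - B).reQuad w = A.reQuad w - B.reQuad w := by
  simp [reQuad, sub_mulVec]

theorem Matrix.reQuad_real_smul_left (c : ℝ) (A : Matrix ι ι ℂ) (w : ι → ℂ) :
    ((c : ℂ) • A).reQuad w = c * A.reQuad w := by
  simp [reQuad, smul_mulVec]

theorem Matrix.reQuad_eq_sum (A : Matrix ι ι ℂ) (w : ι → ℂ) :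
    A.reQuad w = ∑ a, ∑ b, (star (w a) * w b * A a b).re := by
  simp only [reQuad, dotProduct, mulVec, Complex.re_sum, Finset.mul_sum, Pi.star_apply]
  refine Finset.sum_congr rfl fun a _ => Finset.sum_congr rfl fun b _ => ?_
  congr 1
  ring

/-- Polarization: a bound of a Hermitian form by a quadratic form on all `a ± c b`, `|c| = 1`,
bounds the matrix element between `a` and `b`. -/
theorem Matrix.IsHermitian.norm_sq_le_of_reQuad {E N : Matrix ι ι ℂ} (hE : E.IsHermitian) {K : ℝ}
    (a b : ι → ℂ)
    (h : ∀ c : ℂ, ‖c‖ = 1 → E.reQuad (a + c • b) ^ 2 ≤ K * N.reQuad (a + c • b)) :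
    ‖star a ⬝ᵥ E *ᵥ b‖ ^ 2 ≤ K / 4 * (N.reQuad a + N.reQuad b) := by
  -- The phase `c` makes the matrix element real and nonnegative, so that its norm is seen by the
  -- real part in the polarization identity.
  obtain ⟨c, hc, hcs⟩ : ∃ c : ℂ, ‖c‖ = 1 ∧ c * (star a ⬝ᵥ E *ᵥ b) = ‖star a ⬝ᵥ E *ᵥ b‖ := by
    set s := star a ⬝ᵥ E *ᵥ b
    rcases eq_or_ne s 0 with hs | hs
    · exact ⟨1, by simp, by simp [hs]⟩
    · have hs' : (‖s‖ : ℂ) ≠ 0 := by simpa using hs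
      refine ⟨star s / ‖s‖, by simp [hs], ?_⟩
      rw [div_mul_eq_mul_div, Complex.star_def, ← Complex.normSq_eq_conj_mul_self,
        Complex.normSq_eq_norm_sq]
      push_cast
      field_simp
  have h1 := hE.reQuad_add_sub_reQuad_sub a (c • b)
  have h2 := N.reQuad_add_reQuad_sub a (c • b)
  rw [mulVec_smul, dotProduct_smul, smul_eq_mul, hcs, Complex.ofReal_re] at h1
  rw [reQuad_smul, hc] at h2
  have h3 := h c hc
  have h4 := h (-c) (by rwa [norm_neg])
  rw [neg_smul, ← sub_eq_add_neg] at h4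
  -- Here `(u - w)² ≤ 2 (u² + w²)`; the parallelogram law for `N` then disposes of the cross terms.
  have h5 : (4 * ‖star a ⬝ᵥ E *ᵥ b‖) ^ 2
      ≤ 2 * (E.reQuad (a + c • b) ^ 2 + E.reQuad (a - c • b) ^ 2) := by
    rw [← h1]
    nlinarith [sq_nonneg (E.reQuad (a + c • b) + E.reQuad (a - c • b))]
  have h6 : K * N.reQuad (a + c • b) + K * N.reQuad (a - c • b)
      = K * (2 * N.reQuad a + 2 * N.reQuad b) := by
    rw [← mul_add, h2]
    ring
  nlinarith

end Polarization

/-! ### The form defining the Fisher information, and its independence of the eigenbasis -/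

section SLDForm

open Matrix

variable {d : ℕ}

/-- The form `2 ∑ Re(A_kl B_lk) / (p_k + p_l)`, restricted to the pairs of indices in `T`. -/
noncomputable def sldForm (T : Fin d → Fin d → Prop) (p : Fin d → ℝ)
    (A B : Matrix (Fin d) (Fin d) ℂ) : ℝ :=
  open Classical in
  2 * ∑ k, ∑ l, if T k l ∧ 0 < p k + p l then (A k l * B l k).re / (p k + p l) else 0

/-- The matrix with entries `2 A_kl / (p_k + p_l)`, or zero where the denominator is. -/
noncomputable def sldMatrix (p : Fin d → ℝ) (A : Matrix (Fin d) (Fin d) ℂ) :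
    Matrix (Fin d) (Fin d) ℂ :=
  Matrix.of fun k l => ((2 / (p k + p l) : ℝ) : ℂ) * A k l

/-- The convention `2 / 0 = 0` in `sldMatrix` takes over the role of the condition `0 < p k + p l`;
the trace form makes invariance under unitaries accessible. -/
theorem sldForm_eq_trace {p : Fin d → ℝ} (hp : ∀ k, 0 ≤ p k) (A B : Matrix (Fin d) (Fin d) ℂ) :
    sldForm (fun _ _ => True) p A B = (sldMatrix p A * B).trace.re := by
  simp only [sldForm, sldMatrix, trace, diag, mul_apply, Complex.re_sum, Finset.mul_sum,
    Matrix.of_apply, true_and]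
  refine Finset.sum_congr rfl fun k _ => Finset.sum_congr rfl fun l _ => ?_
  rw [mul_assoc, Complex.re_ofReal_mul]
  split_ifs with h
  · ring
  · have : p k + p l = 0 := le_antisymm (not_lt.1 h) (add_nonneg (hp k) (hp l))
    simp [this]

/-- A matrix commuting with `diag p` has nonzero entries only between indices with equal `p`, so the
weights `2 / (p k + p l)` pass through the conjugation. -/
theorem sldMatrix_conj {p : Fin d → ℝ} {W : Matrix (Fin d) (Fin d) ℂ}
    (hW : Commute W (diagonal fun k => (p k : ℂ))) (A : Matrix (Fin d) (Fin d) ℂ) :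
    sldMatrix p (Wᴴ * A * W) = Wᴴ * sldMatrix p A * W := by
  have h : ∀ k l, W k l ≠ 0 → p k = p l := by
    intro k l hkl
    have := congrFun (congrFun hW.eq k) l
    rw [mul_diagonal, diagonal_mul, mul_comm] at this
    exact_mod_cast (mul_right_cancel₀ hkl this).symm
  ext k l
  simp only [sldMatrix, mul_apply, Finset.sum_mul, Finset.mul_sum, Matrix.of_apply,
    conjTranspose_apply]
  refine Finset.sum_congr rfl fun b _ => Finset.sum_congr rfl fun a _ => ?_
  by_cases ha : W a k = 0
  · simp [ha]
  by_cases hb : W b l = 0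
  · simp [hb]
  rw [h a k ha, h b l hb]
  ring

/-- The form does not depend on the orthonormal eigenbasis. -/
theorem sldForm_conj_eq {p : Fin d → ℝ} (hp : ∀ k, 0 ≤ p k) {U V : Matrix (Fin d) (Fin d) ℂ}
    (hU : U ∈ unitaryGroup (Fin d) ℂ) (hV : V ∈ unitaryGroup (Fin d) ℂ)
    (h : U * (diagonal fun k => (p k : ℂ)) * Uᴴ = V * (diagonal fun k => (p k : ℂ)) * Vᴴ)
    (A B : Matrix (Fin d) (Fin d) ℂ) :
    sldForm (fun _ _ => True) p (Uᴴ * A * U) (Uᴴ * B * U) =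
      sldForm (fun _ _ => True) p (Vᴴ * A * V) (Vᴴ * B * V) := by
  have hU1 : Uᴴ * U = 1 := mem_unitaryGroup_iff'.1 hU
  have hU2 : U * Uᴴ = 1 := mem_unitaryGroup_iff.1 hU
  have hV1 : Vᴴ * V = 1 := mem_unitaryGroup_iff'.1 hV
  set D := diagonal fun k => (p k : ℂ)
  -- Two eigenbases for the same ordered eigenvalues differ by a unitary that commutes with `D`.
  have hW : Commute (Uᴴ * V) D := by
    calc Uᴴ * V * D = Uᴴ * (V * D * Vᴴ) * V := by
          simp only [Matrix.mul_assoc, hV1, Matrix.mul_one]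
      _ = Uᴴ * (U * D * Uᴴ) * V := by rw [h]
      _ = D * (Uᴴ * V) := by
          simp only [← Matrix.mul_assoc, hU1, Matrix.one_mul]
  have e : ∀ A : Matrix (Fin d) (Fin d) ℂ,
      Vᴴ * A * V = (Uᴴ * V)ᴴ * (Uᴴ * A * U) * (Uᴴ * V) := by
    intro A
    calc Vᴴ * A * V = Vᴴ * (U * Uᴴ) * A * (U * Uᴴ) * V := by rw [hU2]; simp
      _ = _ := by simp only [conjTranspose_mul, conjTranspose_conjTranspose, Matrix.mul_assoc]
  have hWW : (Uᴴ * V) * (Uᴴ * V)ᴴ = 1 := by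
    have hV2 : V * Vᴴ = 1 := mem_unitaryGroup_iff.1 hV
    rw [conjTranspose_mul, conjTranspose_conjTranspose, Matrix.mul_assoc, ← Matrix.mul_assoc V,
      hV2, Matrix.one_mul, hU1]
  rw [sldForm_eq_trace hp, sldForm_eq_trace hp, e A, e B, sldMatrix_conj hW]
  set W := Uᴴ * V
  set A' := sldMatrix p (Uᴴ * A * U)
  set B' := Uᴴ * B * U
  congr 1
  calc (A' * B').trace = (W * Wᴴ * (A' * (W * Wᴴ) * B')).trace := by rw [hWW]; simp
    _ = (Wᴴ * A' * W * (Wᴴ * B' * W)).trace := by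
      rw [Matrix.mul_assoc W, trace_mul_comm]
      simp only [Matrix.mul_assoc]

end SLDForm

/-! ### Eigenbasis of a density matrix -/

namespace DensityMatrix

open Matrix

variable {d : ℕ}

/-- The unitary matrix whose columns are the eigenvectors `ψ_k`. -/
noncomputable def eigenUnitary (ρ : DensityMatrix d) : Matrix (Fin d) (Fin d) ℂ :=
  ρ.posSemidef.isHermitian.eigenvectorUnitary

theorem eigenUnitary_mem (ρ : DensityMatrix d) : ρ.eigenUnitary ∈ unitaryGroup (Fin d) ℂ :=
  ρ.posSemidef.isHermitian.eigenvectorUnitary.2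

theorem eigenUnitary_conjTranspose_mul (ρ : DensityMatrix d) :
    ρ.eigenUnitaryᴴ * ρ.eigenUnitary = 1 := mem_unitaryGroup_iff'.1 ρ.eigenUnitary_mem

theorem eigenUnitary_mul_conjTranspose (ρ : DensityMatrix d) :
    ρ.eigenUnitary * ρ.eigenUnitaryᴴ = 1 := mem_unitaryGroup_iff.1 ρ.eigenUnitary_mem

theorem mat_eq (ρ : DensityMatrix d) :
    ρ.mat = ρ.eigenUnitary * (diagonal fun k => (ρ.eigenvalue k : ℂ)) * ρ.eigenUnitaryᴴ := by
  have := ρ.posSemidef.isHermitian.spectral_theorem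
  rwa [Unitary.conjStarAlgAut_apply] at this

theorem conj_mat_eq (ρ : DensityMatrix d) :
    ρ.eigenUnitaryᴴ * ρ.mat * ρ.eigenUnitary = diagonal fun k => (ρ.eigenvalue k : ℂ) := by
  conv_lhs => rw [ρ.mat_eq]
  simp only [← Matrix.mul_assoc, eigenUnitary_conjTranspose_mul, Matrix.one_mul]
  rw [Matrix.mul_assoc, eigenUnitary_conjTranspose_mul, Matrix.mul_one]

theorem eigenvalue_nonneg (ρ : DensityMatrix d) (k : Fin d) : 0 ≤ ρ.eigenvalue k :=
  ρ.posSemidef.eigenvalues_nonneg k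

/-- The `k`-th eigenvector. -/
noncomputable def eigenvector (ρ : DensityMatrix d) (k : Fin d) : Fin d → ℂ :=
  fun a => ρ.eigenUnitary a k

theorem element_eq_dotProduct (ρ : DensityMatrix d) (A : Matrix (Fin d) (Fin d) ℂ) (k l : Fin d) :
    ρ.element A k l = star (ρ.eigenvector k) ⬝ᵥ A *ᵥ ρ.eigenvector l := rfl

theorem element_eq_conj (ρ : DensityMatrix d) (A : Matrix (Fin d) (Fin d) ℂ) (k l : Fin d) :
    ρ.element A k l = (ρ.eigenUnitaryᴴ * A * ρ.eigenUnitary) k l := by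
  rw [element_eq_dotProduct, Matrix.mul_assoc, mul_apply]
  rfl

theorem reQuad_eigenvector (ρ : DensityMatrix d) (k : Fin d) :
    ρ.mat.reQuad (ρ.eigenvector k) = ρ.eigenvalue k :=
  (ρ.posSemidef.isHermitian.eigenvalues_eq k).symm

theorem norm_eigenvector_le (ρ : DensityMatrix d) (k a : Fin d) : ‖ρ.eigenvector k a‖ ≤ 1 :=
  entry_norm_bound_of_unitary ρ.eigenUnitary_mem a k

end DensityMatrix

section QFI

open Matrix

variable {n d : ℕ}

theorem qfi_eq_sldForm (ρ : (Fin n → ℝ) → DensityMatrix d) (x : Fin n → ℝ) (i j : Fin n) :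
    qfi ρ x i j = sldForm (fun _ _ => True) (ρ x).eigenvalue
      ((ρ x).eigenUnitaryᴴ * partialState ρ x i * (ρ x).eigenUnitary)
      ((ρ x).eigenUnitaryᴴ * partialState ρ x j * (ρ x).eigenUnitary) := by
  simp only [qfi, sldForm, of_apply, DensityMatrix.element_eq_conj, true_and]

theorem qfi_symm (ρ : (Fin n → ℝ) → DensityMatrix d) (x : Fin n → ℝ) (i j : Fin n) :
    qfi ρ x i j = qfi ρ x j i := by
  simp only [qfi, of_apply]
  rw [Finset.sum_comm]
  congr 1
  refine Finset.sum_congr rfl fun k _ => Finset.sum_congr rfl fun l _ => ?_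
  rw [add_comm, mul_comm]

end QFI

/-! ### Partial derivatives of positive semidefinite families -/

section MatPartial

open Matrix

variable {n : ℕ} {ι : Type*}

/-- The entrywise partial derivative of a matrix-valued function. -/
noncomputable def matPartial (A : (Fin n → ℝ) → Matrix ι ι ℂ) (y : Fin n → ℝ) (j : Fin n) :
    Matrix ι ι ℂ :=
  Matrix.of fun a b => fderiv ℝ (fun z => A z a b) y (Pi.single j 1)

variable {A : (Fin n → ℝ) → Matrix ι ι ℂ} {x : Fin n → ℝ}

theorem matPartial_isHermitian {y : Fin n → ℝ} (h : ∀ᶠ z in 𝓝 y, (A z).IsHermitian)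
    (j : Fin n) : (matPartial A y j).IsHermitian := by
  ext a b
  simp only [conjTranspose_apply, matPartial, of_apply]
  have e : (fun z => A z a b) =ᶠ[𝓝 y] fun z => star (A z b a) := by
    filter_upwards [h] with z hz
    exact (hz.apply a b).symm
  rw [e.fderiv_eq, fderiv_star]
  simp

theorem contDiffAt_matPartial {m : ℕ} (hA : ∀ a b, ContDiffAt ℝ (m + 1 : ℕ) (fun y => A y a b) x)
    (j : Fin n) (a b : ι) : ContDiffAt ℝ m (fun y => matPartial A y j a b) x := by
  have := (hA a b).fderiv_right (m := m) (by norm_cast)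
  exact this.clm_apply contDiffAt_const

variable [Fintype ι]

/-- The bound `2` on the entries accommodates the vectors `a + c b`, `|c| = 1`, of the polarization
step, where `a` and `b` have entries of norm at most `1`. -/
theorem Matrix.abs_reQuad_le (B : Matrix ι ι ℂ) {w : ι → ℂ} (hw : ∀ a, ‖w a‖ ≤ 2) :
    |B.reQuad w| ≤ 4 * ∑ a, ∑ b, ‖B a b‖ := by
  rw [reQuad_eq_sum, Finset.mul_sum]
  refine (Finset.abs_sum_le_sum_abs _ _).trans (Finset.sum_le_sum fun a _ => ?_)
  rw [Finset.mul_sum]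
  refine (Finset.abs_sum_le_sum_abs _ _).trans (Finset.sum_le_sum fun b _ => ?_)
  refine (Complex.abs_re_le_norm _).trans ?_
  rw [norm_mul, norm_mul, norm_star]
  have := hw a
  have := hw b
  gcongr
  nlinarith [norm_nonneg (w a), norm_nonneg (w b)]

/-- The derivative of the quadratic form along a coordinate line. -/
theorem hasDerivAt_reQuad_line (w : ι → ℂ) (y : Fin n → ℝ) (j : Fin n) (τ₀ τ : ℝ)
    (h : ∀ a b, DifferentiableAt ℝ (fun z => A z a b) (y + (τ - τ₀) • Pi.single j 1)) :
    HasDerivAt (fun τ => (A (y + (τ - τ₀) • Pi.single j 1)).reQuad w)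
      ((matPartial A (y + (τ - τ₀) • Pi.single j 1) j).reQuad w) τ := by
  have hl : HasDerivAt (fun τ : ℝ => y + (τ - τ₀) • (Pi.single j 1 : Fin n → ℝ))
      (Pi.single j 1) τ := by
    have := (((hasDerivAt_id τ).sub_const τ₀).smul_const
      (Pi.single j 1 : Fin n → ℝ)).const_add y
    simpa using this
  simp only [reQuad_eq_sum]
  refine HasDerivAt.fun_sum fun a _ => HasDerivAt.fun_sum fun b _ => ?_
  have h1 := (h a b).hasFDerivAt.comp_hasDerivAt τ hl
  have h2 := h1.const_mul (star (w a) * w b)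
  exact Complex.reCLM.hasFDerivAt.comp_hasDerivAt τ h2

theorem eventually_differentiableAt_entries {m : ℕ} (hm : m ≠ 0)
    (hA : ∀ a b, ContDiffAt ℝ m (fun y => A y a b) x) :
    ∀ᶠ y in 𝓝 x, ∀ a b, DifferentiableAt ℝ (fun z => A z a b) y := by
  refine Filter.eventually_all.2 fun a => Filter.eventually_all.2 fun b => ?_
  filter_upwards [(hA a b).eventually (by simp)] with y hy
  exact hy.differentiableAt (by simpa using hm)

theorem norm_single_smul (τ : ℝ) (j : Fin n) : ‖τ • (Pi.single j 1 : Fin n → ℝ)‖ = |τ| := by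
  rw [norm_smul, Real.norm_eq_abs, Pi.norm_single, norm_one, mul_one]

/-- Local data for a matrix-valued `C²` function. -/
theorem exists_ball_second_partial (hA : ∀ a b, ContDiffAt ℝ 2 (fun y => A y a b) x) (j : Fin n)
    {η : ℝ} (hη : 0 < η) : ∃ r > 0, ∀ y ∈ Metric.ball x r,
      (∀ a b, DifferentiableAt ℝ (fun z => A z a b) y) ∧
      (∀ a b, DifferentiableAt ℝ (fun z => matPartial A z j a b) y) ∧
      ∀ w : ι → ℂ, (∀ a, ‖w a‖ ≤ 2) →
        |(matPartial (fun z => matPartial A z j) y j).reQuad w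
          - (matPartial (fun z => matPartial A z j) x j).reQuad w| ≤ η := by
  have h1 : ∀ a b, ContDiffAt ℝ 1 (fun y => matPartial A y j a b) x :=
    contDiffAt_matPartial (m := 1) hA j
  have h2 : ∀ a b, ContDiffAt ℝ 0
      (fun y => matPartial (fun z => matPartial A z j) y j a b) x :=
    contDiffAt_matPartial (m := 0) (by simpa using h1) j
  set B := fun y => matPartial (fun z => matPartial A z j) y j with hB
  have h3 : Tendsto (fun y => 4 * ∑ a, ∑ b, ‖(B y - B x) a b‖) (𝓝 x) (𝓝 0) := by
    have : ContinuousAt (fun y => 4 * ∑ a, ∑ b, ‖(B y - B x) a b‖) x := by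
      refine ContinuousAt.mul continuousAt_const ?_
      refine tendsto_finsetSum _ fun a _ => tendsto_finsetSum _ fun b _ => ?_
      exact ((h2 a b).continuousAt.sub continuousAt_const).norm
    simpa [ContinuousAt] using this
  obtain ⟨r, hr, hball⟩ := Metric.eventually_nhds_iff_ball.1
    (((eventually_differentiableAt_entries two_ne_zero hA).and
      (eventually_differentiableAt_entries (m := 1) one_ne_zero (by simpa using h1))).and
      (h3.eventually_le_const hη))
  refine ⟨r, hr, fun y hy => ⟨(hball y hy).1.1, (hball y hy).1.2, fun w hw => ?_⟩⟩
  rw [← reQuad_sub_left]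
  exact (abs_reQuad_le _ hw).trans (hball y hy).2

theorem continuousAt_sum_norm_entries (hA : ∀ a b, ContinuousAt (fun y => A y a b) x) :
    ContinuousAt (fun y => 4 * ∑ a, ∑ b, ‖A y a b‖) x :=
  ContinuousAt.mul continuousAt_const
    (tendsto_finsetSum _ fun a _ => tendsto_finsetSum _ fun b _ => (hA a b).norm)

/-- The partial derivatives of a positive semidefinite family are controlled by the square root of
the family itself. -/
theorem exists_sq_reQuad_matPartial_le (hA : ∀ a b, ContDiffAt ℝ 2 (fun y => A y a b) x)
    (hpos : ∀ᶠ y in 𝓝 x, ∀ w, 0 ≤ (A y).reQuad w) :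
    ∃ C > 0, ∀ᶠ y in 𝓝 x, ∀ j, ∀ w : ι → ℂ, (∀ a, ‖w a‖ ≤ 2) →
      (matPartial A y j).reQuad w ^ 2 ≤ C * (A y).reQuad w := by
  have main : ∀ j, ∃ C > 0, ∀ᶠ y in 𝓝 x, ∀ w : ι → ℂ, (∀ a, ‖w a‖ ≤ 2) →
      (matPartial A y j).reQuad w ^ 2 ≤ C * (A y).reQuad w := by
    intro j
    obtain ⟨r₁, hr₁, h₁⟩ := exists_ball_second_partial hA j one_pos
    obtain ⟨r₂, hr₂, h₂⟩ := Metric.eventually_nhds_iff_ball.1 hpos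
    obtain ⟨r₃, hr₃, h₃⟩ := Metric.eventually_nhds_iff_ball.1
      ((continuousAt_sum_norm_entries fun a b => (hA a b).continuousAt).eventually_le_const
        (lt_add_one _))
    set M₀ := 4 * ∑ a, ∑ b, ‖A x a b‖
    set M₂ := 4 * ∑ a, ∑ b, ‖matPartial (fun z => matPartial A z j) x j a b‖
    have hM₀ : 0 ≤ M₀ := by positivity
    have hM₂ : 0 ≤ M₂ := by positivity
    obtain ⟨r, hr, hr1, hr2, hr3⟩ : ∃ r > 0, 2 * r ≤ r₁ ∧ 2 * r ≤ r₂ ∧ 2 * r ≤ r₃ :=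
      ⟨min r₁ (min r₂ r₃) / 2, by positivity,
        by linarith [min_le_left r₁ (min r₂ r₃)],
        by linarith [min_le_right r₁ (min r₂ r₃), min_le_left r₂ r₃],
        by linarith [min_le_right r₁ (min r₂ r₃), min_le_right r₂ r₃]⟩
    -- `M₂ + 1` bounds the second derivative along the line, and the last term ensures the
    -- requirement `f t ≤ L r²` of `sq_deriv_le_of_nonneg`.
    set L := M₂ + 1 + (M₀ + 1) / r ^ 2
    have hL : 0 < L := by positivity
    refine ⟨4 * L, by positivity, ?_⟩
    filter_upwards [Metric.ball_mem_nhds x hr] with y hy w hw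
    have hmem : ∀ τ : ℝ, |τ - 0| ≤ r →
        y + (τ - 0) • (Pi.single j 1 : Fin n → ℝ) ∈ Metric.ball x (2 * r) := by
      intro τ hτ
      rw [mem_ball_iff_norm] at hy ⊢
      have e : y + (τ - 0) • (Pi.single j 1 : Fin n → ℝ) - x
          = (y - x) + (τ - 0) • (Pi.single j 1 : Fin n → ℝ) := by abel
      rw [e]
      refine (norm_add_le _ _).trans_lt ?_
      rw [norm_single_smul]
      linarith
    have := sq_deriv_le_of_nonneg (t := 0) hr hL
      (f := fun τ => (A (y + (τ - 0) • Pi.single j 1)).reQuad w)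
      (f₁ := fun τ => (matPartial A (y + (τ - 0) • Pi.single j 1) j).reQuad w)
      (f₂ := fun τ => (matPartial (fun z => matPartial A z j)
        (y + (τ - 0) • Pi.single j 1) j).reQuad w)
      (fun τ hτ => hasDerivAt_reQuad_line w y j 0 τ
        (h₁ _ (Metric.ball_subset_ball hr1 (hmem τ hτ))).1)
      (fun τ hτ => hasDerivAt_reQuad_line (A := fun z => matPartial A z j) w y j 0 τ
        (h₁ _ (Metric.ball_subset_ball hr1 (hmem τ hτ))).2.1)
      (fun τ hτ => by
        have a1 := (h₁ _ (Metric.ball_subset_ball hr1 (hmem τ hτ))).2.2 w hw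
        have a2 := abs_reQuad_le (matPartial (fun z => matPartial A z j) x j) hw
        have a3 : 0 ≤ (M₀ + 1) / r ^ 2 := by positivity
        rw [abs_le] at a1 a2 ⊢
        constructor <;> linarith)
      (fun τ hτ => h₂ _ (Metric.ball_subset_ball hr2 (hmem τ hτ)) w)
      (by
        have a1 := h₃ _ (Metric.ball_subset_ball hr3 (hmem 0 (by simpa using hr.le)))
        have a2 := (le_abs_self _).trans (abs_reQuad_le (A (y + ((0 : ℝ) - 0) • Pi.single j 1)) hw)
        have a3 : L * r ^ 2 = (M₂ + 1) * r ^ 2 + (M₀ + 1) := by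
          simp only [L]
          field_simp
        have a4 : 0 ≤ (M₂ + 1) * r ^ 2 := by positivity
        linarith)
    simpa using this
  choose C hC h using main
  -- The sum dominates each `C j`; the summand `1` keeps the constant positive when there are no
  -- parameters.
  refine ⟨∑ j, C j + 1, add_pos_of_nonneg_of_pos (Finset.sum_nonneg fun j _ => (hC j).le) one_pos,
    ?_⟩
  filter_upwards [Filter.eventually_all.2 h, hpos] with y hy hy0 j w hw
  refine (hy j w hw).trans ?_
  have : C j ≤ ∑ j, C j := Finset.single_le_sum (fun j _ => (hC j).le) (Finset.mem_univ j)
  exact mul_le_mul_of_nonneg_right (by linarith) (hy0 w)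

/-- Near a zero `x` of a positive semidefinite family, along the `i`-th coordinate line through `x`,
the partial derivative `∂_i A` is `(2 / s) A` up to an error that is small compared with the square
root of `A`. -/
theorem eventually_sq_reQuad_matPartial_sub_le
    (hA : ∀ a b, ContDiffAt ℝ 2 (fun y => A y a b) x)
    (hpos : ∀ᶠ y in 𝓝 x, ∀ w, 0 ≤ (A y).reQuad w) (hx : A x = 0) (i : Fin n)
    {κ : ℝ} (hκ : 0 < κ) (hκ1 : κ ≤ 1) :
    ∀ᶠ s in 𝓝[≠] (0 : ℝ), ∀ᶠ y in 𝓝 (x + Pi.single i s), ∀ w : ι → ℂ, (∀ a, ‖w a‖ ≤ 2) →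
      (matPartial A y i - ((2 / s : ℝ) : ℂ) • A y).reQuad w ^ 2 ≤ 128 * κ * (A y).reQuad w := by
  obtain ⟨r₁, hr₁, h₁⟩ := exists_ball_second_partial hA i (pow_pos hκ 2)
  obtain ⟨r₂, hr₂, h₂⟩ := Metric.eventually_nhds_iff_ball.1 hpos
  obtain ⟨C, hC, hgrad⟩ := exists_sq_reQuad_matPartial_le hA hpos
  have hs : ∀ᶠ s in 𝓝[≠] (0 : ℝ), 3 * |s| < min r₁ r₂ := by
    have : Tendsto (fun s : ℝ => 3 * |s|) (𝓝[≠] 0) (𝓝 0) := by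
      have : Continuous fun s : ℝ => 3 * |s| := by fun_prop
      simpa using (this.tendsto 0).mono_left nhdsWithin_le_nhds
    exact this.eventually_lt_const (by positivity)
  filter_upwards [hs, self_mem_nhdsWithin] with s hs hs0
  have hs0 : s ≠ 0 := hs0
  have hs1 : 0 < |s| := abs_pos.2 hs0
  -- The coordinate line through `y` is parametrized so that `τ = s` is `y` itself and `τ = 0` is `y
  -- - s e_i`, which is close to `x` when `y` is close to `x + s e_i`.
  have hback : Tendsto (fun y : Fin n → ℝ => y + (0 - s) • (Pi.single i 1 : Fin n → ℝ))
      (𝓝 (x + Pi.single i s)) (𝓝 x) := by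
    have : Continuous fun y : Fin n → ℝ => y + (0 - s) • (Pi.single i 1 : Fin n → ℝ) := by
      fun_prop
    refine (this.tendsto' _ _ ?_)
    rw [← Pi.single_smul]
    simp [add_assoc, ← Pi.single_add]
  have hσ := (continuousAt_sum_norm_entries fun a b => (hA a b).continuousAt)
  have hσ0 : Tendsto (fun y => 4 * ∑ a, ∑ b, ‖A y a b‖) (𝓝 x) (𝓝 0) := by
    simpa [ContinuousAt, hx] using hσ
  -- As `A x = 0`, the value at `τ = 0` is as small as desired, and the square-root bound on the
  -- gradient makes the derivative there small too. The thresholds are those required of `f 0` and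
  -- `f₁ 0` in `sq_deriv_sub_le`.
  have e1 := (hσ0.comp hback).eventually_le_const (show 0 < κ ^ 2 * s ^ 2 by positivity)
  have e2 := (hσ0.comp hback).eventually_le_const (show 0 < (κ ^ 2 * |s|) ^ 2 / C by positivity)
  filter_upwards [e1, e2, hback.eventually hgrad, Metric.ball_mem_nhds _ hs1]
    with y hy1 hy2 hy3 hy4 w hw
  simp only [Function.comp] at hy1 hy2
  have hmem : ∀ τ : ℝ, |τ| ≤ 2 * |s| →
      y + (τ - s) • (Pi.single i 1 : Fin n → ℝ) ∈ Metric.ball x (min r₁ r₂) := by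
    intro τ hτ
    rw [mem_ball_iff_norm] at hy4 ⊢
    have e : y + (τ - s) • (Pi.single i 1 : Fin n → ℝ) - x
        = (y - (x + Pi.single i s)) + τ • (Pi.single i 1 : Fin n → ℝ) := by
      have : (Pi.single i s : Fin n → ℝ) = s • Pi.single i 1 := by simp [← Pi.single_smul]
      rw [this]
      module
    rw [e]
    refine (norm_add_le _ _).trans_lt ?_
    rw [norm_single_smul]
    linarith
  have hb1 := fun τ hτ => h₁ _ (Metric.ball_subset_ball (min_le_left r₁ r₂) (hmem τ hτ))
  have hb2 := fun τ hτ => h₂ _ (Metric.ball_subset_ball (min_le_right r₁ r₂) (hmem τ hτ))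
  have := sq_deriv_sub_le hs0 hκ hκ1
    (f := fun τ => (A (y + (τ - s) • Pi.single i 1)).reQuad w)
    (f₁ := fun τ => (matPartial A (y + (τ - s) • Pi.single i 1) i).reQuad w)
    (f₂ := fun τ => (matPartial (fun z => matPartial A z i)
      (y + (τ - s) • Pi.single i 1) i).reQuad w)
    (fun τ hτ => hasDerivAt_reQuad_line w y i s τ (hb1 τ hτ).1)
    (fun τ hτ => hasDerivAt_reQuad_line (A := fun z => matPartial A z i) w y i s τ (hb1 τ hτ).2.1)
    (fun τ hτ => (hb1 τ hτ).2.2 w hw) (fun τ hτ => hb2 τ hτ w)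
    ((abs_reQuad_le _ hw).trans hy1)
    (by
      refine abs_le_of_sq_le_sq ?_ (by positivity)
      refine (hy3 i w hw).trans ?_
      rw [le_div_iff₀ hC, mul_comm] at hy2
      refine le_trans ?_ hy2
      gcongr
      exact (le_abs_self _).trans (abs_reQuad_le _ hw))
  rw [reQuad_sub_left, reQuad_real_smul_left]
  simpa using this

end MatPartial

/-! ### Smooth block-diagonalization by the inverse function theorem -/

section BlockDiagonalization

open Matrix
open scoped Matrix.Norms.Operator

variable {d : ℕ}

/-- The Hermitian part. -/
noncomputable def hermPart : Matrix (Fin d) (Fin d) ℂ →ₗ[ℝ] Matrix (Fin d) (Fin d) ℂ where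
  toFun X := (1 / 2 : ℝ) • (X + Xᴴ)
  map_add' X Y := by
    rw [conjTranspose_add, ← smul_add]
    abel_nf
  map_smul' c X := by
    simp only [conjTranspose_smul, star_trivial, RingHom.id_apply, ← smul_add]
    rw [smul_comm]

theorem hermPart_apply (X : Matrix (Fin d) (Fin d) ℂ) : hermPart X = (1 / 2 : ℝ) • (X + Xᴴ) := rfl

theorem hermPart_isHermitian (X : Matrix (Fin d) (Fin d) ℂ) : (hermPart X).IsHermitian := by
  rw [IsHermitian, hermPart_apply, conjTranspose_smul, conjTranspose_add, conjTranspose_conjTranspose,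
    star_trivial, add_comm]

theorem conjTranspose_sub_hermPart (X : Matrix (Fin d) (Fin d) ℂ) :
    (X - hermPart X)ᴴ = -(X - hermPart X) := by
  rw [conjTranspose_sub, (hermPart_isHermitian X).eq, hermPart_apply]
  module

theorem hermPart_of_isHermitian {X : Matrix (Fin d) (Fin d) ℂ} (hX : X.IsHermitian) :
    hermPart X = X := by
  rw [hermPart_apply, hX.eq]
  module

variable (Z : Finset (Fin d))

/-- The block-diagonal part with respect to `Z` and its complement of the Hermitian part. -/
noncomputable def blockPart : Matrix (Fin d) (Fin d) ℂ →ₗ[ℝ] Matrix (Fin d) (Fin d) ℂ where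
  toFun X := Matrix.of fun k l => if (k ∈ Z ↔ l ∈ Z) then hermPart X k l else 0
  map_add' X Y := by
    ext k l
    by_cases hk : k ∈ Z <;> by_cases hl : l ∈ Z <;> simp [hk, hl]
  map_smul' c X := by
    ext k l
    by_cases hk : k ∈ Z <;> by_cases hl : l ∈ Z <;> simp [hk, hl]

/-- The off-diagonal part with respect to `Z` and its complement of the Hermitian part, made
skew-Hermitian by a change of sign of one block. -/
noncomputable def skewPart : Matrix (Fin d) (Fin d) ℂ →ₗ[ℝ] Matrix (Fin d) (Fin d) ℂ where
  toFun X := Matrix.of fun k l => if (k ∈ Z ↔ l ∈ Z) then 0 else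
    if k ∈ Z then -hermPart X k l else hermPart X k l
  map_add' X Y := by
    ext k l
    by_cases hk : k ∈ Z <;> by_cases hl : l ∈ Z <;> simp [hk, hl, add_comm]
  map_smul' c X := by
    ext k l
    by_cases hk : k ∈ Z <;> by_cases hl : l ∈ Z <;> simp [hk, hl]

theorem blockPart_apply (X : Matrix (Fin d) (Fin d) ℂ) (k l : Fin d) :
    blockPart Z X k l = if (k ∈ Z ↔ l ∈ Z) then hermPart X k l else 0 := rfl

theorem skewPart_apply (X : Matrix (Fin d) (Fin d) ℂ) (k l : Fin d) :
    skewPart Z X k l = if (k ∈ Z ↔ l ∈ Z) then 0 else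
      if k ∈ Z then -hermPart X k l else hermPart X k l := rfl

theorem blockPart_isHermitian (X : Matrix (Fin d) (Fin d) ℂ) : (blockPart Z X).IsHermitian := by
  ext k l
  have := (hermPart_isHermitian X).apply k l
  rw [conjTranspose_apply, blockPart_apply, blockPart_apply, ← this]
  by_cases hk : k ∈ Z <;> by_cases hl : l ∈ Z <;> simp [hk, hl]

theorem conjTranspose_skewPart (X : Matrix (Fin d) (Fin d) ℂ) :
    (skewPart Z X)ᴴ = -skewPart Z X := by
  ext k l
  have := (hermPart_isHermitian X).apply k l
  rw [conjTranspose_apply, Matrix.neg_apply, skewPart_apply, skewPart_apply, ← this]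
  by_cases hk : k ∈ Z <;> by_cases hl : l ∈ Z <;> simp [hk, hl]

theorem exp_skewPart_mem (X : Matrix (Fin d) (Fin d) ℂ) :
    NormedSpace.exp (skewPart Z X) ∈ unitaryGroup (Fin d) ℂ := by
  have h : Commute (skewPart Z X) (-skewPart Z X) := (Commute.refl _).neg_right
  rw [mem_unitaryGroup_iff, star_eq_conjTranspose, ← exp_conjTranspose, conjTranspose_skewPart,
    ← Matrix.exp_add_of_commute _ _ h, add_neg_cancel, NormedSpace.exp_zero]

/-- The conjugate of a block-diagonal Hermitian matrix by a unitary, plus a skew-Hermitian part. -/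
noncomputable def blockChart (X : Matrix (Fin d) (Fin d) ℂ) : Matrix (Fin d) (Fin d) ℂ :=
  NormedSpace.exp (skewPart Z X) * blockPart Z X * NormedSpace.exp (-skewPart Z X)
    + (X - hermPart X)

theorem hermPart_blockChart (X : Matrix (Fin d) (Fin d) ℂ) :
    hermPart (blockChart Z X) = NormedSpace.exp (skewPart Z X) * blockPart Z X *
      (NormedSpace.exp (skewPart Z X))ᴴ := by
  rw [← exp_conjTranspose, conjTranspose_skewPart, blockChart, map_add,
    hermPart_of_isHermitian, hermPart_apply (X - hermPart X), conjTranspose_sub_hermPart]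
  · simp
  · rw [IsHermitian, conjTranspose_mul, conjTranspose_mul, ← exp_conjTranspose, ← exp_conjTranspose,
      conjTranspose_neg, conjTranspose_skewPart, neg_neg, (blockPart_isHermitian Z X).eq,
      Matrix.mul_assoc]

/-- The derivative of `blockChart` at a diagonal matrix. -/
noncomputable def blockChartDeriv (D : Matrix (Fin d) (Fin d) ℂ) :
    Matrix (Fin d) (Fin d) ℂ →ₗ[ℝ] Matrix (Fin d) (Fin d) ℂ :=
  (LinearMap.mulRight ℝ D - LinearMap.mulLeft ℝ D) ∘ₗ skewPart Z + blockPart Z +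
    (LinearMap.id - hermPart)

/-- Off the blocks, the commutator of `skewPart Z X` with `D` multiplies entries of the Hermitian
part by `p l` or `p k` up to sign, whichever is nonzero; on the blocks `blockPart` returns the
entries. The skew-Hermitian summand of `blockChart` makes this an endomorphism of the whole matrix
space, for which injectivity is enough. -/
theorem blockChartDeriv_injective {p : Fin d → ℝ} (hZ : ∀ k, k ∈ Z ↔ p k = 0) :
    Function.Injective (blockChartDeriv Z (diagonal fun k => (p k : ℂ))) := by
  set D : Matrix (Fin d) (Fin d) ℂ := diagonal fun k => (p k : ℂ) with hD
  have hDh : Dᴴ = D := by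
    rw [hD, diagonal_conjTranspose]
    congr 1
    ext k
    simp
  rw [injective_iff_map_eq_zero]
  intro X hX
  have e : (skewPart Z X * D - D * skewPart Z X + blockPart Z X) + (X - hermPart X) = 0 := by
    simpa [blockChartDeriv] using hX
  have e' := congrArg conjTranspose e
  rw [conjTranspose_add, conjTranspose_sub_hermPart, conjTranspose_add, conjTranspose_sub,
    conjTranspose_mul, conjTranspose_mul, conjTranspose_skewPart, hDh,
    (blockPart_isHermitian Z X).eq, conjTranspose_zero] at e'
  -- The commutator of a skew-Hermitian and a Hermitian matrix is Hermitian, so adding the equation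
  -- to its adjoint isolates this part.
  have e1 : skewPart Z X * D - D * skewPart Z X + blockPart Z X = 0 := by
    have : (2 : ℝ) • (skewPart Z X * D - D * skewPart Z X + blockPart Z X) = 0 := by
      calc _ = ((skewPart Z X * D - D * skewPart Z X + blockPart Z X) + (X - hermPart X)) +
          (D * -skewPart Z X - -skewPart Z X * D + blockPart Z X + -(X - hermPart X)) := by
            rw [Matrix.mul_neg, Matrix.neg_mul]
            module
        _ = 0 := by rw [e, e', add_zero]
    exact (smul_eq_zero.1 this).resolve_left two_ne_zero
  have e2 : X = hermPart X := by
    rw [e1, zero_add, sub_eq_zero] at e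
    exact e
  rw [e2]
  ext k l
  have h := congrFun (congrFun e1 k) l
  simp only [Matrix.add_apply, Matrix.sub_apply, hD, mul_diagonal, diagonal_mul, Matrix.zero_apply, skewPart_apply,
    blockPart_apply] at h
  by_cases hk : k ∈ Z <;> by_cases hl : l ∈ Z
  · simpa [hk, hl] using h
  · have hk0 := (hZ k).1 hk
    have hl0 : p l ≠ 0 := fun h => hl ((hZ l).2 h)
    simpa [hk, hl, hk0, hl0] using h
  · have hl0 := (hZ l).1 hl
    have hk0 : p k ≠ 0 := fun h => hk ((hZ k).2 h)
    simpa [hk, hl, hk0, hl0] using h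
  · simpa [hk, hl] using h

theorem contDiff_exp_comp (T : Matrix (Fin d) (Fin d) ℂ →ₗ[ℝ] Matrix (Fin d) (Fin d) ℂ) :
    ContDiff ℝ 2 fun X => NormedSpace.exp (T X) := by
  have h1 : ContDiff ℝ 2 (NormedSpace.exp : Matrix (Fin d) (Fin d) ℂ → _) :=
    contDiff_iff_contDiffAt.2 fun X => (NormedSpace.exp_analytic (𝕂 := ℝ) X).contDiffAt
  exact h1.comp (LinearMap.toContinuousLinearMap T).contDiff

theorem contDiff_blockChart : ContDiff ℝ 2 (blockChart Z) := by
  have h1 := contDiff_exp_comp (skewPart Z)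
  have h2 := contDiff_exp_comp (-skewPart Z)
  have h3 : ContDiff ℝ 2 (blockPart Z) := (LinearMap.toContinuousLinearMap (blockPart Z)).contDiff
  have h4 : ContDiff ℝ 2 (hermPart (d := d)) :=
    (LinearMap.toContinuousLinearMap (hermPart (d := d))).contDiff
  exact ((h1.mul h3).mul h2).add (contDiff_id.sub h4)

theorem skewPart_diagonal (c : Fin d → ℝ) : skewPart Z (diagonal fun k => (c k : ℂ)) = 0 := by
  ext k l
  have : hermPart (diagonal fun k => (c k : ℂ)) = diagonal fun k => (c k : ℂ) :=
    hermPart_of_isHermitian (isHermitian_diagonal_iff.2 fun k => by simp [IsSelfAdjoint])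
  rw [skewPart_apply, this]
  by_cases hkl : k = l
  · simp [hkl]
  · simp [diagonal_apply_ne _ hkl]

theorem blockPart_diagonal (c : Fin d → ℝ) :
    blockPart Z (diagonal fun k => (c k : ℂ)) = diagonal fun k => (c k : ℂ) := by
  ext k l
  have : hermPart (diagonal fun k => (c k : ℂ)) = diagonal fun k => (c k : ℂ) :=
    hermPart_of_isHermitian (isHermitian_diagonal_iff.2 fun k => by simp [IsSelfAdjoint])
  rw [blockPart_apply, this]
  by_cases hkl : k = l
  · simp [hkl]
  · simp [diagonal_apply_ne _ hkl]

theorem blockChart_diagonal (c : Fin d → ℝ) :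
    blockChart Z (diagonal fun k => (c k : ℂ)) = diagonal fun k => (c k : ℂ) := by
  have : hermPart (diagonal fun k => (c k : ℂ)) = diagonal fun k => (c k : ℂ) :=
    hermPart_of_isHermitian (isHermitian_diagonal_iff.2 fun k => by simp [IsSelfAdjoint])
  rw [blockChart, skewPart_diagonal, blockPart_diagonal, this]
  simp

/-- At a diagonal matrix the skew part vanishes: both exponentials equal `1` there, with derivatives
`± skewPart Z`, and the product rule produces the commutator with `D`. -/
theorem hasFDerivAt_blockChart (c : Fin d → ℝ) :
    HasFDerivAt (blockChart Z)
      (LinearMap.toContinuousLinearMap (blockChartDeriv Z (diagonal fun k => (c k : ℂ))))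
      (diagonal fun k => (c k : ℂ)) := by
  set D : Matrix (Fin d) (Fin d) ℂ := diagonal fun k => (c k : ℂ)
  have hexp : HasFDerivAt (NormedSpace.exp : Matrix (Fin d) (Fin d) ℂ → _)
      (1 : Matrix (Fin d) (Fin d) ℂ →L[ℝ] Matrix (Fin d) (Fin d) ℂ) 0 :=
    hasFDerivAt_exp_zero
  have hS := (LinearMap.toContinuousLinearMap (skewPart Z)).hasFDerivAt (x := D)
  have h1 : HasFDerivAt (fun X => NormedSpace.exp (skewPart Z X))
      (LinearMap.toContinuousLinearMap (skewPart Z)) D := by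
    have h0 : HasFDerivAt (NormedSpace.exp : Matrix (Fin d) (Fin d) ℂ → _)
      (1 : Matrix (Fin d) (Fin d) ℂ →L[ℝ] Matrix (Fin d) (Fin d) ℂ)
        (LinearMap.toContinuousLinearMap (skewPart Z) D) := by
      rw [LinearMap.coe_toContinuousLinearMap', skewPart_diagonal]
      exact hexp
    exact h0.comp D hS
  have h2 : HasFDerivAt (fun X => NormedSpace.exp (-skewPart Z X))
      (-LinearMap.toContinuousLinearMap (skewPart Z)) D := by
    have h0 : HasFDerivAt (NormedSpace.exp : Matrix (Fin d) (Fin d) ℂ → _)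
      (1 : Matrix (Fin d) (Fin d) ℂ →L[ℝ] Matrix (Fin d) (Fin d) ℂ)
        (-LinearMap.toContinuousLinearMap (skewPart Z) D) := by
      rw [LinearMap.coe_toContinuousLinearMap', skewPart_diagonal, neg_zero]
      exact hexp
    exact h0.comp D hS.neg
  have h3 := (LinearMap.toContinuousLinearMap (blockPart Z)).hasFDerivAt (x := D)
  have h4 := (LinearMap.toContinuousLinearMap (hermPart (d := d))).hasFDerivAt (x := D)
  refine (((h1.mul' h3).mul' h2).add ((hasFDerivAt_id D).sub h4)).congr_fderiv ?_
  ext1 X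
  have e1 : skewPart Z D = 0 := skewPart_diagonal Z c
  have e2 : blockPart Z D = D := blockPart_diagonal Z c
  simp only [blockChartDeriv, LinearMap.coe_toContinuousLinearMap', e1, e2, neg_zero,
    NormedSpace.exp_zero, one_mul, Pi.mul_apply, MulOpposite.op_one, one_smul]
  change D * -skewPart Z X + (1 * blockPart Z X + skewPart Z X * D) +
    (X - hermPart X) = skewPart Z X * D - D * skewPart Z X + blockPart Z X + (X - hermPart X)
  rw [Matrix.mul_neg, Matrix.one_mul]
  abel

/-- Hermitian matrices near a diagonal matrix can be brought by a smoothly varying unitary to a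
block-diagonal form that splits off its kernel. -/
theorem exists_blockDiagonalization {p : Fin d → ℝ} (hZ : ∀ k, k ∈ Z ↔ p k = 0) :
    ∃ V N : Matrix (Fin d) (Fin d) ℂ → Matrix (Fin d) (Fin d) ℂ,
      ContDiffAt ℝ 2 V (diagonal fun k => (p k : ℂ)) ∧
      ContDiffAt ℝ 2 N (diagonal fun k => (p k : ℂ)) ∧
      V (diagonal fun k => (p k : ℂ)) = 1 ∧
      N (diagonal fun k => (p k : ℂ)) = (diagonal fun k => (p k : ℂ)) ∧
      (∀ R, V R ∈ unitaryGroup (Fin d) ℂ) ∧ (∀ R k l, ¬(k ∈ Z ↔ l ∈ Z) → N R k l = 0) ∧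
      ∀ᶠ R in 𝓝 (diagonal fun k => (p k : ℂ)), R.IsHermitian → R = V R * N R * (V R)ᴴ := by
  set D : Matrix (Fin d) (Fin d) ℂ := diagonal fun k => (p k : ℂ) with hD
  have hc := (contDiff_blockChart Z).contDiffAt (x := D)
  -- An injective endomorphism of a finite-dimensional space is invertible.
  let e : Matrix (Fin d) (Fin d) ℂ ≃L[ℝ] Matrix (Fin d) (Fin d) ℂ :=
    (LinearEquiv.ofInjectiveEndo (blockChartDeriv Z D)
      (blockChartDeriv_injective Z hZ)).toContinuousLinearEquiv
  have he : HasFDerivAt (blockChart Z)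
      (e : Matrix (Fin d) (Fin d) ℂ →L[ℝ] Matrix (Fin d) (Fin d) ℂ) D := by
    refine (hasFDerivAt_blockChart Z p).congr_fderiv ?_
    ext1 X
    rfl
  have h20 : (2 : WithTop ℕ∞) ≠ 0 := two_ne_zero
  set Ψ := hc.localInverse he h20
  have hΨ : ContDiffAt ℝ 2 Ψ D := by
    have := hc.to_localInverse he h20
    rwa [blockChart_diagonal] at this
  have hΨD : Ψ D = D := by
    have := hc.localInverse_apply_image he h20
    rwa [blockChart_diagonal] at this
  have hinv : ∀ᶠ R in 𝓝 D, blockChart Z (Ψ R) = R := by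
    have := (hc.hasStrictFDerivAt' he h20).eventually_right_inverse
    rwa [blockChart_diagonal] at this
  refine ⟨fun R => NormedSpace.exp (skewPart Z (Ψ R)), fun R => blockPart Z (Ψ R),
    (contDiff_exp_comp (skewPart Z)).contDiffAt.comp D hΨ,
    (LinearMap.toContinuousLinearMap (blockPart Z)).contDiff.contDiffAt.comp D hΨ, ?_, ?_,
    fun R => exp_skewPart_mem Z _, fun R k l hkl => ?_, ?_⟩
  · change NormedSpace.exp (skewPart Z (Ψ D)) = 1
    rw [hΨD, hD, skewPart_diagonal, NormedSpace.exp_zero]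
  · change blockPart Z (Ψ D) = D
    rw [hΨD, hD, blockPart_diagonal]
  · change blockPart Z (Ψ R) k l = 0
    rw [blockPart_apply, if_neg hkl]
  -- Taking Hermitian parts in `blockChart Z (Ψ R) = R` removes the skew-Hermitian summand and
  -- leaves the factorization.
  · filter_upwards [hinv] with R hR hRh
    rw [← hermPart_blockChart, hR, hermPart_of_isHermitian hRh]

end BlockDiagonalization

/-! ### Continuity of sorted eigenvalues, and limits of eigenbases -/

theorem Antitone.eq_of_map_univ_eq {m : ℕ} {f g : Fin m → ℝ} (hf : Antitone f) (hg : Antitone g)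
    (h : Multiset.map f Finset.univ.val = Multiset.map g Finset.univ.val) : f = g := by
  rw [← List.ofFn_inj]
  rw [Fin.univ_val_map, Fin.univ_val_map, Multiset.coe_eq_coe] at h
  exact h.eq_of_sortedGE hf.sortedGE_ofFn hg.sortedGE_ofFn

theorem Matrix.tendsto_nhds_iff {α ι κ R : Type*} [TopologicalSpace R] {l : Filter α}
    {f : α → Matrix ι κ R} {M : Matrix ι κ R} :
    Tendsto f l (𝓝 M) ↔ ∀ a b, Tendsto (fun y => f y a b) l (𝓝 (M a b)) :=
  tendsto_pi_nhds.trans (forall_congr' fun _ => tendsto_pi_nhds)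

/-- A function that is bounded converges along every ultrafilter. -/
theorem Ultrafilter.exists_tendsto_of_norm_le {α E : Type*} [NormedAddCommGroup E] [ProperSpace E]
    (g : Ultrafilter α) (f : α → E) (C : ℝ) (h : ∀ y, ‖f y‖ ≤ C) : ∃ a, Tendsto f g (𝓝 a) := by
  obtain ⟨a, -, ha⟩ := (isCompact_closedBall (0 : E) C).ultrafilter_le_nhds' (g.map f)
    (Ultrafilter.mem_map.2 (Filter.univ_mem' (f := (g : Filter α)) fun y => by simpa using h y))
  exact ⟨a, ha⟩

namespace DensityMatrix

open Matrix

variable {d : ℕ}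

theorem sum_eigenvalue (ρ : DensityMatrix d) : ∑ k, ρ.eigenvalue k = 1 := by
  have h := ρ.posSemidef.isHermitian.trace_eq_sum_eigenvalues
  rw [ρ.trace_eq_one] at h
  have : ((∑ k, ρ.eigenvalue k : ℝ) : ℂ) = 1 := by
    rw [h, Complex.ofReal_sum]
    rfl
  exact_mod_cast this

theorem eigenvalue_le_one (ρ : DensityMatrix d) (k : Fin d) : ρ.eigenvalue k ≤ 1 := by
  rw [← ρ.sum_eigenvalue]
  exact Finset.single_le_sum (fun l _ => ρ.eigenvalue_nonneg l) (Finset.mem_univ k)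

theorem charpoly_eq (ρ : DensityMatrix d) :
    ρ.mat.charpoly = ∏ k, (Polynomial.X - Polynomial.C ((ρ.eigenvalue k : ℝ) : ℂ)) :=
  ρ.posSemidef.isHermitian.charpoly_eq

variable {α : Type*}

/-- Along an ultrafilter along which a family of density matrices converges entrywise, the sorted
eigenvalues converge, and the eigenbases converge to an eigenbasis. -/
theorem exists_tendsto_eigen (g : Ultrafilter α) (ρ : α → DensityMatrix d) (σ : DensityMatrix d)
    (h : ∀ a b, Tendsto (fun y => (ρ y).mat a b) g (𝓝 (σ.mat a b))) :
    (∀ k, Tendsto (fun y => (ρ y).eigenvalue k) g (𝓝 (σ.eigenvalue k))) ∧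
      ∃ U ∈ unitaryGroup (Fin d) ℂ, Tendsto (fun y => (ρ y).eigenUnitary) g (𝓝 U) ∧
        U * (diagonal fun k => (σ.eigenvalue k : ℂ)) * Uᴴ = σ.mat := by
  -- Eigenbases need not converge along a neighbourhood filter, but entries and eigenvalues lie in
  -- compact sets, so they converge along an ultrafilter.
  have h1 : ∀ a b, ∃ u, Tendsto (fun y => (ρ y).eigenUnitary a b) g (𝓝 u) := fun a b =>
    g.exists_tendsto_of_norm_le _ 1 fun y => (ρ y).norm_eigenvector_le b a
  have h2 : ∀ k, ∃ q, Tendsto (fun y => (ρ y).eigenvalue k) g (𝓝 q) := fun k =>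
    g.exists_tendsto_of_norm_le _ 1 fun y => by
      rw [Real.norm_eq_abs, abs_of_nonneg ((ρ y).eigenvalue_nonneg k)]
      exact (ρ y).eigenvalue_le_one k
  choose u hu using h1
  choose q hq using h2
  set U : Matrix (Fin d) (Fin d) ℂ := Matrix.of u
  have hU : Tendsto (fun y => (ρ y).eigenUnitary) g (𝓝 U) :=
    Matrix.tendsto_nhds_iff.2 hu
  have hUs : Tendsto (fun y => (ρ y).eigenUnitaryᴴ) g (𝓝 Uᴴ) :=
    (Continuous.matrix_conjTranspose continuous_id).continuousAt.tendsto.comp hU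
  have hUm : U ∈ unitaryGroup (Fin d) ℂ := by
    rw [mem_unitaryGroup_iff]
    refine tendsto_nhds_unique (hU.mul hUs) ?_
    simp only [eigenUnitary_mul_conjTranspose]
    exact tendsto_const_nhds
  have hD : Tendsto (fun y => diagonal fun k => ((ρ y).eigenvalue k : ℂ)) g
      (𝓝 (diagonal fun k => (q k : ℂ))) := by
    have : Tendsto (fun y => fun k => ((ρ y).eigenvalue k : ℂ)) g (𝓝 fun k => (q k : ℂ)) := by
      rw [tendsto_pi_nhds]
      exact fun k => (Complex.continuous_ofReal.tendsto _).comp (hq k)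
    exact (Continuous.matrix_diagonal continuous_id).continuousAt.tendsto.comp this
  have hσ : U * (diagonal fun k => (q k : ℂ)) * Uᴴ = σ.mat := by
    refine tendsto_nhds_unique ((hU.mul hD).mul hUs) ?_
    simp only [← mat_eq]
    exact Matrix.tendsto_nhds_iff.2 h
  have hroots : Multiset.map (fun k => (q k : ℂ)) Finset.univ.val
      = Multiset.map (fun k => (σ.eigenvalue k : ℂ)) Finset.univ.val := by
    have e1 : σ.mat.charpoly.roots = Multiset.map (fun k => (q k : ℂ)) Finset.univ.val := by
      rw [← hσ, charpoly_mul_comm, ← mul_assoc]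
      have : Uᴴ * U = 1 := mem_unitaryGroup_iff'.1 hUm
      rw [this, one_mul, charpoly_diagonal, Polynomial.roots_prod]
      · simp
      · simp [Finset.prod_ne_zero_iff, Polynomial.X_sub_C_ne_zero]
    rw [← e1]
    exact σ.posSemidef.isHermitian.roots_charpoly_eq_eigenvalues
  -- The characteristic polynomial fixes the limits `q` only as a multiset. Passing to the limit
  -- preserves the decreasing order, and two decreasing enumerations of one multiset agree.
  have hqe : q = σ.eigenvalue := by
    set e : Fin (Fintype.card (Fin d)) ≃ Fin d := Fintype.equivOfCardEq (Fintype.card_fin _)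
    have key : ∀ τ : DensityMatrix d, τ.eigenvalue ∘ e = τ.posSemidef.isHermitian.eigenvalues₀ := by
      intro τ
      ext k
      simp [eigenvalue, IsHermitian.eigenvalues, e]
    have h0 : q ∘ e = σ.eigenvalue ∘ e := by
      refine Antitone.eq_of_map_univ_eq (fun k l hkl => ?_) ?_ ?_
      · refine le_of_tendsto_of_tendsto' (hq (e l)) (hq (e k)) fun y => ?_
        have := (ρ y).posSemidef.isHermitian.eigenvalues₀_antitone hkl
        rwa [← key (ρ y)] at this
      · rw [key]
        exact σ.posSemidef.isHermitian.eigenvalues₀_antitone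
      · have h3 := congrArg (Multiset.map Complex.re) hroots
        simp only [Multiset.map_map, Function.comp_def, Complex.ofReal_re] at h3
        have h4 : ∀ f : Fin d → ℝ, Multiset.map (f ∘ e) Finset.univ.val
            = Multiset.map f Finset.univ.val := by
          intro f
          rw [← Multiset.map_map]
          simp
        rw [h4, h4]
        exact h3
    exact e.surjective.injective_comp_right h0
  subst hqe
  exact ⟨hq, U, hUm, hU, hσ⟩

theorem tendsto_eigenvalue {l : Filter α} {ρ : α → DensityMatrix d} {σ : DensityMatrix d}
    (h : ∀ a b, Tendsto (fun y => (ρ y).mat a b) l (𝓝 (σ.mat a b))) (k : Fin d) :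
    Tendsto (fun y => (ρ y).eigenvalue k) l (𝓝 (σ.eigenvalue k)) := by
  rw [tendsto_iff_ultrafilter]
  exact fun g hg => (exists_tendsto_eigen g ρ σ fun a b => (h a b).mono_left hg).1 k

end DensityMatrix

/-! ### The nonsingular terms of the Fisher information -/

section RegularPart

open Matrix

variable {n d : ℕ}

/-- The terms of the quantum Fisher information in which at most one eigenvalue vanishes at `x`
depend continuously on the parameter at `x`. -/
theorem tendsto_sldForm_regular {ρ : (Fin n → ℝ) → DensityMatrix d} {x : Fin n → ℝ}
    (hρ : ∀ a b, ContDiffAt ℝ 2 (fun y => (ρ y).mat a b) x) (i j : Fin n) :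
    Tendsto (fun y => sldForm
        (fun k l => ¬((ρ x).eigenvalue k = 0 ∧ (ρ x).eigenvalue l = 0)) (ρ y).eigenvalue
        ((ρ y).eigenUnitaryᴴ * partialState ρ y i * (ρ y).eigenUnitary)
        ((ρ y).eigenUnitaryᴴ * partialState ρ y j * (ρ y).eigenUnitary))
      (𝓝 x) (𝓝 (qfi ρ x i j)) := by
  have hd : ∀ i, Tendsto (fun y => partialState ρ y i) (𝓝 x) (𝓝 (partialState ρ x i)) := by
    intro i
    refine Matrix.tendsto_nhds_iff.2 fun a b => ?_
    exact (contDiffAt_matPartial (A := fun y => (ρ y).mat) (m := 1) hρ i a b).continuousAt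
  rw [tendsto_iff_ultrafilter]
  intro g hg
  obtain ⟨hp, U, hU, hUt, hUx⟩ := DensityMatrix.exists_tendsto_eigen g ρ (ρ x)
    fun a b => (hρ a b).continuousAt.tendsto.mono_left hg
  have hUs : Tendsto (fun y => (ρ y).eigenUnitaryᴴ) g (𝓝 Uᴴ) :=
    (Continuous.matrix_conjTranspose continuous_id).continuousAt.tendsto.comp hUt
  have hA : ∀ i k l, Tendsto
      (fun y => ((ρ y).eigenUnitaryᴴ * partialState ρ y i * (ρ y).eigenUnitary) k l) g
      (𝓝 ((Uᴴ * partialState ρ x i * U) k l)) := by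
    intro i k l
    exact Matrix.tendsto_nhds_iff.1 ((hUs.mul ((hd i).mono_left hg)).mul hUt) k l
  -- The limiting eigenbasis `U` may differ from the chosen one at `x`, which is harmless by
  -- `sldForm_conj_eq`; the pairs in the kernel contribute nothing at `x` itself.
  have hlim : qfi ρ x i j = sldForm
      (fun k l => ¬((ρ x).eigenvalue k = 0 ∧ (ρ x).eigenvalue l = 0)) (ρ x).eigenvalue
      (Uᴴ * partialState ρ x i * U) (Uᴴ * partialState ρ x j * U) := by
    rw [qfi_eq_sldForm, sldForm_conj_eq (ρ x).eigenvalue_nonneg (ρ x).eigenUnitary_mem hU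
      (by rw [hUx, ← DensityMatrix.mat_eq])]
    simp only [sldForm]
    congr 1
    refine Finset.sum_congr rfl fun k _ => Finset.sum_congr rfl fun l _ => ?_
    by_cases h : (ρ x).eigenvalue k = 0 ∧ (ρ x).eigenvalue l = 0
    · simp [h.1, h.2]
    · simp [h]
  rw [hlim]
  simp only [sldForm]
  refine Tendsto.const_mul _ (tendsto_finsetSum _ fun k _ => tendsto_finsetSum _ fun l _ => ?_)
  by_cases h : (ρ x).eigenvalue k = 0 ∧ (ρ x).eigenvalue l = 0
  · simp [h]
  · have hpos : 0 < (ρ x).eigenvalue k + (ρ x).eigenvalue l := by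
      have h1 := (ρ x).eigenvalue_nonneg k
      have h2 := (ρ x).eigenvalue_nonneg l
      refine lt_of_le_of_ne (add_nonneg h1 h2) fun h0 => h ?_
      constructor <;> linarith
    simp only [h, not_false_eq_true, true_and, if_pos hpos]
    have h1 := ((Complex.continuous_re.tendsto _).comp
      ((hA i k l).mul (hA j l k))).div ((hp k).add (hp l)) hpos.ne'
    refine h1.congr' ?_
    filter_upwards [((hp k).add (hp l)).eventually_const_lt hpos] with y hy
    rw [if_pos hy]
    rfl

end RegularPart

/-! ### The block frame of a family, and smoothness of the vanishing sum -/

section BlockFrame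

open Matrix

variable {n d : ℕ}

/-- A unitary frame `V`, of class `C²` at `x`, that brings `ρ` near `x` to a form `N` which is
block-diagonal with respect to the kernel of `ρ x`. -/
structure IsBlockFrame (ρ : (Fin n → ℝ) → DensityMatrix d) (x : Fin n → ℝ)
    (V N : (Fin n → ℝ) → Matrix (Fin d) (Fin d) ℂ) : Prop where
  contDiffAt_frame : ∀ a b, ContDiffAt ℝ 2 (fun y => V y a b) x
  contDiffAt_block : ∀ a b, ContDiffAt ℝ 2 (fun y => N y a b) x
  unitary : ∀ y, V y ∈ unitaryGroup (Fin d) ℂ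
  mat_eq : ∀ᶠ y in 𝓝 x, (ρ y).mat = V y * N y * (V y)ᴴ
  frame_self : V x = (ρ x).eigenUnitary
  block_self : N x = diagonal fun k => ((ρ x).eigenvalue k : ℂ)
  block_eq_zero : ∀ y k l, ¬((ρ x).eigenvalue k = 0 ↔ (ρ x).eigenvalue l = 0) → N y k l = 0

open scoped Matrix.Norms.Operator in
-- The block-diagonalization near a diagonal matrix is composed with `ρ y` written in the eigenbasis
-- of `ρ x`, where it is diagonal for `y = x`.
theorem exists_isBlockFrame {ρ : (Fin n → ℝ) → DensityMatrix d} {x : Fin n → ℝ}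
    (hρ : ∀ a b, ContDiffAt ℝ 2 (fun y => (ρ y).mat a b) x) : ∃ V N, IsBlockFrame ρ x V N := by
  set Z : Finset (Fin d) := Finset.univ.filter fun k => (ρ x).eigenvalue k = 0
  have hZ : ∀ k, k ∈ Z ↔ (ρ x).eigenvalue k = 0 := by simp [Z]
  obtain ⟨V, N, hV, hN, hV1, hN1, hVu, hN0, hev⟩ := exists_blockDiagonalization Z hZ
  set D : Matrix (Fin d) (Fin d) ℂ := diagonal fun k => ((ρ x).eigenvalue k : ℂ)
  set U := (ρ x).eigenUnitary
  have hU1 : Uᴴ * U = 1 := (ρ x).eigenUnitary_conjTranspose_mul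
  have hU2 : U * Uᴴ = 1 := (ρ x).eigenUnitary_mul_conjTranspose
  let R : (Fin n → ℝ) → Matrix (Fin d) (Fin d) ℂ := fun y => Uᴴ * (ρ y).mat * U
  have hRx : R x = D := (ρ x).conj_mat_eq
  have hR : ContDiffAt ℝ 2 R x := by
    let T : (Fin d → Fin d → ℂ) →ₗ[ℝ] Matrix (Fin d) (Fin d) ℂ :=
      (LinearMap.mulLeft ℝ Uᴴ ∘ₗ LinearMap.mulRight ℝ U) ∘ₗ (Matrix.ofLinearEquiv ℝ).toLinearMap
    have h1 : ContDiffAt ℝ 2 (fun y => fun a b => (ρ y).mat a b) x :=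
      contDiffAt_pi.2 fun a => contDiffAt_pi.2 fun b => hρ a b
    have h2 := (LinearMap.toContinuousLinearMap T).contDiff.contDiffAt.comp x h1
    refine h2.congr_of_eventuallyEq (Eventually.of_forall fun y => ?_)
    exact Matrix.mul_assoc _ _ _
  have entry : ∀ (F : Matrix (Fin d) (Fin d) ℂ → Matrix (Fin d) (Fin d) ℂ), ContDiffAt ℝ 2 F D →
      ∀ a b, ContDiffAt ℝ 2 (fun y => F (R y) a b) x := by
    intro F hF a b
    rw [← hRx] at hF
    exact (LinearMap.toContinuousLinearMap
      (Matrix.entryLinearMap ℝ ℂ a b)).contDiff.contDiffAt.comp x (hF.comp x hR)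
  refine ⟨fun y => U * V (R y), fun y => N (R y), fun a b => ?_, entry N hN,
    fun y => mul_mem (ρ x).eigenUnitary_mem (hVu _), ?_, ?_, ?_, fun y k l hkl => ?_⟩
  · simp only [mul_apply]
    exact ContDiffAt.sum fun c _ => contDiffAt_const.mul (entry V hV c b)
  · have hcont : Tendsto R (𝓝 x) (𝓝 D) := by
      rw [← hRx]
      exact hR.continuousAt
    filter_upwards [hcont.eventually hev] with y hy
    have hRh : (R y).IsHermitian := by
      rw [IsHermitian, conjTranspose_mul, conjTranspose_mul, conjTranspose_conjTranspose,
        (ρ y).posSemidef.isHermitian.eq]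
      exact (Matrix.mul_assoc _ _ _).symm
    have h1 := hy hRh
    calc (ρ y).mat = U * (R y) * Uᴴ := by
          simp only [R, ← Matrix.mul_assoc, hU2, Matrix.one_mul]
          rw [Matrix.mul_assoc, hU2, Matrix.mul_one]
      _ = _ := by
          conv_lhs => rw [h1]
          simp only [conjTranspose_mul, Matrix.mul_assoc]
  · change U * V (R x) = U
    rw [hRx, hV1, Matrix.mul_one]
  · change N (R x) = D
    rw [hRx, hN1]
  · exact hN0 _ k l (by rwa [hZ, hZ])

namespace IsBlockFrame

variable {ρ : (Fin n → ℝ) → DensityMatrix d} {x : Fin n → ℝ}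
  {V N : (Fin n → ℝ) → Matrix (Fin d) (Fin d) ℂ}

theorem conjTranspose_mul_self (h : IsBlockFrame ρ x V N) (y : Fin n → ℝ) : (V y)ᴴ * V y = 1 :=
  mem_unitaryGroup_iff'.1 (h.unitary y)

theorem mul_conjTranspose_self (h : IsBlockFrame ρ x V N) (y : Fin n → ℝ) : V y * (V y)ᴴ = 1 :=
  mem_unitaryGroup_iff.1 (h.unitary y)

theorem eventually_block_eq (h : IsBlockFrame ρ x V N) :
    ∀ᶠ y in 𝓝 x, N y = (V y)ᴴ * (ρ y).mat * V y := by
  filter_upwards [h.mat_eq] with y hy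
  rw [hy]
  simp only [← Matrix.mul_assoc, h.conjTranspose_mul_self, Matrix.one_mul]
  rw [Matrix.mul_assoc, h.conjTranspose_mul_self, Matrix.mul_one]

theorem eventually_block_posSemidef (h : IsBlockFrame ρ x V N) :
    ∀ᶠ y in 𝓝 x, (N y).PosSemidef := by
  filter_upwards [h.eventually_block_eq] with y hy
  rw [hy]
  exact (ρ y).posSemidef.conjTranspose_mul_mul_same _

/-- The eigenvectors of `ρ y` in the frame `V y`. -/
noncomputable def eigenFrame (ρ : (Fin n → ℝ) → DensityMatrix d)
    (V : (Fin n → ℝ) → Matrix (Fin d) (Fin d) ℂ) (y : Fin n → ℝ) : Matrix (Fin d) (Fin d) ℂ :=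
  (V y)ᴴ * (ρ y).eigenUnitary

theorem eigenFrame_mem (h : IsBlockFrame ρ x V N) (y : Fin n → ℝ) :
    eigenFrame ρ V y ∈ unitaryGroup (Fin d) ℂ :=
  mul_mem (Unitary.star_mem (h.unitary y)) (ρ y).eigenUnitary_mem

theorem eventually_block_mul_eigenFrame (h : IsBlockFrame ρ x V N) :
    ∀ᶠ y in 𝓝 x, N y * eigenFrame ρ V y =
      eigenFrame ρ V y * diagonal fun k => ((ρ y).eigenvalue k : ℂ) := by
  filter_upwards [h.eventually_block_eq] with y hy
  have h1 : (ρ y).mat * (ρ y).eigenUnitary =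
      (ρ y).eigenUnitary * diagonal fun k => ((ρ y).eigenvalue k : ℂ) := by
    conv_lhs => rw [(ρ y).mat_eq]
    rw [Matrix.mul_assoc, (ρ y).eigenUnitary_conjTranspose_mul, Matrix.mul_one]
  calc N y * eigenFrame ρ V y = (V y)ᴴ * (ρ y).mat * (V y * (V y)ᴴ) * (ρ y).eigenUnitary := by
        rw [hy, eigenFrame]
        simp only [Matrix.mul_assoc]
    _ = (V y)ᴴ * ((ρ y).mat * (ρ y).eigenUnitary) := by
        rw [h.mul_conjTranspose_self, Matrix.mul_one, Matrix.mul_assoc]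
    _ = _ := by rw [h1, ← Matrix.mul_assoc, eigenFrame]

theorem tendsto_eigenvalue (hρ : ∀ a b, ContDiffAt ℝ 2 (fun y => (ρ y).mat a b) x) (k : Fin d) :
    Tendsto (fun y => (ρ y).eigenvalue k) (𝓝 x) (𝓝 ((ρ x).eigenvalue k)) :=
  DensityMatrix.tendsto_eigenvalue (fun a b => (hρ a b).continuousAt.tendsto) k

end IsBlockFrame

/-- The positive eigenvalues are bounded below. -/
theorem DensityMatrix.exists_gap (σ : DensityMatrix d) :
    ∃ c > 0, ∀ k, σ.eigenvalue k ≠ 0 → c ≤ σ.eigenvalue k := by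
  have h : ∀ k, ∃ c > 0, σ.eigenvalue k ≠ 0 → c ≤ σ.eigenvalue k := by
    intro k
    by_cases hk : σ.eigenvalue k = 0
    · exact ⟨1, one_pos, fun h => absurd hk h⟩
    · exact ⟨_, lt_of_le_of_ne (σ.eigenvalue_nonneg k) (Ne.symm hk), fun _ => le_rfl⟩
  choose c hc h using h
  rcases isEmpty_or_nonempty (Fin d) with he | he
  · exact ⟨1, one_pos, fun k => (he.false k).elim⟩
  · obtain ⟨k₀, hk₀⟩ := Finite.exists_min c
    exact ⟨c k₀, hc k₀, fun k hk => (hk₀ k).trans (h k hk)⟩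

namespace IsBlockFrame

variable {ρ : (Fin n → ℝ) → DensityMatrix d} {x : Fin n → ℝ}
  {V N : (Fin n → ℝ) → Matrix (Fin d) (Fin d) ℂ}

/-- Near `x`, the eigenvectors in the frame respect the two blocks. -/
theorem eventually_eigenFrame_eq_zero (h : IsBlockFrame ρ x V N)
    (hρ : ∀ a b, ContDiffAt ℝ 2 (fun y => (ρ y).mat a b) x) :
    ∀ᶠ y in 𝓝 x, ∀ a k, ¬((ρ x).eigenvalue a = 0 ↔ (ρ x).eigenvalue k = 0) →
      eigenFrame ρ V y a k = 0 := by
  obtain ⟨c, hc, hgap⟩ := (ρ x).exists_gap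
  have h1 : ∀ᶠ y in 𝓝 x, ∀ k, |(ρ y).eigenvalue k - (ρ x).eigenvalue k| < c / 2 := by
    refine Filter.eventually_all.2 fun k => ?_
    have := (tendsto_eigenvalue hρ k).eventually (Metric.ball_mem_nhds _ (half_pos hc))
    simpa [Real.dist_eq] using this
  have h2 : ∀ᶠ y in 𝓝 x, ∑ a, ∑ b, ‖(N y - N x) a b‖ < c / 2 := by
    have : Tendsto (fun y => ∑ a, ∑ b, ‖(N y - N x) a b‖) (𝓝 x) (𝓝 0) := by
      have : ContinuousAt (fun y => ∑ a, ∑ b, ‖(N y - N x) a b‖) x :=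
        tendsto_finsetSum _ fun a _ => tendsto_finsetSum _ fun b _ =>
          ((h.contDiffAt_block a b).continuousAt.sub continuousAt_const).norm
      simpa [ContinuousAt] using this
    exact this.eventually_lt_const (half_pos hc)
  filter_upwards [h1, h2, h.eventually_block_mul_eigenFrame] with y hy1 hy2 hy3
  intro a₀ k hak₀
  set C := eigenFrame ρ V y
  classical
  set T : Finset (Fin d) := Finset.univ.filter fun a =>
    ¬((ρ x).eigenvalue a = 0 ↔ (ρ x).eigenvalue k = 0) with hT
  -- Among the entries of column `k` in the wrong block, take the largest. The eigenvector equation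
  -- in row `a` multiplies it by an eigenvalue difference of size at least `c / 2`, whereas the row
  -- of `N y - N x`, of sum less than `c / 2`, pairs only with entries of the wrong block.
  obtain ⟨a, haT, hmax⟩ := T.exists_max_image (fun a => ‖C a k‖) ⟨a₀, by simpa [hT] using hak₀⟩
  have hak : ¬((ρ x).eigenvalue a = 0 ↔ (ρ x).eigenvalue k = 0) := by simpa [hT] using haT
  suffices hz : ‖C a k‖ = 0 by
    have := hmax a₀ (by simpa [hT] using hak₀)
    rw [hz] at this
    exact norm_le_zero_iff.1 this
  have heq : (N y - N x) a ⬝ᵥ (fun b => C b k) =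
      (((ρ y).eigenvalue k - (ρ x).eigenvalue a : ℝ) : ℂ) * C a k := by
    have e1 : ∑ b, N y a b * C b k = C a k * ((ρ y).eigenvalue k : ℂ) := by
      have := congrFun (congrFun hy3 a) k
      rwa [mul_diagonal, mul_apply] at this
    have e2 : ∑ b, N x a b * C b k = ((ρ x).eigenvalue a : ℂ) * C a k := by
      rw [h.block_self, ← mul_apply, diagonal_mul]
    simp only [dotProduct, Matrix.sub_apply, sub_mul, Finset.sum_sub_distrib, e1, e2]
    push_cast
    ring
  have hle : ‖(N y - N x) a ⬝ᵥ (fun b => C b k)‖ ≤ (∑ b, ‖(N y - N x) a b‖) * ‖C a k‖ := by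
    rw [Finset.sum_mul]
    refine (norm_sum_le _ _).trans (Finset.sum_le_sum fun b _ => ?_)
    rw [norm_mul]
    by_cases hb : b ∈ T
    · exact mul_le_mul_of_nonneg_left (hmax b hb) (norm_nonneg _)
    · have hbk : ((ρ x).eigenvalue b = 0 ↔ (ρ x).eigenvalue k = 0) := by
        simpa [hT] using hb
      have hab : ¬((ρ x).eigenvalue a = 0 ↔ (ρ x).eigenvalue b = 0) := by rwa [hbk]
      rw [Matrix.sub_apply, h.block_eq_zero y a b hab, h.block_eq_zero x a b hab]
      simp
  have hrow : ∑ b, ‖(N y - N x) a b‖ < c / 2 :=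
    (Finset.single_le_sum (f := fun a => ∑ b, ‖(N y - N x) a b‖)
      (fun a _ => by positivity) (Finset.mem_univ a)).trans_lt hy2
  have hdiff : c / 2 ≤ |(ρ y).eigenvalue k - (ρ x).eigenvalue a| := by
    have hk := hy1 k
    rw [abs_lt] at hk
    rw [le_abs]
    by_cases ha : (ρ x).eigenvalue a = 0
    · have hk0 : (ρ x).eigenvalue k ≠ 0 := fun h0 => hak (by simp [ha, h0])
      have := hgap k hk0
      left
      linarith
    · have hk0 : (ρ x).eigenvalue k = 0 := by
        by_contra h0
        exact hak (by simp [ha, h0])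
      have := hgap a ha
      right
      linarith
  rw [heq, norm_mul, Complex.norm_real, Real.norm_eq_abs] at hle
  by_contra hne
  have hpos : 0 < ‖C a k‖ := lt_of_le_of_ne (norm_nonneg _) (Ne.symm hne)
  have := le_of_mul_le_mul_right hle hpos
  linarith

end IsBlockFrame

/-- The partial trace over a block is invariant under unitaries that respect the blocks. -/
theorem sum_conj_block_eq {C : Matrix (Fin d) (Fin d) ℂ} (hC : C ∈ unitaryGroup (Fin d) ℂ)
    (Z : Finset (Fin d)) (hZ : ∀ a k, ¬(a ∈ Z ↔ k ∈ Z) → C a k = 0)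
    (B : Matrix (Fin d) (Fin d) ℂ) : ∑ k ∈ Z, (Cᴴ * B * C) k k = ∑ k ∈ Z, B k k := by
  classical
  set P : Matrix (Fin d) (Fin d) ℂ := diagonal fun k => if k ∈ Z then 1 else 0 with hP
  have tr : ∀ A : Matrix (Fin d) (Fin d) ℂ, ∑ k ∈ Z, A k k = (A * P).trace := by
    intro A
    simp only [trace, diag, hP, mul_diagonal, mul_ite, mul_one, mul_zero]
    rw [Finset.sum_ite_mem, Finset.univ_inter]
  -- Respecting the blocks means commuting with the projection `P` onto `Z`, so cyclicity of the
  -- trace applies.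
  have hCP : C * P = P * C := by
    ext a k
    rw [hP, mul_diagonal, diagonal_mul]
    by_cases h : a ∈ Z ↔ k ∈ Z
    · by_cases ha : a ∈ Z
      · simp [ha, h.1 ha]
      · have hk : k ∉ Z := fun hk => ha (h.2 hk)
        simp [ha, hk]
    · simp [hZ a k h]
  have hCC : C * Cᴴ = 1 := mem_unitaryGroup_iff.1 hC
  rw [tr, tr, Matrix.mul_assoc, hCP, Matrix.mul_assoc, trace_mul_comm, Matrix.mul_assoc,
    Matrix.mul_assoc, hCC, Matrix.mul_one]

namespace IsBlockFrame

variable {ρ : (Fin n → ℝ) → DensityMatrix d} {x : Fin n → ℝ}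
  {V N : (Fin n → ℝ) → Matrix (Fin d) (Fin d) ℂ}

theorem conj_eigenFrame (h : IsBlockFrame ρ x V N) :
    ∀ᶠ y in 𝓝 x, (eigenFrame ρ V y)ᴴ * N y * eigenFrame ρ V y =
      diagonal fun k => ((ρ y).eigenvalue k : ℂ) := by
  filter_upwards [h.eventually_block_mul_eigenFrame] with y hy
  have hC : (eigenFrame ρ V y)ᴴ * eigenFrame ρ V y = 1 := mem_unitaryGroup_iff'.1 (h.eigenFrame_mem y)
  rw [Matrix.mul_assoc, hy, ← Matrix.mul_assoc, hC, Matrix.one_mul]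

/-- The eigenvectors in the frame respect the blocks near `x`, so the eigenvalues with index in `Z`
sum to the partial trace of `N`. This is what makes the sum `C²` even where its summands are not. -/
theorem eventually_vanishingSum_eq (h : IsBlockFrame ρ x V N)
    (hρ : ∀ a b, ContDiffAt ℝ 2 (fun y => (ρ y).mat a b) x) :
    ∀ᶠ y in 𝓝 x, vanishingSum ρ x y = ∑ k with (ρ x).eigenvalue k = 0, (N y k k).re := by
  filter_upwards [h.eventually_eigenFrame_eq_zero hρ, h.conj_eigenFrame] with y hy1 hy2
  have := sum_conj_block_eq (h.eigenFrame_mem y)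
    (Finset.univ.filter fun k => (ρ x).eigenvalue k = 0) (by simpa using hy1) (N y)
  rw [hy2] at this
  have := congrArg Complex.re this
  simpa [vanishingSum] using this

theorem contDiffAt_vanishingSum (h : IsBlockFrame ρ x V N)
    (hρ : ∀ a b, ContDiffAt ℝ 2 (fun y => (ρ y).mat a b) x) :
    ContDiffAt ℝ 2 (vanishingSum ρ x) x := by
  refine ContDiffAt.congr_of_eventuallyEq ?_ (h.eventually_vanishingSum_eq hρ)
  exact ContDiffAt.sum fun k _ =>
    Complex.reCLM.contDiff.contDiffAt.comp x (h.contDiffAt_block k k)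

end IsBlockFrame

end BlockFrame

/-! ### Derivatives of the family in its eigenbasis -/

section MatPartialAlgebra

open Matrix

variable {n : ℕ} {ι : Type*} {A B : (Fin n → ℝ) → Matrix ι ι ℂ} {y : Fin n → ℝ}

theorem matPartial_congr (h : A =ᶠ[𝓝 y] B) (j : Fin n) : matPartial A y j = matPartial B y j := by
  ext a b
  simp only [matPartial, of_apply]
  have : (fun z => A z a b) =ᶠ[𝓝 y] fun z => B z a b := h.mono fun z hz => by simp only [hz]
  rw [this.fderiv_eq]

theorem matPartial_conjTranspose (j : Fin n) :
    matPartial (fun z => (A z)ᴴ) y j = (matPartial A y j)ᴴ := by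
  ext a b
  simp only [matPartial, of_apply, conjTranspose_apply, fderiv_star]
  rfl

theorem matPartial_mul [Fintype ι] (hA : ∀ a b, DifferentiableAt ℝ (fun z => A z a b) y)
    (hB : ∀ a b, DifferentiableAt ℝ (fun z => B z a b) y) (j : Fin n) :
    matPartial (fun z => A z * B z) y j = matPartial A y j * B y + A y * matPartial B y j := by
  ext a b
  simp only [matPartial, of_apply, Matrix.add_apply, mul_apply]
  have hs : HasFDerivAt (fun z => ∑ c, A z a c * B z c b)
      (∑ c, (A y a c • fderiv ℝ (fun z => B z c b) y + B y c b • fderiv ℝ (fun z => A z a c) y)) y :=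
    HasFDerivAt.fun_sum fun c _ => (hA a c).hasFDerivAt.mul (hB c b).hasFDerivAt
  rw [hs.fderiv, _root_.sum_apply, ← Finset.sum_add_distrib]
  refine Finset.sum_congr rfl fun c _ => ?_
  simp only [_root_.add_apply, _root_.smul_apply, smul_eq_mul]
  ring

end MatPartialAlgebra

section Derivatives

open Matrix

variable {n d : ℕ} {ρ : (Fin n → ℝ) → DensityMatrix d} {x : Fin n → ℝ}

/-- The matrix of `∂_j ρ` in the eigenbasis of `ρ y`. -/
noncomputable def eigenPartial (ρ : (Fin n → ℝ) → DensityMatrix d) (y : Fin n → ℝ) (j : Fin n) :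
    Matrix (Fin d) (Fin d) ℂ :=
  (ρ y).eigenUnitaryᴴ * partialState ρ y j * (ρ y).eigenUnitary

theorem partialState_isHermitian (ρ : (Fin n → ℝ) → DensityMatrix d) (y : Fin n → ℝ) (j : Fin n) :
    (partialState ρ y j).IsHermitian :=
  matPartial_isHermitian (A := fun y => (ρ y).mat)
    (Eventually.of_forall fun z => (ρ z).posSemidef.isHermitian) j

theorem Matrix.PosSemidef.reQuad_nonneg {ι : Type*} [Fintype ι] {A : Matrix ι ι ℂ}
    (hA : A.PosSemidef) (w : ι → ℂ) : 0 ≤ A.reQuad w :=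
  (Complex.le_def.1 (hA.dotProduct_mulVec_nonneg w)).1

/-- The matrix elements of `∂_j ρ` are controlled by the square roots of the eigenvalues. -/
theorem exists_norm_eigenPartial_le (hρ : ∀ a b, ContDiffAt ℝ 2 (fun y => (ρ y).mat a b) x) :
    ∃ A > 0, ∀ᶠ y in 𝓝 x, ∀ j k l, ‖eigenPartial ρ y j k l‖ ≤
      A * √((ρ y).eigenvalue k + (ρ y).eigenvalue l) := by
  obtain ⟨C, hC, h⟩ := exists_sq_reQuad_matPartial_le hρ
    (Eventually.of_forall fun y w => (ρ y).posSemidef.reQuad_nonneg w)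
  -- The factor `1 / 4` comes from polarization.
  refine ⟨√(C / 4), by positivity, ?_⟩
  filter_upwards [h] with y hy j k l
  have h1 := (partialState_isHermitian ρ y j).norm_sq_le_of_reQuad (N := (ρ y).mat) (K := C)
    ((ρ y).eigenvector k) ((ρ y).eigenvector l) (fun c hc => hy j _ fun a => by
      have h1 := (ρ y).norm_eigenvector_le k a
      have h2 := (ρ y).norm_eigenvector_le l a
      refine (norm_add_le _ _).trans ?_
      rw [Pi.smul_apply, norm_smul, hc]
      linarith)
  rw [DensityMatrix.reQuad_eigenvector, DensityMatrix.reQuad_eigenvector,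
    ← DensityMatrix.element_eq_dotProduct, DensityMatrix.element_eq_conj] at h1
  rw [← Real.sqrt_mul (by positivity)]
  exact Real.le_sqrt_of_sq_le h1

/-- The square-root bound holds at `x` itself, where its right-hand side is zero: `∂_j ρ` has no
component inside the kernel. -/
theorem eigenPartial_eq_zero (hρ : ∀ a b, ContDiffAt ℝ 2 (fun y => (ρ y).mat a b) x) (j : Fin n)
    {k l : Fin d} (h : (ρ x).eigenvalue k + (ρ x).eigenvalue l = 0) :
    eigenPartial ρ x j k l = 0 := by
  obtain ⟨A, -, hA⟩ := exists_norm_eigenPartial_le hρ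
  have := hA.self_of_nhds j k l
  rw [h, Real.sqrt_zero, mul_zero] at this
  exact norm_le_zero_iff.1 this

namespace IsBlockFrame

variable {V N : (Fin n → ℝ) → Matrix (Fin d) (Fin d) ℂ}

/-- The block of `N` that vanishes at `x`. -/
noncomputable def kernelBlock (ρ : (Fin n → ℝ) → DensityMatrix d) (x : Fin n → ℝ)
    (N : (Fin n → ℝ) → Matrix (Fin d) (Fin d) ℂ) (y : Fin n → ℝ) : Matrix (Fin d) (Fin d) ℂ :=
  Matrix.of fun a b =>
    if (ρ x).eigenvalue a = 0 ∧ (ρ x).eigenvalue b = 0 then N y a b else 0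

theorem kernelBlock_apply (y : Fin n → ℝ) (a b : Fin d) : kernelBlock ρ x N y a b =
    if (ρ x).eigenvalue a = 0 ∧ (ρ x).eigenvalue b = 0 then N y a b else 0 := rfl

theorem contDiffAt_kernelBlock (h : IsBlockFrame ρ x V N) (a b : Fin d) :
    ContDiffAt ℝ 2 (fun y => kernelBlock ρ x N y a b) x := by
  simp only [kernelBlock_apply]
  split_ifs
  · exact h.contDiffAt_block a b
  · exact contDiffAt_const

theorem kernelBlock_self (h : IsBlockFrame ρ x V N) : kernelBlock ρ x N x = 0 := by
  ext a b
  rw [kernelBlock_apply, h.block_self, Matrix.zero_apply]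
  split_ifs with hab
  · by_cases e : a = b
    · subst e
      simp [hab.1]
    · rw [diagonal_apply_ne _ e]
  · rfl

theorem eventually_kernelBlock_posSemidef (h : IsBlockFrame ρ x V N) :
    ∀ᶠ y in 𝓝 x, (kernelBlock ρ x N y).PosSemidef := by
  filter_upwards [h.eventually_block_posSemidef] with y hy
  set P : Matrix (Fin d) (Fin d) ℂ :=
    diagonal fun k => if (ρ x).eigenvalue k = 0 then 1 else 0 with hP
  have : kernelBlock ρ x N y = Pᴴ * N y * P := by
    ext a b
    rw [kernelBlock_apply, hP, diagonal_conjTranspose, mul_diagonal, diagonal_mul]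
    by_cases ha : (ρ x).eigenvalue a = 0 <;> by_cases hb : (ρ x).eigenvalue b = 0 <;>
      simp [ha, hb]
  rw [this]
  exact hy.conjTranspose_mul_mul_same P

theorem matPartial_kernelBlock (y : Fin n → ℝ) (j : Fin n) (a b : Fin d) :
    matPartial (kernelBlock ρ x N) y j a b =
      if (ρ x).eigenvalue a = 0 ∧ (ρ x).eigenvalue b = 0 then matPartial N y j a b else 0 := by
  simp only [matPartial, of_apply, kernelBlock_apply]
  split_ifs <;> simp

/-- Conjugation by a matrix that respects the blocks only sees the kernel block. -/
theorem conj_kernelBlock_apply {C B B' : Matrix (Fin d) (Fin d) ℂ} {k l : Fin d}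
    (hC : ∀ a k, ¬((ρ x).eigenvalue a = 0 ↔ (ρ x).eigenvalue k = 0) → C a k = 0)
    (hB : ∀ a b, (ρ x).eigenvalue a = 0 → (ρ x).eigenvalue b = 0 → B a b = B' a b)
    (hk : (ρ x).eigenvalue k = 0) (hl : (ρ x).eigenvalue l = 0) :
    (Cᴴ * B * C) k l = (Cᴴ * B' * C) k l := by
  simp only [mul_apply, Finset.sum_mul, conjTranspose_apply]
  refine Finset.sum_congr rfl fun b _ => Finset.sum_congr rfl fun a _ => ?_
  by_cases ha : (ρ x).eigenvalue a = 0
  · by_cases hb : (ρ x).eigenvalue b = 0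
    · rw [hB a b ha hb]
    · rw [hC b l (by simp [hb, hl])]
      simp
  · rw [hC a k (by simp [ha, hk])]
    simp

/-- The connection matrix `V* ∂_j V` in the eigenbasis. -/
noncomputable def connection (ρ : (Fin n → ℝ) → DensityMatrix d)
    (V : (Fin n → ℝ) → Matrix (Fin d) (Fin d) ℂ) (y : Fin n → ℝ) (j : Fin n) :
    Matrix (Fin d) (Fin d) ℂ :=
  (eigenFrame ρ V y)ᴴ * ((V y)ᴴ * matPartial V y j) * eigenFrame ρ V y

/-- The derivative of `ρ` in its eigenbasis, in terms of the derivatives of the block-diagonal form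
and of the frame. -/
theorem eventually_eigenPartial_eq (h : IsBlockFrame ρ x V N) : ∀ᶠ y in 𝓝 x, ∀ j k l,
    eigenPartial ρ y j k l = ((eigenFrame ρ V y)ᴴ * matPartial N y j * eigenFrame ρ V y) k l +
      connection ρ V y j k l * (((ρ y).eigenvalue l - (ρ y).eigenvalue k : ℝ) : ℂ) := by
  filter_upwards [h.mat_eq.eventually_nhds, h.eventually_block_mul_eigenFrame,
    eventually_differentiableAt_entries two_ne_zero h.contDiffAt_frame,
    eventually_differentiableAt_entries two_ne_zero h.contDiffAt_block] with y hy hy1 hV hN j k l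
  set C := eigenFrame ρ V y with hC
  set D : Matrix (Fin d) (Fin d) ℂ := diagonal fun k => ((ρ y).eigenvalue k : ℂ) with hD
  have hVs : ∀ a b, DifferentiableAt ℝ (fun z => (V z)ᴴ a b) y := fun a b => (hV b a).star
  have hVN : ∀ a b, DifferentiableAt ℝ (fun z => (V z * N z) a b) y := by
    intro a b
    simp only [mul_apply]
    exact DifferentiableAt.fun_sum fun c _ => (hV a c).mul (hN c b)
  have e1 : partialState ρ y j = (matPartial V y j * N y + V y * matPartial N y j) * (V y)ᴴ +
      V y * N y * (matPartial V y j)ᴴ := by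
    calc partialState ρ y j = matPartial (fun z => V z * N z * (V z)ᴴ) y j :=
          matPartial_congr (A := fun z => (ρ z).mat) hy j
      _ = _ := by
        rw [matPartial_mul hVN hVs, matPartial_mul hV hN, matPartial_conjTranspose]
  -- Differentiation of `V* V = 1`.
  have hskew : (matPartial V y j)ᴴ * V y = -((V y)ᴴ * matPartial V y j) := by
    have h0 : matPartial (fun z => (V z)ᴴ * V z) y j = 0 := by
      simp only [h.conjTranspose_mul_self]
      ext a b
      simp [matPartial]
    rw [matPartial_mul hVs hV, matPartial_conjTranspose] at h0
    exact eq_neg_of_add_eq_zero_left h0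
  have hUC : (ρ y).eigenUnitary = V y * C := by
    rw [hC, eigenFrame, ← Matrix.mul_assoc, h.mul_conjTranspose_self, Matrix.one_mul]
  have hNs : Cᴴ * N y = D * Cᴴ := by
    have hNh : (N y)ᴴ = N y := by
      have : N y = (V y)ᴴ * (ρ y).mat * V y := by
        rw [hy.self_of_nhds]
        simp only [← Matrix.mul_assoc, h.conjTranspose_mul_self, Matrix.one_mul]
        rw [Matrix.mul_assoc, h.conjTranspose_mul_self, Matrix.mul_one]
      rw [this]
      exact isHermitian_conjTranspose_mul_mul _ (ρ y).posSemidef.isHermitian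
    have hDh : Dᴴ = D := by
      rw [hD, diagonal_conjTranspose]
      congr 1
      ext k
      simp
    have := congrArg conjTranspose hy1
    rwa [conjTranspose_mul, conjTranspose_mul, hNh, hDh] at this
  have hVV := h.conjTranspose_mul_self y
  -- Of the three terms of the product rule, the two that differentiate the frame become a
  -- commutator of the connection with `D`, because the eigenframe diagonalizes `N y`.
  have e2 : eigenPartial ρ y j = Cᴴ * matPartial N y j * C +
      (connection ρ V y j * D - D * connection ρ V y j) := by
    calc eigenPartial ρ y j
        = Cᴴ * ((V y)ᴴ * matPartial V y j) * (N y * (((V y)ᴴ * V y) * C)) +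
          Cᴴ * (((V y)ᴴ * V y) * matPartial N y j) * (((V y)ᴴ * V y) * C) +
          (Cᴴ * ((V y)ᴴ * V y)) * N y * ((matPartial V y j)ᴴ * V y) * C := by
          rw [eigenPartial, e1, hUC, conjTranspose_mul]
          simp only [Matrix.mul_add, Matrix.add_mul, Matrix.mul_assoc]
      _ = Cᴴ * ((V y)ᴴ * matPartial V y j) * (N y * C) + Cᴴ * matPartial N y j * C -
          (Cᴴ * N y) * ((V y)ᴴ * matPartial V y j) * C := by
        rw [hskew, hVV]
        simp only [Matrix.mul_one, Matrix.one_mul, Matrix.mul_neg, Matrix.neg_mul, sub_eq_add_neg]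
      _ = _ := by
        rw [hy1, hNs, connection]
        simp only [← hC, Matrix.mul_assoc]
        abel
  rw [e2, Matrix.add_apply, Matrix.sub_apply, hD, mul_diagonal, diagonal_mul]
  push_cast
  ring

end IsBlockFrame

end Derivatives

/-! ### The singular terms near `x + s e_i` -/

section OneParameterLimit

open Matrix

variable {n d : ℕ} {ρ : (Fin n → ℝ) → DensityMatrix d} {x : Fin n → ℝ}
  {V N : (Fin n → ℝ) → Matrix (Fin d) (Fin d) ℂ}

theorem tendsto_add_single (x : Fin n → ℝ) (i : Fin n) :
    Tendsto (fun s : ℝ => x + Pi.single i s) (𝓝 0) (𝓝 x) := by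
  have : Continuous fun s : ℝ => x + Pi.single i s :=
    continuous_const.add (continuous_single (A := fun _ => ℝ) i)
  exact this.tendsto' _ _ (by simp)

/-- A property that holds near `x` holds near the points `x + s e_i`, for small `s ≠ 0`. -/
theorem Filter.Eventually.near_add_single {P : (Fin n → ℝ) → Prop} (h : ∀ᶠ y in 𝓝 x, P y)
    (i : Fin n) : ∀ᶠ s in 𝓝[≠] (0 : ℝ), ∀ᶠ y in 𝓝 (x + Pi.single i s), P y :=
  ((tendsto_add_single x i).mono_left nhdsWithin_le_nhds).eventually h.eventually_nhds

theorem vanishingSum_self (ρ : (Fin n → ℝ) → DensityMatrix d) (x : Fin n → ℝ) :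
    vanishingSum ρ x x = 0 :=
  Finset.sum_eq_zero fun k hk => by simpa using hk

theorem vanishingSum_nonneg (ρ : (Fin n → ℝ) → DensityMatrix d) (x y : Fin n → ℝ) :
    0 ≤ vanishingSum ρ x y :=
  Finset.sum_nonneg fun k _ => (ρ y).eigenvalue_nonneg k

theorem star_col_dotProduct (C E : Matrix (Fin d) (Fin d) ℂ) (k l : Fin d) :
    star (fun a => C a k) ⬝ᵥ E *ᵥ (fun a => C a l) = (Cᴴ * E * C) k l := by
  rw [Matrix.mul_assoc, mul_apply]
  rfl

namespace IsBlockFrame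

/-- Near `x + s e_i`, the matrix of `∂_i ρ` in the small eigenvectors is `(2 / s) ρ` up to an error
that is small compared with the square roots of the eigenvalues. -/
theorem eventually_norm_eigenPartial_sub_le (h : IsBlockFrame ρ x V N)
    (hρ : ∀ a b, ContDiffAt ℝ 2 (fun y => (ρ y).mat a b) x) (i : Fin n) {θ : ℝ} (hθ : 0 < θ) :
    ∀ᶠ s in 𝓝[≠] (0 : ℝ), ∀ᶠ y in 𝓝 (x + Pi.single i s), ∀ k l, (ρ x).eigenvalue k = 0 →
      (ρ x).eigenvalue l = 0 →
      ‖eigenPartial ρ y i k l - if k = l then ((2 / s * (ρ y).eigenvalue k : ℝ) : ℂ) else 0‖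
        ≤ θ * √((ρ y).eigenvalue k + (ρ y).eigenvalue l) := by
  have hM := h.eventually_kernelBlock_posSemidef
  -- Polarization turns the constant `128 κ` into `32 κ`. Half of `θ` is spent on this error and
  -- half on the commutator with the connection.
  obtain ⟨κ, hκ, hκ1, hκθ⟩ : ∃ κ > 0, κ ≤ 1 ∧ 32 * κ ≤ (θ / 2) ^ 2 :=
    ⟨min 1 ((θ / 2) ^ 2 / 32), by positivity, min_le_left _ _, by
      have := min_le_right 1 ((θ / 2) ^ 2 / 32)
      linarith⟩
  have hmain := eventually_sq_reQuad_matPartial_sub_le h.contDiffAt_kernelBlock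
    (hM.mono fun y hy w => hy.reQuad_nonneg w) h.kernelBlock_self i hκ hκ1
  -- the connection is bounded
  have hconn : ∃ K > 0, ∀ᶠ y in 𝓝 x, ∀ k l, ‖connection ρ V y i k l‖ ≤ K := by
    have hcont : ∀ a b, ContinuousAt (fun y => ((V y)ᴴ * matPartial V y i) a b) x := by
      intro a b
      simp only [mul_apply, conjTranspose_apply]
      exact tendsto_finsetSum _ fun c _ => ((h.contDiffAt_frame c a).continuousAt.star).mul
        (contDiffAt_matPartial (m := 1) h.contDiffAt_frame i c b).continuousAt
    refine ⟨4 * ∑ a, ∑ b, ‖((V x)ᴴ * matPartial V x i) a b‖ + 1, by positivity, ?_⟩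
    filter_upwards [(continuousAt_sum_norm_entries hcont).eventually_le_const (lt_add_one _)]
      with y hy k l
    refine le_trans ?_ hy
    have hC := fun a k => entry_norm_bound_of_unitary (h.eigenFrame_mem y) a k
    have hsum : 0 ≤ ∑ a, ∑ b, ‖((V y)ᴴ * matPartial V y i) a b‖ := by positivity
    have : ‖connection ρ V y i k l‖ ≤ ∑ a, ∑ b, ‖((V y)ᴴ * matPartial V y i) a b‖ := by
      rw [connection, Matrix.mul_assoc, mul_apply]
      refine (norm_sum_le _ _).trans (Finset.sum_le_sum fun a _ => ?_)
      rw [norm_mul, conjTranspose_apply, norm_star]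
      refine (mul_le_of_le_one_left (norm_nonneg _) (hC a k)).trans ?_
      rw [mul_apply]
      refine (norm_sum_le _ _).trans (Finset.sum_le_sum fun b _ => ?_)
      rw [norm_mul]
      exact mul_le_of_le_one_right (norm_nonneg _) (hC b l)
    linarith
  obtain ⟨K, hK, hconn⟩ := hconn
  -- The commutator term is at most `K q` with `q` the sum of the two eigenvalues; writing `q = √q
  -- √q`, one factor is made smaller than `θ / (2 K)`.
  have hsmall : ∀ᶠ y in 𝓝 x, ∀ k l, (ρ x).eigenvalue k = 0 → (ρ x).eigenvalue l = 0 →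
      √((ρ y).eigenvalue k + (ρ y).eigenvalue l) ≤ θ / (2 * K) := by
    refine Filter.eventually_all.2 fun k => Filter.eventually_all.2 fun l => ?_
    by_cases hkl : (ρ x).eigenvalue k = 0 ∧ (ρ x).eigenvalue l = 0
    · have ht := ((tendsto_eigenvalue hρ k).add (tendsto_eigenvalue hρ l)).sqrt
      rw [hkl.1, hkl.2, add_zero, Real.sqrt_zero] at ht
      exact (ht.eventually_le_const (by positivity)).mono fun y hy _ _ => hy
    · exact Eventually.of_forall fun y hk hl => absurd ⟨hk, hl⟩ hkl
  filter_upwards [hmain, (h.eventually_eigenPartial_eq.near_add_single i),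
    hconn.near_add_single i, hsmall.near_add_single i, hM.eventually_nhds.near_add_single i,
    h.conj_eigenFrame.near_add_single i,
    (h.eventually_eigenFrame_eq_zero hρ).near_add_single i] with s h1 h2 h3 h4 h5 h6 h7
  filter_upwards [h1, h2, h3, h4, h5, h6, h7] with y h1 h2 h3 h4 h5 h6 h7 k l hk hl
  set C := eigenFrame ρ V y with hC
  set M := kernelBlock ρ x N with hMdef
  have hCb := fun a k => entry_norm_bound_of_unitary (h.eigenFrame_mem y) a k
  have hMh : (M y).IsHermitian := h5.self_of_nhds.isHermitian
  have hE : (matPartial M y i - ((2 / s : ℝ) : ℂ) • M y).IsHermitian := by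
    refine (matPartial_isHermitian (h5.mono fun z hz => hz.isHermitian) i).sub ?_
    rw [IsHermitian, conjTranspose_smul, hMh.eq]
    simp
  -- Columns of the eigenframe with index in the kernel diagonalize the kernel block, so its
  -- quadratic form takes the values `p_k(y)` on them.
  have hMC : ∀ k l, (ρ x).eigenvalue k = 0 → (ρ x).eigenvalue l = 0 →
      (Cᴴ * M y * C) k l = if k = l then ((ρ y).eigenvalue k : ℂ) else 0 := by
    intro k l hk hl
    rw [conj_kernelBlock_apply (B' := N y) h7 (fun a b ha hb => by
      rw [hMdef, kernelBlock_apply, if_pos ⟨ha, hb⟩]) hk hl, h6, diagonal_apply]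
  have hquad : ∀ k, (ρ x).eigenvalue k = 0 →
      (M y).reQuad (fun a => C a k) = (ρ y).eigenvalue k := by
    intro k hk
    rw [reQuad, star_col_dotProduct, hMC k k hk hk, if_pos rfl, Complex.ofReal_re]
  have hp := hE.norm_sq_le_of_reQuad (N := M y) (K := 128 * κ) (fun a => C a k) (fun a => C a l)
    (fun c hc => h1 _ fun a => by
      refine (norm_add_le _ _).trans ?_
      rw [Pi.smul_apply, norm_smul, hc]
      linarith [hCb a k, hCb a l])
  rw [hquad k hk, hquad l hl, star_col_dotProduct, Matrix.mul_sub, Matrix.sub_mul,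
    Matrix.sub_apply, Matrix.mul_smul, Matrix.smul_mul, Matrix.smul_apply, hMC k l hk hl,
    conj_kernelBlock_apply (B' := matPartial N y i) h7 (fun a b ha hb => by
      rw [hMdef, matPartial_kernelBlock, if_pos ⟨ha, hb⟩]) hk hl] at hp
  set q := (ρ y).eigenvalue k + (ρ y).eigenvalue l with hq
  have hq0 : 0 ≤ q := add_nonneg ((ρ y).eigenvalue_nonneg k) ((ρ y).eigenvalue_nonneg l)
  set e := (Cᴴ * matPartial N y i * C) k l -
    ((2 / s : ℝ) : ℂ) • (if k = l then ((ρ y).eigenvalue k : ℂ) else 0) with he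
  have hb1 : ‖e‖ ≤ θ / 2 * √q := by
    rw [← Real.sqrt_sq (by positivity : 0 ≤ θ / 2), ← Real.sqrt_mul (by positivity)]
    refine Real.le_sqrt_of_sq_le (hp.trans ?_)
    exact mul_le_mul_of_nonneg_right (by linarith) hq0
  have hb2 : ‖connection ρ V y i k l * (((ρ y).eigenvalue l - (ρ y).eigenvalue k : ℝ) : ℂ)‖
      ≤ θ / 2 * √q := by
    rw [norm_mul, Complex.norm_real, Real.norm_eq_abs]
    have hle : |(ρ y).eigenvalue l - (ρ y).eigenvalue k| ≤ q := by
      rw [abs_le]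
      constructor <;> linarith [(ρ y).eigenvalue_nonneg k, (ρ y).eigenvalue_nonneg l]
    calc _ ≤ K * q := mul_le_mul (h3 k l) hle (abs_nonneg _) hK.le
      _ = K * √q * √q := by rw [mul_assoc, Real.mul_self_sqrt hq0]
      _ ≤ K * (θ / (2 * K)) * √q := by
        gcongr
        exact h4 k l hk hl
      _ = θ / 2 * √q := by field_simp
  have hfin : eigenPartial ρ y i k l -
      (if k = l then ((2 / s * (ρ y).eigenvalue k : ℝ) : ℂ) else 0) =
      e + connection ρ V y i k l * (((ρ y).eigenvalue l - (ρ y).eigenvalue k : ℝ) : ℂ) := by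
    rw [h2 i k l, he]
    split_ifs
    · push_cast
      rw [smul_eq_mul]
      ring
    · rw [smul_zero]
      ring
  rw [hfin]
  refine (norm_add_le _ _).trans ?_
  linarith

/-- The trace of `∂_j ρ` over the small eigenvectors is the derivative of the sum of the small
eigenvalues. -/
theorem eventually_sum_eigenPartial (h : IsBlockFrame ρ x V N)
    (hρ : ∀ a b, ContDiffAt ℝ 2 (fun y => (ρ y).mat a b) x) (j : Fin n) :
    ∀ᶠ y in 𝓝 x, ∑ k with (ρ x).eigenvalue k = 0, (eigenPartial ρ y j k k).re =
      fderiv ℝ (vanishingSum ρ x) y (Pi.single j 1) := by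
  filter_upwards [h.eventually_eigenPartial_eq, h.eventually_eigenFrame_eq_zero hρ,
    (h.eventually_vanishingSum_eq hρ).eventually_nhds,
    eventually_differentiableAt_entries two_ne_zero h.contDiffAt_block] with y h1 h2 h3 h4
  have h3' : vanishingSum ρ x =ᶠ[𝓝 y]
    fun y => ∑ k with (ρ x).eigenvalue k = 0, (N y k k).re := h3
  have hs := sum_conj_block_eq (h.eigenFrame_mem y)
    (Finset.univ.filter fun k => (ρ x).eigenvalue k = 0) (by simpa using h2) (matPartial N y j)
  have hd : HasFDerivAt (fun y => ∑ k with (ρ x).eigenvalue k = 0, (N y k k).re)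
      (∑ k with (ρ x).eigenvalue k = 0, Complex.reCLM ∘L fderiv ℝ (fun z => N z k k) y) y :=
    HasFDerivAt.fun_sum fun k _ => Complex.reCLM.hasFDerivAt.comp y (h4 k k).hasFDerivAt
  rw [h3'.fderiv_eq, hd.fderiv, _root_.sum_apply]
  have hs' := congrArg Complex.re hs
  rw [Complex.re_sum, Complex.re_sum] at hs'
  refine Eq.trans ?_ hs'
  refine Finset.sum_congr rfl fun k _ => ?_
  -- On the diagonal the commutator term carries the factor `p_k - p_k = 0`.
  rw [h1 j k k]
  simp

end IsBlockFrame

theorem qfi_eq_add (ρ : (Fin n → ℝ) → DensityMatrix d) (x y : Fin n → ℝ) (i j : Fin n) :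
    qfi ρ y i j = sldForm (fun k l => ¬((ρ x).eigenvalue k = 0 ∧ (ρ x).eigenvalue l = 0))
        (ρ y).eigenvalue (eigenPartial ρ y i) (eigenPartial ρ y j) +
      sldForm (fun k l => (ρ x).eigenvalue k = 0 ∧ (ρ x).eigenvalue l = 0)
        (ρ y).eigenvalue (eigenPartial ρ y i) (eigenPartial ρ y j) := by
  rw [qfi_eq_sldForm]
  simp only [sldForm, ← mul_add, ← Finset.sum_add_distrib]
  congr 1
  refine Finset.sum_congr rfl fun k _ => Finset.sum_congr rfl fun l _ => ?_
  by_cases h : (ρ x).eigenvalue k = 0 ∧ (ρ x).eigenvalue l = 0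
  · simp [h, eigenPartial]
  · simp [h, eigenPartial]

/-- Comparison of a single term of the quantum Fisher information with its leading part. -/
theorem abs_term_sub_le {E F : ℂ} {p q m θ A : ℝ} (hpq : 0 < p + q)
    (hE : ‖E - m‖ ≤ θ * √(p + q)) (hF : ‖F‖ ≤ A * √(p + q)) :
    |(E * F).re / (p + q) - m * F.re / (p + q)| ≤ θ * A := by
  have e : (E * F).re / (p + q) - m * F.re / (p + q) = ((E - m) * F).re / (p + q) := by
    rw [sub_mul, Complex.sub_re, Complex.re_ofReal_mul, sub_div]
  rw [e, abs_div, abs_of_pos hpq, div_le_iff₀ hpq]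
  refine (Complex.abs_re_le_norm _).trans ?_
  rw [norm_mul]
  calc _ ≤ (θ * √(p + q)) * (A * √(p + q)) :=
        mul_le_mul hE hF (norm_nonneg _) ((norm_nonneg _).trans hE)
    _ = θ * A * (√(p + q) * √(p + q)) := by ring
    _ = _ := by rw [Real.mul_self_sqrt hpq.le]

/-- Near `x + s e_i`, the small eigenvalues contribute `(2 / s) ∂_j S` to `H^{ij}`. -/
theorem eventually_abs_sldForm_sub_le (hρ : ∀ a b, ContDiffAt ℝ 2 (fun y => (ρ y).mat a b) x)
    (i j : Fin n) {ε : ℝ} (hε : 0 < ε) :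
    ∀ᶠ s in 𝓝[≠] (0 : ℝ), ∀ᶠ y in 𝓝 (x + Pi.single i s),
      |sldForm (fun k l => (ρ x).eigenvalue k = 0 ∧ (ρ x).eigenvalue l = 0)
          (ρ y).eigenvalue (eigenPartial ρ y i) (eigenPartial ρ y j) -
        2 * (1 / s * fderiv ℝ (vanishingSum ρ x) y (Pi.single j 1))| ≤ ε := by
  obtain ⟨V, N, h⟩ := exists_isBlockFrame hρ
  obtain ⟨A, hA, hbound⟩ := exists_norm_eigenPartial_le hρ
  -- Each of the `d²` terms has error at most `θ A`, and the form carries a factor `2`; the `+ 1`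
  -- keeps the denominator positive.
  set θ := ε / (2 * (d * d + 1) * A) with hθdef
  have hθ : 0 < θ := by positivity
  filter_upwards [h.eventually_norm_eigenPartial_sub_le hρ i hθ,
    (h.eventually_sum_eigenPartial hρ j).near_add_single i, hbound.near_add_single i]
    with s h1 h2 h3
  filter_upwards [h1, h2, h3] with y h1 h2 h3
  rw [← h2]
  set E := eigenPartial ρ y i
  set F := eigenPartial ρ y j
  set p := (ρ y).eigenvalue
  have hp : ∀ k, 0 ≤ p k := (ρ y).eigenvalue_nonneg
  have hdiag : 1 / s * ∑ k with (ρ x).eigenvalue k = 0, (F k k).re =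
      ∑ k, ∑ l, if (ρ x).eigenvalue k = 0 ∧ k = l then 1 / s * (F k k).re else 0 := by
    rw [Finset.mul_sum, Finset.sum_filter]
    refine Finset.sum_congr rfl fun k _ => ?_
    by_cases hk : (ρ x).eigenvalue k = 0 <;> simp [hk]
  rw [hdiag, sldForm, ← mul_sub, ← Finset.sum_sub_distrib]
  simp only [← Finset.sum_sub_distrib]
  rw [abs_mul, abs_two]
  have hterm : ∀ k l, |(if ((ρ x).eigenvalue k = 0 ∧ (ρ x).eigenvalue l = 0) ∧ 0 < p k + p l
      then (E k l * F l k).re / (p k + p l) else 0) -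
      if (ρ x).eigenvalue k = 0 ∧ k = l then 1 / s * (F k k).re else 0| ≤ θ * A := by
    intro k l
    by_cases hkl : (ρ x).eigenvalue k = 0 ∧ (ρ x).eigenvalue l = 0
    -- If both eigenvalues vanish at `y`, the term is absent from the form, and its counterpart is
    -- zero because the matrix element of `∂_j ρ` vanishes.
    · rcases (add_nonneg (hp k) (hp l)).eq_or_lt with h0 | hpos
      · have hF : F k l = 0 := by
          have := h3 j k l
          rw [← h0, Real.sqrt_zero, mul_zero] at this
          exact norm_le_zero_iff.1 this
        have hz : ¬ 0 < p k + p l := by rw [← h0]; exact lt_irrefl _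
        rw [if_neg (fun hh => hz hh.2)]
        by_cases hkl' : k = l
        · subst hkl'
          rw [hF]
          simp
          positivity
        · simp [hkl']
          positivity
      · rw [if_pos ⟨hkl, hpos⟩]
        have hF : ‖F l k‖ ≤ A * √(p k + p l) := by
          rw [add_comm]
          exact h3 j l k
        have hE := h1 k l hkl.1 hkl.2
        -- On the diagonal the leading part is `(2 / s) p_k F_kk / (2 p_k) = F_kk / s`; off the
        -- diagonal it is zero.
        by_cases hkl' : k = l
        · subst hkl'
          rw [if_pos rfl] at hE
          have := abs_term_sub_le hpos hE hF
          convert this using 2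
          simp only [hkl.1, and_self, if_true]
          have : p k + p k ≠ 0 := hpos.ne'
          have hk0 : p k ≠ 0 := fun h0 => by simp [h0] at this
          congr 1
          by_cases hs : s = 0
          · simp [hs]
          · field_simp
            ring
        · rw [if_neg hkl'] at hE
          have := abs_term_sub_le (m := 0) hpos (by simpa using hE) hF
          simpa [hkl'] using this
    · have : ¬((ρ x).eigenvalue k = 0 ∧ k = l) := by
        rintro ⟨hk, rfl⟩
        exact hkl ⟨hk, hk⟩
      rw [if_neg (fun hh => hkl hh.1), if_neg this]
      simp
      positivity
  have hsum : |∑ k, ∑ l, ((if ((ρ x).eigenvalue k = 0 ∧ (ρ x).eigenvalue l = 0) ∧ 0 < p k + p l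
      then (E k l * F l k).re / (p k + p l) else 0) -
      if (ρ x).eigenvalue k = 0 ∧ k = l then 1 / s * (F k k).re else 0)| ≤ d * d * (θ * A) := by
    refine (Finset.abs_sum_le_sum_abs _ _).trans ?_
    calc _ ≤ ∑ _k : Fin d, ∑ _l : Fin d, θ * A :=
          Finset.sum_le_sum fun k _ => (Finset.abs_sum_le_sum_abs _ _).trans
            (Finset.sum_le_sum fun l _ => hterm k l)
      _ = _ := by
        simp
        ring
  have hfin : 2 * (d * d * (θ * A)) ≤ ε := by
    have e : 2 * ((d * d + 1) * (θ * A)) = ε := by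
      rw [hθdef]
      field_simp
    have : 0 ≤ θ * A := by positivity
    nlinarith
  refine le_trans ?_ hfin
  refine mul_le_mul_of_nonneg_left (le_of_eq_of_le ?_ hsum) zero_le_two
  congr 1
  refine Finset.sum_congr rfl fun k _ => Finset.sum_congr rfl fun l _ => ?_
  congr

/-- Near the points `x + s e_i`, `s ≠ 0` small, `H^{ij}` is close to
`H^{ij}(x) + 2 ∂_i ∂_j S(x)`. -/
theorem eventually_abs_qfi_sub_lt (hρ : ∀ a b, ContDiffAt ℝ 2 (fun y => (ρ y).mat a b) x)
    (i j : Fin n) {ε : ℝ} (hε : 0 < ε) :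
    ∀ᶠ s in 𝓝[≠] (0 : ℝ), ∀ᶠ y in 𝓝 (x + Pi.single i s),
      |qfi ρ y i j - (qfi ρ x i j + 2 * hessian (vanishingSum ρ x) x i j)| < ε := by
  obtain ⟨V, N, h⟩ := exists_isBlockFrame hρ
  set S := vanishingSum ρ x with hS
  have hSc : ContDiffAt ℝ 2 S x := h.contDiffAt_vanishingSum hρ
  set S' : (Fin n → ℝ) → ℝ := fun y => fderiv ℝ S y (Pi.single j 1) with hS'
  have hS'c : ContDiffAt ℝ 1 S' x :=
    (hSc.fderiv_right (m := 1) (by norm_num)).clm_apply contDiffAt_const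
  -- Since `x` is a minimum of `S`, the quotient `S' (x + s e_i) / s` is a difference quotient of
  -- `S'`.
  have hS'0 : S' x = 0 := by
    have hmin : IsLocalMin S x := Eventually.of_forall fun y => by
      rw [hS, vanishingSum_self]
      exact vanishingSum_nonneg ρ x y
    simp [hS', hmin.fderiv_eq_zero]
  have hreg : ∀ᶠ y in 𝓝 x, |sldForm
      (fun k l => ¬((ρ x).eigenvalue k = 0 ∧ (ρ x).eigenvalue l = 0)) (ρ y).eigenvalue
        (eigenPartial ρ y i) (eigenPartial ρ y j) - qfi ρ x i j| < ε / 4 :=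
    (tendsto_sldForm_regular hρ i j).eventually (Metric.ball_mem_nhds _ (by positivity))
  have hder : Tendsto (fun s : ℝ => 1 / s * S' (x + Pi.single i s)) (𝓝[≠] 0)
      (𝓝 (hessian S x i j)) := by
    have h1 : HasDerivAt (fun s : ℝ => S' (x + Pi.single i s)) (hessian S x i j) 0 := by
      have h2 : HasFDerivAt S' (fderiv ℝ S' x) (x + Pi.single i 0) := by
        rw [Pi.single_zero, add_zero]
        exact (hS'c.differentiableAt one_ne_zero).hasFDerivAt
      have h3 : HasDerivAt (fun s : ℝ => x + (Pi.single i s : Fin n → ℝ)) (Pi.single i 1) 0 := by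
        have := ((hasDerivAt_id (0 : ℝ)).smul_const (Pi.single i 1 : Fin n → ℝ)).const_add x
        simpa [← Pi.single_smul] using this
      exact h2.comp_hasDerivAt 0 h3
    have := h1.tendsto_slope_zero
    simpa [hS'0] using this
  have hder' := hder.eventually (Metric.ball_mem_nhds _ (show 0 < ε / 8 by positivity))
  have hcont : ∀ᶠ s in 𝓝[≠] (0 : ℝ), ContinuousAt S' (x + Pi.single i s) := by
    have : ∀ᶠ y in 𝓝 x, ContinuousAt S' y :=
      (hS'c.eventually (by simp)).mono fun y hy => hy.continuousAt
    exact (this.near_add_single i).mono fun s hs => hs.self_of_nhds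
  filter_upwards [eventually_abs_sldForm_sub_le hρ i j (show 0 < ε / 4 by positivity),
    hreg.near_add_single i, hder', hcont] with s h1 h2 h3 h4
  rw [Real.dist_eq] at h3
  have h5 : ∀ᶠ y in 𝓝 (x + Pi.single i s), |1 / s * S' y - hessian S x i j| < ε / 8 :=
    (((h4.tendsto.const_mul (1 / s)).sub_const (hessian S x i j)).abs).eventually_lt_const h3
  filter_upwards [h1, h2, h5] with y h1 h2 h5
  rw [qfi_eq_add ρ x y]
  rw [abs_lt] at *
  rw [abs_le] at h1
  simp only [hS'] at h5
  constructor <;> linarith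

end OneParameterLimit

/-! ### An exact formula for the squared Bures distance -/

namespace DensityMatrix

open Matrix

variable {d : ℕ}

theorem sqrt_mat (σ : DensityMatrix d) : CFC.sqrt σ.mat =
    σ.eigenUnitary * (diagonal fun k => ((√(σ.eigenvalue k) : ℝ) : ℂ)) * σ.eigenUnitaryᴴ := by
  refine CFC.sqrt_unique ?_ ?_
  · have h : ∀ k, ((√(σ.eigenvalue k) : ℝ) : ℂ) * ((√(σ.eigenvalue k) : ℝ) : ℂ) =
        (σ.eigenvalue k : ℂ) := by
      intro k
      rw [← Complex.ofReal_mul, Real.mul_self_sqrt (σ.eigenvalue_nonneg k)]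
    set D := diagonal fun k => ((√(σ.eigenvalue k) : ℝ) : ℂ) with hD
    calc σ.eigenUnitary * D * σ.eigenUnitaryᴴ * (σ.eigenUnitary * D * σ.eigenUnitaryᴴ)
        = σ.eigenUnitary * D * (σ.eigenUnitaryᴴ * σ.eigenUnitary) * D * σ.eigenUnitaryᴴ := by
          simp only [Matrix.mul_assoc]
      _ = σ.eigenUnitary * (D * D) * σ.eigenUnitaryᴴ := by
          rw [eigenUnitary_conjTranspose_mul, Matrix.mul_one]
          simp only [Matrix.mul_assoc]
      _ = σ.mat := by
          conv_rhs => rw [σ.mat_eq]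
          rw [hD, diagonal_mul_diagonal]
          simp only [h]
  · rw [Matrix.nonneg_iff_posSemidef]
    refine PosSemidef.mul_mul_conjTranspose_same (PosSemidef.diagonal fun k => ?_) _
    simp [Real.sqrt_nonneg]

/-- The square root of the fidelity in the eigenbasis of the first state. -/
theorem exists_sqrt_fidelity (σ τ : DensityMatrix d) :
    ∃ W : Matrix (Fin d) (Fin d) ℂ, W.PosSemidef ∧
      (∀ k l, (W * W) k l = ((√(σ.eigenvalue k) : ℝ) : ℂ) *
        (σ.eigenUnitaryᴴ * τ.mat * σ.eigenUnitary) k l * ((√(σ.eigenvalue l) : ℝ) : ℂ)) ∧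
      √(fidelity σ τ) = W.trace.re := by
  set U := σ.eigenUnitary
  have hU1 : Uᴴ * U = 1 := σ.eigenUnitary_conjTranspose_mul
  have hU2 : U * Uᴴ = 1 := σ.eigenUnitary_mul_conjTranspose
  set B := CFC.sqrt σ.mat * τ.mat * CFC.sqrt σ.mat with hB
  have hσs : (CFC.sqrt σ.mat).PosSemidef := Matrix.nonneg_iff_posSemidef.1 (CFC.sqrt_nonneg _)
  have hBpos : 0 ≤ B := by
    rw [Matrix.nonneg_iff_posSemidef, hB]
    have := τ.posSemidef.conjTranspose_mul_mul_same (CFC.sqrt σ.mat)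
    rwa [hσs.isHermitian.eq] at this
  have hW0 : (CFC.sqrt B).PosSemidef := Matrix.nonneg_iff_posSemidef.1 (CFC.sqrt_nonneg _)
  have hW : (Uᴴ * CFC.sqrt B * U).PosSemidef := hW0.conjTranspose_mul_mul_same U
  have htr : (Uᴴ * CFC.sqrt B * U).trace = (CFC.sqrt B).trace := by
    rw [trace_mul_comm, ← Matrix.mul_assoc, hU2, Matrix.one_mul]
  refine ⟨Uᴴ * CFC.sqrt B * U, hW, fun k l => ?_, ?_⟩
  · set D := diagonal fun k => ((√(σ.eigenvalue k) : ℝ) : ℂ) with hD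
    have : Uᴴ * CFC.sqrt B * U * (Uᴴ * CFC.sqrt B * U) = D * (Uᴴ * τ.mat * U) * D := by
      calc Uᴴ * CFC.sqrt B * U * (Uᴴ * CFC.sqrt B * U)
          = Uᴴ * CFC.sqrt B * (U * Uᴴ) * CFC.sqrt B * U := by simp only [Matrix.mul_assoc]
        _ = Uᴴ * (CFC.sqrt B * CFC.sqrt B) * U := by
            rw [hU2, Matrix.mul_one]
            simp only [Matrix.mul_assoc]
        _ = Uᴴ * B * U := by rw [CFC.sqrt_mul_sqrt_self B hBpos]
        _ = (Uᴴ * U) * D * (Uᴴ * τ.mat * U) * D * (Uᴴ * U) := by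
            rw [hB, sqrt_mat]
            simp only [U, hD, Matrix.mul_assoc]
        _ = D * (Uᴴ * τ.mat * U) * D := by rw [hU1, Matrix.one_mul, Matrix.mul_one]
    rw [this, hD, mul_diagonal, diagonal_mul]
  · rw [fidelity, ← hB, htr]
    exact Real.sqrt_sq (Complex.le_def.1 hW0.trace_nonneg).1

/-- The deviation `R - diag p` of a state from `σ`, in the eigenbasis of `σ`. -/
noncomputable def deviation (σ τ : DensityMatrix d) : Matrix (Fin d) (Fin d) ℂ :=
  σ.eigenUnitaryᴴ * τ.mat * σ.eigenUnitary - diagonal fun k => (σ.eigenvalue k : ℂ)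

theorem trace_deviation (σ τ : DensityMatrix d) : (σ.deviation τ).trace = 0 := by
  rw [deviation, trace_sub, trace_mul_comm, ← Matrix.mul_assoc, eigenUnitary_mul_conjTranspose,
    Matrix.one_mul, τ.trace_eq_one, trace_diagonal]
  have := σ.sum_eigenvalue
  rw [← Complex.ofReal_sum, this]
  simp

theorem _root_.Matrix.IsHermitian.sum_mul_re {A : Matrix (Fin d) (Fin d) ℂ} (hA : A.IsHermitian)
    (k : Fin d) : (A * A) k k = ((∑ l, ‖A k l‖ ^ 2 : ℝ) : ℂ) := by
  rw [mul_apply]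
  push_cast
  refine Finset.sum_congr rfl fun l _ => ?_
  rw [← hA.apply l k, Complex.star_def, Complex.mul_conj, Complex.normSq_eq_norm_sq]
  push_cast
  rfl

/-- The squared Bures distance from `σ`, exactly, in terms of the deviation and of a matrix `Δ`
that solves a quadratic equation. -/
theorem exists_buresDistSq_eq (σ τ : DensityMatrix d) {c : ℝ} (hc : 0 < c)
    (hgap : ∀ k, σ.eigenvalue k ≠ 0 → c ≤ σ.eigenvalue k) :
    ∃ Δ : Matrix (Fin d) (Fin d) ℂ,
      (∀ k l, ((σ.eigenvalue k + σ.eigenvalue l : ℝ) : ℂ) * Δ k l + (Δ * Δ) k l =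
        ((√(σ.eigenvalue k) * √(σ.eigenvalue l) : ℝ) : ℂ) * σ.deviation τ k l) ∧
      (∀ k l, σ.eigenvalue k = 0 → Δ k l = 0) ∧
      ∑ k, ∑ l, ‖Δ k l‖ ^ 2 ≤ (1 / c ^ 2) * ∑ k, ∑ l, ‖σ.deviation τ k l‖ ^ 2 ∧
      buresDistSq σ τ = ∑ k with σ.eigenvalue k = 0, (σ.deviation τ k k).re +
        ∑ k, ∑ l, ‖Δ k l‖ ^ 2 / σ.eigenvalue k := by
  obtain ⟨W, hW, hWW, hF⟩ := exists_sqrt_fidelity σ τ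
  set p := σ.eigenvalue with hpdef
  have hp : ∀ k, 0 ≤ p k := σ.eigenvalue_nonneg
  have hp1 : ∀ k, p k ≤ 1 := σ.eigenvalue_le_one
  set D : Matrix (Fin d) (Fin d) ℂ := diagonal fun k => (p k : ℂ) with hD
  have hDh : D.IsHermitian := isHermitian_diagonal_iff.2 fun k => by simp [IsSelfAdjoint]
  set δ := σ.deviation τ with hδ
  set Δ := W - D with hΔ
  have hΔh : Δ.IsHermitian := hW.isHermitian.sub hDh
  set E : Matrix (Fin d) (Fin d) ℂ := Matrix.of fun k l => ((√(p k) * √(p l) : ℝ) : ℂ) * δ k l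
    with hE
  have hWE : W * W = D * D + E := by
    ext k l
    rw [hWW, Matrix.add_apply, hD, diagonal_mul_diagonal, hE, of_apply, hδ, deviation,
      Matrix.sub_apply]
    by_cases hkl : k = l
    · subst hkl
      rw [diagonal_apply_eq, diagonal_apply_eq]
      have : ((√(p k) : ℝ) : ℂ) * ((√(p k) : ℝ) : ℂ) = (p k : ℂ) := by
        rw [← Complex.ofReal_mul, Real.mul_self_sqrt (hp k)]
      push_cast
      linear_combination (p k : ℂ) * this
    · rw [diagonal_apply_ne _ hkl, diagonal_apply_ne _ hkl]
      push_cast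
      ring
  have hWΔ : W = D + Δ := by rw [hΔ]; abel
  have hquad : D * Δ + Δ * D + Δ * Δ = E := by
    have : (D + Δ) * (D + Δ) = D * D + E := by rw [← hWΔ, hWE]
    have h2 : (D + Δ) * (D + Δ) = D * D + (D * Δ + Δ * D + Δ * Δ) := by
      simp only [Matrix.mul_add, Matrix.add_mul]
      abel
    rw [h2] at this
    exact add_left_cancel this
  -- For `p k = 0` the diagonal entry of `W²`, which is the squared norm of row `k` of `W`,
  -- vanishes.
  have hzero : ∀ k l, p k = 0 → Δ k l = 0 := by
    intro k l hk
    have h1 := hW.isHermitian.sum_mul_re k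
    rw [hWW k k, hk, Real.sqrt_zero] at h1
    have h2 : ∑ l, ‖W k l‖ ^ 2 = 0 := by
      have : ((∑ l, ‖W k l‖ ^ 2 : ℝ) : ℂ) = 0 := by rw [← h1]; simp
      exact_mod_cast this
    have h3 := (Finset.sum_eq_zero_iff_of_nonneg (fun l _ => by positivity)).1 h2 l
      (Finset.mem_univ l)
    have h4 : W k l = 0 := by simpa using h3
    rw [hΔ, Matrix.sub_apply, h4, hD, diagonal_apply]
    split_ifs <;> simp [hk]
  have hentry : ∀ k l, ((p k + p l : ℝ) : ℂ) * Δ k l + (Δ * Δ) k l =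
      ((√(p k) * √(p l) : ℝ) : ℂ) * δ k l := by
    intro k l
    have := congrFun (congrFun hquad k) l
    rw [Matrix.add_apply, Matrix.add_apply, hD, diagonal_mul, mul_diagonal, hE, of_apply] at this
    rw [← this]
    push_cast
    ring
  refine ⟨Δ, hentry, hzero, ?_, ?_⟩
  · -- the trace of `Δ (W Δ + Δ D) = Δ E`
    have h1 : W * Δ + Δ * D = E := by
      rw [← hquad, hWΔ, Matrix.add_mul]
      abel
    have h2 : (Δ * W * Δ).trace + (Δ * Δ * D).trace = (Δ * E).trace := by
      rw [← h1, Matrix.mul_add, trace_add, Matrix.mul_assoc, Matrix.mul_assoc]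
    -- Positivity of `W` allows this term to be dropped; the remaining one bounds `c ‖Δ‖²` because
    -- the rows of `Δ` in the kernel are zero. Hence the a priori bound needs no smallness of the
    -- deviation.
    have h3 : 0 ≤ (Δ * W * Δ).trace.re := by
      have := hW.conjTranspose_mul_mul_same Δ
      rw [hΔh.eq] at this
      exact (Complex.le_def.1 this.trace_nonneg).1
    have h4 : (Δ * Δ * D).trace.re = ∑ k, p k * ∑ l, ‖Δ k l‖ ^ 2 := by
      rw [trace, Complex.re_sum]
      refine Finset.sum_congr rfl fun k _ => ?_
      rw [diag_apply, hD, mul_diagonal, hΔh.sum_mul_re, ← Complex.ofReal_mul, Complex.ofReal_re,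
        mul_comm]
    have h5 : c * ∑ k, ∑ l, ‖Δ k l‖ ^ 2 ≤ (Δ * Δ * D).trace.re := by
      rw [h4, Finset.mul_sum]
      refine Finset.sum_le_sum fun k _ => ?_
      by_cases hk : p k = 0
      · simp [hzero k _ hk]
      · exact mul_le_mul_of_nonneg_right (hgap k hk) (by positivity)
    have h6 : (Δ * E).trace.re ≤ ∑ k, ∑ l, ‖Δ k l‖ * ‖δ l k‖ := by
      rw [trace, Complex.re_sum]
      refine Finset.sum_le_sum fun k _ => ?_
      rw [diag_apply, mul_apply, Complex.re_sum]
      refine Finset.sum_le_sum fun l _ => (Complex.re_le_norm _).trans ?_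
      rw [norm_mul, hE, of_apply, norm_mul, Complex.norm_real, Real.norm_eq_abs,
        abs_of_nonneg (by positivity)]
      refine mul_le_mul_of_nonneg_left (mul_le_of_le_one_left (norm_nonneg _) ?_) (norm_nonneg _)
      exact mul_le_one₀ (Real.sqrt_le_one.2 (hp1 l)) (Real.sqrt_nonneg _)
        (Real.sqrt_le_one.2 (hp1 k))
    -- Young's inequality with weight `c`: half of the lower bound `h5` absorbs the `Δ` part.
    have h7 : ∑ k, ∑ l, ‖Δ k l‖ * ‖δ l k‖ ≤
        c / 2 * ∑ k, ∑ l, ‖Δ k l‖ ^ 2 + 1 / (2 * c) * ∑ k, ∑ l, ‖δ k l‖ ^ 2 := by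
      rw [Finset.sum_comm (f := fun k l => ‖δ k l‖ ^ 2), Finset.mul_sum, Finset.mul_sum,
        ← Finset.sum_add_distrib]
      refine Finset.sum_le_sum fun k _ => ?_
      rw [Finset.mul_sum, Finset.mul_sum, ← Finset.sum_add_distrib]
      refine Finset.sum_le_sum fun l _ => ?_
      have e : c / 2 * ‖Δ k l‖ ^ 2 + 1 / (2 * c) * ‖δ l k‖ ^ 2 - ‖Δ k l‖ * ‖δ l k‖
          = 1 / (2 * c) * (c * ‖Δ k l‖ - ‖δ l k‖) ^ 2 := by
        field_simp
        ring
      have : 0 ≤ 1 / (2 * c) * (c * ‖Δ k l‖ - ‖δ l k‖) ^ 2 := by positivity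
      linarith
    have h8 := congrArg Complex.re h2
    rw [Complex.add_re] at h8
    have h9 : c / 2 * ∑ k, ∑ l, ‖Δ k l‖ ^ 2 ≤ 1 / (2 * c) * ∑ k, ∑ l, ‖δ k l‖ ^ 2 := by
      linarith
    calc ∑ k, ∑ l, ‖Δ k l‖ ^ 2 = 2 / c * (c / 2 * ∑ k, ∑ l, ‖Δ k l‖ ^ 2) := by field_simp
      _ ≤ 2 / c * (1 / (2 * c) * ∑ k, ∑ l, ‖δ k l‖ ^ 2) := by gcongr
      _ = _ := by field_simp
  · have htrW : W.trace.re = 1 + ∑ k, (Δ k k).re := by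
      rw [hWΔ, trace_add, Complex.add_re, hD, trace_diagonal, ← Complex.ofReal_sum,
        σ.sum_eigenvalue, Complex.ofReal_re, trace, Complex.re_sum]
      rfl
    -- Off the kernel this is the diagonal quadratic equation divided by `p k`; in the kernel both
    -- sides are zero, as `Δ` vanishes there.
    have hdiag : ∀ k, -2 * (Δ k k).re = (if p k = 0 then 0 else -(δ k k).re) +
        ∑ l, ‖Δ k l‖ ^ 2 / p k := by
      intro k
      split_ifs with hk
      · simp [hk, hzero k k hk]
      · have h1 := congrArg Complex.re (hentry k k)
        rw [hΔh.sum_mul_re, Complex.add_re, Complex.re_ofReal_mul, Complex.re_ofReal_mul,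
          Complex.ofReal_re, Real.mul_self_sqrt (hp k)] at h1
        rw [← Finset.sum_div]
        field_simp
        linarith
    have htr0 : ∑ k, (δ k k).re = 0 := by
      have := congrArg Complex.re (trace_deviation σ τ)
      rwa [trace, Complex.re_sum] at this
    -- The deviation has trace zero, so minus its trace off the kernel is its trace over the kernel.
    have hsplit : ∑ k, (if p k = 0 then 0 else -(δ k k).re) = ∑ k with p k = 0, (δ k k).re := by
      rw [Finset.sum_filter]
      have : ∑ k, ((if p k = 0 then (δ k k).re else 0) - (if p k = 0 then 0 else -(δ k k).re)) =
          ∑ k, (δ k k).re := by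
        refine Finset.sum_congr rfl fun k _ => ?_
        split_ifs <;> simp
      rw [Finset.sum_sub_distrib, htr0] at this
      linarith
    rw [buresDistSq, hF, htrW, ← hsplit, ← Finset.sum_add_distrib]
    rw [← Finset.sum_congr rfl fun k _ => hdiag k, ← Finset.mul_sum]
    ring

end DensityMatrix

/-! ### First-order expansions of matrix-valued functions -/

section FirstOrder

open Matrix

variable {n d : ℕ}

/-- The matrix `∑ i, v_i M_i`. -/
noncomputable def dirComb (M : Fin n → Matrix (Fin d) (Fin d) ℂ) (v : Fin n → ℝ) :
    Matrix (Fin d) (Fin d) ℂ :=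
  ∑ i, (v i : ℂ) • M i

theorem dirComb_apply (M : Fin n → Matrix (Fin d) (Fin d) ℂ) (v : Fin n → ℝ) (k l : Fin d) :
    dirComb M v k l = ∑ i, (v i : ℂ) * M i k l := by
  simp [dirComb, Matrix.sum_apply]

theorem dirComb_mul_mul (P Q : Matrix (Fin d) (Fin d) ℂ) (M : Fin n → Matrix (Fin d) (Fin d) ℂ)
    (v : Fin n → ℝ) : dirComb (fun i => P * M i * Q) v = P * dirComb M v * Q := by
  simp [dirComb, Matrix.mul_sum, Matrix.sum_mul]

theorem isBigO_coord (i : Fin n) :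
    (fun v : Fin n → ℝ => ((v i : ℝ) : ℂ)) =O[𝓝 0] fun v => ‖v‖ :=
  IsBigO.of_bound 1 (Eventually.of_forall fun v => by
    simpa using norm_le_pi_norm v i)

theorem isBigO_dirComb (M : Fin n → Matrix (Fin d) (Fin d) ℂ) (k l : Fin d) :
    (fun v : Fin n → ℝ => dirComb M v k l) =O[𝓝 0] fun v => ‖v‖ := by
  simp only [dirComb_apply, mul_comm]
  exact IsBigO.fun_sum fun i _ => (isBigO_coord i).const_mul_left _

theorem isLittleO_sub_dirComb {A : (Fin n → ℝ) → Matrix (Fin d) (Fin d) ℂ} {x : Fin n → ℝ}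
    {k l : Fin d} (hA : DifferentiableAt ℝ (fun z => A z k l) x) :
    (fun v => A (x + v) k l - A x k l - dirComb (matPartial A x) v k l)
      =o[𝓝 0] fun v => ‖v‖ := by
  have h := (hasFDerivAt_iff_isLittleO_nhds_zero.1 hA.hasFDerivAt).norm_right
  refine h.congr_left fun v => ?_
  congr 1
  have hv : v = ∑ i, v i • (Pi.single i (1 : ℝ) : Fin n → ℝ) := by
    conv_lhs => rw [← Finset.univ_sum_single v]
    refine Finset.sum_congr rfl fun i _ => ?_
    rw [← Pi.single_smul, smul_eq_mul, mul_one]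
  conv_lhs => rw [hv, map_sum]
  rw [dirComb_apply]
  refine Finset.sum_congr rfl fun i _ => ?_
  rw [map_smul]
  rfl

theorem isLittleO_mul_mul {F : (Fin n → ℝ) → Matrix (Fin d) (Fin d) ℂ} {g : (Fin n → ℝ) → ℝ}
    {f : Filter (Fin n → ℝ)} (h : ∀ a b, (fun v => F v a b) =o[f] g)
    (P Q : Matrix (Fin d) (Fin d) ℂ) (k l : Fin d) : (fun v => (P * F v * Q) k l) =o[f] g := by
  simp only [mul_apply]
  refine IsLittleO.fun_sum fun b _ => ?_
  simp only [mul_comm _ (Q b l)]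
  exact (IsLittleO.fun_sum fun a _ => (h a b).const_mul_left _).const_mul_left _

theorem Asymptotics.IsLittleO.complex_re {α : Type*} {l : Filter α} {f : α → ℂ} {g : α → ℝ}
    (h : f =o[l] g) : (fun v => (f v).re) =o[l] g :=
  IsBigO.trans_isLittleO (IsBigO.of_bound 1 (Eventually.of_forall fun v => by
    simpa using Complex.abs_re_le_norm (f v))) h

theorem isLittleO_norm_sq_sub {α : Type*} {f : Filter α} {a b : α → ℂ} {g : α → ℝ}
    (hab : (fun v => a v - b v) =o[f] g) (hb : b =O[f] g) :
    (fun v => ‖a v‖ ^ 2 - ‖b v‖ ^ 2) =o[f] fun v => g v ^ 2 := by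
  have ha : a =O[f] g := by
    have := hab.isBigO.add hb
    simpa using this
  have h1 : (fun v => ‖a v‖ - ‖b v‖) =o[f] g :=
    IsLittleO.of_norm_left (IsBigO.trans_isLittleO (IsBigO.of_bound 1 (Eventually.of_forall
      fun v => by simpa using abs_norm_sub_norm_le (a v) (b v))) hab.norm_left)
  have h2 := h1.mul_isBigO (ha.norm_left.add hb.norm_left)
  refine h2.congr (fun v => ?_) (fun v => ?_) <;> ring

end FirstOrder

/-! ### Second-order expansion of the squared Bures distance -/

section BuresAsymptotics

open Matrix

variable {n d : ℕ} {ρ : (Fin n → ℝ) → DensityMatrix d} {x : Fin n → ℝ}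

theorem isLittleO_deviation (hρ : ∀ a b, ContDiffAt ℝ 2 (fun y => (ρ y).mat a b) x) (k l : Fin d) :
    (fun v => (ρ x).deviation (ρ (x + v)) k l - dirComb (eigenPartial ρ x) v k l)
      =o[𝓝 0] fun v => ‖v‖ := by
  set U := (ρ x).eigenUnitary with hU
  have h := isLittleO_mul_mul (F := fun v => (ρ (x + v)).mat - (ρ x).mat -
    dirComb (matPartial (fun y => (ρ y).mat) x) v) (fun a b => isLittleO_sub_dirComb
      (A := fun y => (ρ y).mat) ((hρ a b).differentiableAt (by simp))) Uᴴ U k l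
  refine h.congr_left fun v => ?_
  have e1 : dirComb (eigenPartial ρ x) v =
      Uᴴ * dirComb (matPartial (fun y => (ρ y).mat) x) v * U := dirComb_mul_mul _ _ _ v
  rw [e1, DensityMatrix.deviation, ← (ρ x).conj_mat_eq, ← hU, ← Matrix.sub_apply]
  simp only [Matrix.mul_sub, Matrix.sub_mul]

theorem sum_sum_mul_comm (G : Fin n → Fin n → Fin d → Fin d → ℝ) (v : Fin n → ℝ) :
    ∑ i, ∑ j, (2 * ∑ k, ∑ l, G i j k l) * v i * v j =
      2 * ∑ k, ∑ l, ∑ i, ∑ j, G i j k l * v i * v j := by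
  simp only [Finset.mul_sum, Finset.sum_mul]
  calc _ = ∑ i, ∑ k, ∑ j, ∑ l, 2 * G i j k l * v i * v j :=
        Finset.sum_congr rfl fun i _ => Finset.sum_comm
    _ = ∑ k, ∑ i, ∑ j, ∑ l, 2 * G i j k l * v i * v j := Finset.sum_comm
    _ = ∑ k, ∑ i, ∑ l, ∑ j, 2 * G i j k l * v i * v j :=
        Finset.sum_congr rfl fun k _ => Finset.sum_congr rfl fun i _ => Finset.sum_comm
    _ = ∑ k, ∑ l, ∑ i, ∑ j, 2 * G i j k l * v i * v j :=
        Finset.sum_congr rfl fun k _ => Finset.sum_comm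
    _ = _ := by simp only [mul_assoc]

/-- The quadratic form of the quantum Fisher information matrix. -/
theorem sum_qfi_mul (ρ : (Fin n → ℝ) → DensityMatrix d) (x v : Fin n → ℝ) :
    ∑ i, ∑ j, qfi ρ x i j * v i * v j = 2 * ∑ k, ∑ l,
      ‖dirComb (eigenPartial ρ x) v k l‖ ^ 2 / ((ρ x).eigenvalue k + (ρ x).eigenvalue l) := by
  set p := (ρ x).eigenvalue
  have hp : ∀ k, 0 ≤ p k := (ρ x).eigenvalue_nonneg
  have hterm : ∀ k l, ‖dirComb (eigenPartial ρ x) v k l‖ ^ 2 / (p k + p l) =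
      ∑ i, ∑ j, (if 0 < p k + p l then
        (eigenPartial ρ x i k l * eigenPartial ρ x j l k).re / (p k + p l) else 0) * v i * v j := by
    intro k l
    have hh : ∀ j, eigenPartial ρ x j l k = star (eigenPartial ρ x j k l) := fun j =>
      ((isHermitian_conjTranspose_mul_mul _ (partialState_isHermitian ρ x j)).apply l k).symm
    split_ifs with h
    · have e : ‖dirComb (eigenPartial ρ x) v k l‖ ^ 2 =
          (dirComb (eigenPartial ρ x) v k l * star (dirComb (eigenPartial ρ x) v k l)).re := by
        rw [Complex.star_def, Complex.mul_conj, Complex.normSq_eq_norm_sq, Complex.ofReal_re]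
      rw [e, dirComb_apply, star_sum, Finset.sum_mul_sum, Complex.re_sum, Finset.sum_div]
      refine Finset.sum_congr rfl fun i _ => ?_
      rw [Complex.re_sum, Finset.sum_div]
      refine Finset.sum_congr rfl fun j _ => ?_
      rw [hh j, star_mul', Complex.star_def, Complex.conj_ofReal]
      have : (v i : ℂ) * eigenPartial ρ x i k l * ((v j : ℂ) * (starRingEnd ℂ) (eigenPartial ρ x j k l))
          = ((v i * v j : ℝ) : ℂ) *
            (eigenPartial ρ x i k l * (starRingEnd ℂ) (eigenPartial ρ x j k l)) := by
        push_cast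
        ring
      rw [this, Complex.re_ofReal_mul]
      ring
    · have : p k + p l = 0 := le_antisymm (not_lt.1 h) (add_nonneg (hp k) (hp l))
      simp [this]
  have e2 : ∀ i j, qfi ρ x i j = 2 * ∑ k, ∑ l, if 0 < p k + p l then
        (eigenPartial ρ x i k l * eigenPartial ρ x j l k).re / (p k + p l) else 0 := by
    intro i j
    rw [qfi_eq_sldForm]
    simp only [sldForm, true_and]
    rfl
  simp only [hterm, e2]
  exact sum_sum_mul_comm _ v

/-- The two second-order contributions to the squared Bures distance combine to the quadratic form
of the quantum Fisher information matrix. -/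
theorem sum_bures_weights {p : Fin d → ℝ} (hp : ∀ k, 0 ≤ p k) {q : Fin d → Fin d → ℝ}
    (hq : ∀ k l, q k l = q l k) :
    ∑ k with p k = 0, ∑ l, q k l / p l + ∑ k, ∑ l, (p k * p l / (p k + p l) ^ 2 * q k l) / p k =
      1 / 2 * ∑ k, ∑ l, q k l / (p k + p l) := by
  set F : Fin d → Fin d → ℝ := fun k l =>
    (if p k = 0 then q k l / p l else 0) + (p k * p l / (p k + p l) ^ 2 * q k l) / p k with hF
  have e1 : ∑ k with p k = 0, ∑ l, q k l / p l +
      ∑ k, ∑ l, (p k * p l / (p k + p l) ^ 2 * q k l) / p k = ∑ k, ∑ l, F k l := by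
    rw [Finset.sum_filter, ← Finset.sum_add_distrib]
    refine Finset.sum_congr rfl fun k _ => ?_
    simp only [hF, Finset.sum_add_distrib]
    split_ifs <;> simp
  -- The identity holds only after symmetrization: for positive eigenvalues the two weights are `p_l
  -- / (p_k + p_l)²` and `p_k / (p_k + p_l)²`, and if just one eigenvalue vanishes a single kernel
  -- term supplies everything.
  have e2 : ∀ k l, F k l + F l k = q k l / (p k + p l) := by
    intro k l
    simp only [hF, hq l k]
    rcases (hp k).eq_or_lt with hk | hk <;> rcases (hp l).eq_or_lt with hl | hl
    · simp [← hk, ← hl]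
    · simp [← hk, hl.ne']
    · simp [← hl, hk.ne']
    · have := (add_pos hk hl).ne'
      simp only [hk.ne', hl.ne', if_false, add_comm (p l) (p k)]
      field_simp
      ring
  have e3 : ∑ k, ∑ l, F k l + ∑ k, ∑ l, F k l = ∑ k, ∑ l, q k l / (p k + p l) := by
    conv_lhs => arg 2; rw [Finset.sum_comm]
    simp only [← Finset.sum_add_distrib, e2]
  rw [e1, ← e3]
  ring

namespace IsBlockFrame

variable {V N : (Fin n → ℝ) → Matrix (Fin d) (Fin d) ℂ}

theorem eigenFrame_self (h : IsBlockFrame ρ x V N) : eigenFrame ρ V x = 1 := by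
  rw [eigenFrame, h.frame_self, DensityMatrix.eigenUnitary_conjTranspose_mul]

theorem eigenPartial_self_eq (h : IsBlockFrame ρ x V N) (j : Fin n) (k l : Fin d) :
    eigenPartial ρ x j k l = matPartial N x j k l +
      connection ρ V x j k l * (((ρ x).eigenvalue l - (ρ x).eigenvalue k : ℝ) : ℂ) := by
  rw [h.eventually_eigenPartial_eq.self_of_nhds, h.eigenFrame_self]
  simp

/-- Between the two blocks `N` is identically zero, so the mixing of kernel and support to first
order is due to the rotation of the frame alone. -/
theorem dirComb_eigenPartial (h : IsBlockFrame ρ x V N) (v : Fin n → ℝ) {k l : Fin d}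
    (hk : (ρ x).eigenvalue k = 0) (hl : (ρ x).eigenvalue l ≠ 0) :
    dirComb (eigenPartial ρ x) v k l =
      ((ρ x).eigenvalue l : ℂ) * dirComb (connection ρ V x) v k l := by
  have h0 : ∀ j, matPartial N x j k l = 0 := by
    intro j
    have : (fun y => N y k l) = fun _ => 0 :=
      funext fun y => h.block_eq_zero y k l fun e => hl (e.1 hk)
    simp [matPartial, this]
  simp only [dirComb_apply, h.eigenPartial_self_eq, h0, hk, Finset.mul_sum]
  refine Finset.sum_congr rfl fun i _ => ?_
  push_cast
  ring

/-- The kernel block of `N` vanishes at `x` together with its first derivatives, since `∂_j ρ` has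
no component inside the kernel. -/
theorem isLittleO_block (h : IsBlockFrame ρ x V N)
    (hρ : ∀ a b, ContDiffAt ℝ 2 (fun y => (ρ y).mat a b) x) {k l : Fin d}
    (hk : (ρ x).eigenvalue k = 0) (hl : (ρ x).eigenvalue l = 0) :
    (fun v => N (x + v) k l) =o[𝓝 0] fun v => ‖v‖ := by
  have h0 : ∀ j, matPartial N x j k l = 0 := by
    intro j
    have e := h.eigenPartial_self_eq j k l
    rw [eigenPartial_eq_zero hρ j (by rw [hk, hl, add_zero]), hk, hl] at e
    simpa using e.symm
  refine (isLittleO_sub_dirComb ((h.contDiffAt_block k l).differentiableAt (by simp))).congr_left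
    fun v => ?_
  have : N x k l = 0 := by
    rw [h.block_self, diagonal_apply]
    split_ifs <;> simp [hk]
  simp [dirComb_apply, h0, this]

/-- The frame, seen from the eigenbasis of `ρ x`. -/
theorem isLittleO_frame (h : IsBlockFrame ρ x V N) (k l : Fin d) :
    (fun v => ((ρ x).eigenUnitaryᴴ * V (x + v)) k l - (1 : Matrix (Fin d) (Fin d) ℂ) k l -
      dirComb (connection ρ V x) v k l) =o[𝓝 0] fun v => ‖v‖ := by
  have h1 := isLittleO_mul_mul (F := fun v => V (x + v) - V x - dirComb (matPartial V x) v)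
    (fun a b => isLittleO_sub_dirComb ((h.contDiffAt_frame a b).differentiableAt (by simp)))
    (ρ x).eigenUnitaryᴴ 1 k l
  refine h1.congr_left fun v => ?_
  have e : connection ρ V x = fun j => (ρ x).eigenUnitaryᴴ * matPartial V x j * 1 := by
    funext j
    rw [connection, h.eigenFrame_self, h.frame_self]
    simp
  rw [e, dirComb_mul_mul, ← Matrix.sub_apply, ← Matrix.sub_apply]
  simp only [Matrix.mul_sub, Matrix.mul_one, h.frame_self,
    DensityMatrix.eigenUnitary_conjTranspose_mul]

/-- Write `T = U* V = 1 + K + o(|v|)` with `K` the connection. In the kernel block `N = o(|v|)`, so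
replacing `T` by `1` costs `o(|v|²)`. Between the blocks `N = 0`. In the other block `T k a` and `T
k b` are already `O(|v|)`, so `N` may be replaced by `diag p` and `T` by `K`. -/
theorem isLittleO_conj_block_term (h : IsBlockFrame ρ x V N)
    (hρ : ∀ a b, ContDiffAt ℝ 2 (fun y => (ρ y).mat a b) x) {k : Fin d}
    (hk : (ρ x).eigenvalue k = 0) (a b : Fin d) :
    (fun v => ((ρ x).eigenUnitaryᴴ * V (x + v)) k a * N (x + v) a b *
        star (((ρ x).eigenUnitaryᴴ * V (x + v)) k b) -
      ((if k = a ∧ k = b then N (x + v) a b else 0) + if a = b then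
        ((ρ x).eigenvalue a : ℂ) * (dirComb (connection ρ V x) v k a *
          star (dirComb (connection ρ V x) v k b)) else 0))
      =o[𝓝 0] fun v => ‖v‖ ^ 2 := by
  set T : (Fin n → ℝ) → Matrix (Fin d) (Fin d) ℂ := fun v => (ρ x).eigenUnitaryᴴ * V (x + v)
  set K : (Fin n → ℝ) → Matrix (Fin d) (Fin d) ℂ := fun v => dirComb (connection ρ V x) v
  have hK : ∀ a, (fun v => K v k a) =O[𝓝 0] fun v => ‖v‖ := fun a => isBigO_dirComb _ k a
  have hT : ∀ a, (fun v => T v k a - (1 : Matrix (Fin d) (Fin d) ℂ) k a - K v k a)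
      =o[𝓝 0] fun v => ‖v‖ := fun a => h.isLittleO_frame k a
  have hT1 : ∀ a, (fun v => T v k a - (1 : Matrix (Fin d) (Fin d) ℂ) k a)
      =O[𝓝 0] fun v => ‖v‖ := by
    intro a
    simpa using (hT a).isBigO.add (hK a)
  have hn0 : Tendsto (fun v : Fin n → ℝ => ‖v‖) (𝓝 0) (𝓝 0) := by
    simpa using (continuous_norm (E := Fin n → ℝ)).tendsto 0
  have hone : (fun v : Fin n → ℝ => ‖v‖) =O[𝓝 0] fun _ => (1 : ℝ) := hn0.isBigO_one ℝ
  have hTb : ∀ a, (fun v => T v k a) =O[𝓝 0] fun _ => (1 : ℝ) := by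
    intro a
    have := ((hT1 a).trans hone).add (isBigO_const_const ((1 : Matrix (Fin d) (Fin d) ℂ) k a)
      one_ne_zero (𝓝 (0 : Fin n → ℝ)))
    simpa using this
  have hstar : ∀ {f : (Fin n → ℝ) → ℂ} {g : (Fin n → ℝ) → ℝ}, f =O[𝓝 0] g →
      (fun v => star (f v)) =O[𝓝 0] g := fun hf =>
    IsBigO.of_norm_left (by simpa using hf.norm_left)
  by_cases ha : (ρ x).eigenvalue a = 0 <;> by_cases hb : (ρ x).eigenvalue b = 0
  · have h1 : (fun v => T v k a * star (T v k b) - (1 : Matrix (Fin d) (Fin d) ℂ) k a *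
        star ((1 : Matrix (Fin d) (Fin d) ℂ) k b)) =O[𝓝 0] fun v => ‖v‖ := by
      have e1 := (hT1 a).mul (hstar (hTb b))
      have e2 := (hstar (hT1 b)).const_mul_left ((1 : Matrix (Fin d) (Fin d) ℂ) k a)
      simp only [mul_one] at e1
      refine (e1.add e2).congr_left fun v => ?_
      rw [star_sub]
      ring
    refine ((h.isLittleO_block hρ ha hb).mul_isBigO h1).congr (fun v => ?_) (fun v => by ring)
    have e : (if k = a ∧ k = b then N (x + v) a b else 0) = N (x + v) a b *
        ((1 : Matrix (Fin d) (Fin d) ℂ) k a * star ((1 : Matrix (Fin d) (Fin d) ℂ) k b)) := by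
      by_cases e1 : k = a <;> by_cases e2 : k = b <;> simp [e1, e2, Matrix.one_apply]
    rw [e, ha]
    simp only [Complex.ofReal_zero, zero_mul, ite_self, add_zero]
    ring
  · have h0 : ∀ y, N y a b = 0 := fun y => h.block_eq_zero y a b fun e => hb (e.1 ha)
    have hab : a ≠ b := fun e => hb (e ▸ ha)
    simp [h0, hab]
  · have h0 : ∀ y, N y a b = 0 := fun y => h.block_eq_zero y a b fun e => ha (e.2 hb)
    have hab : a ≠ b := fun e => ha (e ▸ hb)
    simp [h0, hab]
  · have hka : k ≠ a := fun e => ha (e ▸ hk)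
    have hkb : k ≠ b := fun e => hb (e ▸ hk)
    have hN : (fun v => N (x + v) a b - N x a b) =o[𝓝 0] fun _ => (1 : ℝ) := by
      rw [isLittleO_one_iff]
      have h1 : Tendsto (fun v => N (x + v) a b) (𝓝 0) (𝓝 (N x a b)) := by
        have h2 : Tendsto (fun v => x + v) (𝓝 0) (𝓝 x) :=
          (continuous_const.add continuous_id).tendsto' _ _ (by simp)
        exact (h.contDiffAt_block a b).continuousAt.tendsto.comp h2
      simpa using h1.sub_const (N x a b)
    have ea : (1 : Matrix (Fin d) (Fin d) ℂ) k a = 0 := Matrix.one_apply_ne hka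
    have eb : (1 : Matrix (Fin d) (Fin d) ℂ) k b = 0 := Matrix.one_apply_ne hkb
    have hTa := hT1 a
    have hTb := hT1 b
    have hTa' := hT a
    have hTb' := hT b
    simp only [ea, eb, sub_zero] at hTa hTb hTa' hTb'
    have hstar' : (fun v => star (T v k b - K v k b)) =o[𝓝 0] fun v => ‖v‖ :=
      IsLittleO.of_norm_left (by simpa only [norm_star] using hTb'.norm_left)
    have t1 := hN.mul_isBigO (hTa.mul (hstar hTb))
    have t2 := ((hTa'.mul_isBigO (hstar hTb)).add ((hK a).mul_isLittleO hstar')).const_mul_left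
      (N x a b)
    have e3 : ∀ v, (if a = b then ((ρ x).eigenvalue a : ℂ) * (K v k a * star (K v k b)) else 0) =
        N x a b * (K v k a * star (K v k b)) := by
      intro v
      rw [h.block_self, diagonal_apply]
      split_ifs <;> simp
    have t3 : _ =o[𝓝 0] fun v : Fin n → ℝ => ‖v‖ ^ 2 :=
      (t1.congr_right fun v => by rw [one_mul, ← sq]).add (t2.congr_right fun v => by rw [← sq])
    refine t3.congr_left fun v => ?_
    rw [e3, if_neg fun e => hka e.1, star_sub]
    ring

/-- The second-order expansion of the diagonal of `ρ` on the kernel of `ρ x`. -/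
theorem isLittleO_sum_deviation (h : IsBlockFrame ρ x V N)
    (hρ : ∀ a b, ContDiffAt ℝ 2 (fun y => (ρ y).mat a b) x) :
    (fun v => ∑ k with (ρ x).eigenvalue k = 0, ((ρ x).deviation (ρ (x + v)) k k).re -
      (vanishingSum ρ x (x + v) + ∑ k with (ρ x).eigenvalue k = 0, ∑ l,
        ‖dirComb (eigenPartial ρ x) v k l‖ ^ 2 / (ρ x).eigenvalue l))
      =o[𝓝 0] fun v => ‖v‖ ^ 2 := by
  set p := (ρ x).eigenvalue
  set U := (ρ x).eigenUnitary
  have hx : Tendsto (fun v => x + v) (𝓝 0) (𝓝 x) :=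
    (continuous_const.add continuous_id).tendsto' _ _ (by simp)
  have key : ∀ k, p k = 0 → (fun v => ((ρ x).deviation (ρ (x + v)) k k).re -
      ((N (x + v) k k).re + ∑ l, ‖dirComb (eigenPartial ρ x) v k l‖ ^ 2 / p l))
      =o[𝓝 0] fun v => ‖v‖ ^ 2 := by
    intro k hk
    have h1 := IsLittleO.fun_sum (s := Finset.univ) fun (b : Fin d) _ =>
      IsLittleO.fun_sum (s := Finset.univ) fun (a : Fin d) _ =>
        h.isLittleO_conj_block_term hρ hk a b
    refine h1.complex_re.congr' ?_ EventuallyEq.rfl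
    filter_upwards [hx.eventually h.mat_eq] with v hv
    have e1 : (ρ x).deviation (ρ (x + v)) k k = ∑ b, ∑ a, (Uᴴ * V (x + v)) k a * N (x + v) a b *
        star ((Uᴴ * V (x + v)) k b) := by
      have e : Uᴴ * (ρ (x + v)).mat * U = Uᴴ * V (x + v) * N (x + v) * (Uᴴ * V (x + v))ᴴ := by
        rw [hv, conjTranspose_mul, conjTranspose_conjTranspose]
        simp only [Matrix.mul_assoc]
      rw [DensityMatrix.deviation, Matrix.sub_apply, diagonal_apply_eq, e]
      change _ - ((p k : ℝ) : ℂ) = _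
      rw [hk, Complex.ofReal_zero, sub_zero, mul_apply]
      refine Finset.sum_congr rfl fun b _ => ?_
      rw [mul_apply, Finset.sum_mul]
      rfl
    -- The factor `p l` relating `∂ρ` to the connection turns `|F|² / p l` into `p l |K|²`; for `p l
    -- = 0` both sides are zero.
    have e2 : ∀ l, ‖dirComb (eigenPartial ρ x) v k l‖ ^ 2 / p l = ((p l : ℂ) *
        (dirComb (connection ρ V x) v k l * star (dirComb (connection ρ V x) v k l))).re := by
      intro l
      rw [Complex.star_def, Complex.mul_conj, Complex.normSq_eq_norm_sq, ← Complex.ofReal_mul,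
        Complex.ofReal_re]
      by_cases hl : p l = 0
      · simp [hl]
      · rw [h.dirComb_eigenPartial v hk hl, norm_mul, Complex.norm_real, Real.norm_eq_abs, mul_pow,
          sq_abs]
        change p l ^ 2 * _ / p l = _
        field_simp
    have e3 : ∑ b, ∑ a, (if k = a ∧ k = b then N (x + v) a b else 0) = N (x + v) k k := by
      rw [Finset.sum_eq_single k, Finset.sum_eq_single k] <;> simp +contextual [eq_comm]
    simp only [Finset.sum_sub_distrib, Finset.sum_add_distrib, e1, e3, e2,
      Complex.sub_re, Complex.add_re, Finset.sum_ite_eq', Finset.mem_univ, if_true, Complex.re_sum]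
    rfl
  have h1 := IsLittleO.fun_sum (s := Finset.univ.filter fun k => p k = 0) fun k hk =>
    key k (by simpa using hk)
  refine h1.congr' ?_ EventuallyEq.rfl
  filter_upwards [hx.eventually (h.eventually_vanishingSum_eq hρ)] with v hv
  rw [hv, Finset.sum_sub_distrib, Finset.sum_add_distrib]

end IsBlockFrame

/-- The second-order expansion of the squared Bures distance. -/
theorem isLittleO_buresDistSq (hρ : ∀ a b, ContDiffAt ℝ 2 (fun y => (ρ y).mat a b) x) :
    (fun v => (ρ x).buresDistSq (ρ (x + v)) - ∑ i, ∑ j, ((1 / 4 : ℝ) • (qfi ρ x +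
      (2 : ℝ) • hessian (vanishingSum ρ x) x)) i j * v i * v j) =o[𝓝 0] fun v => ‖v‖ ^ 2 := by
  obtain ⟨V, N, h⟩ := exists_isBlockFrame hρ
  obtain ⟨c, hc, hgap⟩ := (ρ x).exists_gap
  choose Δ hΔ hΔ0 hΔle hdist using fun v => (ρ x).exists_buresDistSq_eq (ρ (x + v)) hc hgap
  set p := (ρ x).eigenvalue
  have hp : ∀ k, 0 ≤ p k := (ρ x).eigenvalue_nonneg
  set F : (Fin n → ℝ) → Matrix (Fin d) (Fin d) ℂ := dirComb (eigenPartial ρ x)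
  set δ : (Fin n → ℝ) → Matrix (Fin d) (Fin d) ℂ := fun v => (ρ x).deviation (ρ (x + v))
  have hF : ∀ k l, (fun v => F v k l) =O[𝓝 0] fun v => ‖v‖ := fun k l => isBigO_dirComb _ k l
  have hδF : ∀ k l, (fun v => δ v k l - F v k l) =o[𝓝 0] fun v => ‖v‖ := isLittleO_deviation hρ
  have hδ : ∀ k l, (fun v => δ v k l) =O[𝓝 0] fun v => ‖v‖ := fun k l => by
    simpa using (hδF k l).isBigO.add (hF k l)
  -- The a priori bound gives `Δ = O(|v|)`, hence `Δ² = o(|v|)`, so the quadratic equation for `Δ`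
  -- becomes linear to leading order.
  have hΔO : ∀ k l, (fun v => Δ v k l) =O[𝓝 0] fun v => ‖v‖ := by
    intro k l
    have h1 : (fun v => 1 / c ^ 2 * ∑ k, ∑ l, ‖δ v k l‖ ^ 2) =O[𝓝 0] fun v => ‖v‖ ^ 2 :=
      (IsBigO.fun_sum fun k _ => IsBigO.fun_sum fun l _ =>
        ((hδ k l).norm_left.pow 2)).const_mul_left _
    have h2 : (fun v => ‖Δ v k l‖ ^ 2) =O[𝓝 0] fun v => ‖v‖ ^ 2 := by
      refine IsBigO.trans (IsBigO.of_bound 1 (Eventually.of_forall fun v => ?_)) h1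
      rw [one_mul, Real.norm_of_nonneg (by positivity), Real.norm_of_nonneg (by positivity)]
      refine le_trans ?_ (hΔle v)
      refine (Finset.single_le_sum (f := fun l => ‖Δ v k l‖ ^ 2) (fun _ _ => by positivity)
        (Finset.mem_univ l)).trans ?_
      exact Finset.single_le_sum (f := fun k => ∑ l, ‖Δ v k l‖ ^ 2) (fun _ _ => by positivity)
        (Finset.mem_univ k)
    exact (IsBigO.of_pow two_ne_zero h2).of_norm_left
  have hn0 : Tendsto (fun v : Fin n → ℝ => ‖v‖) (𝓝 0) (𝓝 0) := by
    simpa using (continuous_norm (E := Fin n → ℝ)).tendsto 0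
  have hΔ2 : ∀ k l, (fun v => (Δ v * Δ v) k l) =o[𝓝 0] fun v => ‖v‖ := by
    intro k l
    simp only [mul_apply]
    refine IsLittleO.fun_sum fun m _ => ?_
    have h1 : (fun v => Δ v k m) =o[𝓝 0] fun _ => (1 : ℝ) :=
      (hΔO k m).trans_isLittleO ((isLittleO_one_iff ℝ).2 hn0)
    simpa using h1.mul_isBigO (hΔO m l)
  have hterm : ∀ k l, (fun v => ‖Δ v k l‖ ^ 2 / p k -
      (p k * p l / (p k + p l) ^ 2 * ‖F v k l‖ ^ 2) / p k) =o[𝓝 0] fun v => ‖v‖ ^ 2 := by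
    intro k l
    by_cases hk : p k = 0
    · simp [hk]
    have hkl : p k + p l ≠ 0 :=
      (add_pos_of_pos_of_nonneg (lt_of_le_of_ne (hp k) (Ne.symm hk)) (hp l)).ne'
    -- The ratio of `Δ k l` to `δ k l` obtained by discarding `Δ²`.
    set w : ℝ := √(p k) * √(p l) / (p k + p l) with hw
    have hw2 : w ^ 2 = p k * p l / (p k + p l) ^ 2 := by
      rw [hw, div_pow, mul_pow, Real.sq_sqrt (hp k), Real.sq_sqrt (hp l)]
    have e1 : (fun v => Δ v k l - (w : ℂ) * F v k l) =o[𝓝 0] fun v => ‖v‖ := by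
      refine (((hδF k l).const_mul_left (w : ℂ)).sub
        ((hΔ2 k l).const_mul_left (((p k + p l : ℝ) : ℂ)⁻¹))).congr_left fun v => ?_
      have e := hΔ v k l
      have hkl' : ((p k + p l : ℝ) : ℂ) ≠ 0 := by exact_mod_cast hkl
      have hw' : (w : ℂ) = ((p k + p l : ℝ) : ℂ)⁻¹ * ((√(p k) * √(p l) : ℝ) : ℂ) := by
        rw [hw, Complex.ofReal_div]
        ring
      have e' : Δ v k l = ((p k + p l : ℝ) : ℂ)⁻¹ *
          (((√(p k) * √(p l) : ℝ) : ℂ) * δ v k l - (Δ v * Δ v) k l) := by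
        rw [eq_inv_mul_iff_mul_eq₀ hkl']
        exact eq_sub_of_add_eq e
      rw [e', hw']
      ring
    have e2 := isLittleO_norm_sq_sub e1 ((hF k l).const_mul_left _)
    refine (e2.const_mul_left (p k)⁻¹).congr_left fun v => ?_
    rw [norm_mul, mul_pow, Complex.norm_real, Real.norm_eq_abs, sq_abs, hw2]
    ring
  have h1 := IsLittleO.fun_sum (s := Finset.univ) fun (k : Fin d) _ =>
    IsLittleO.fun_sum (s := Finset.univ) fun (l : Fin d) _ => hterm k l
  have h2 := h.isLittleO_sum_deviation hρ
  have hS := (h.contDiffAt_vanishingSum hρ).twiceDifferentiableAt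
  have h3 := hS.isLittleO_of_nonneg (Eventually.of_forall (vanishingSum_nonneg ρ x))
    (vanishingSum_self ρ x)
  refine ((h1.add h2).add h3).congr_left fun v => ?_
  have e1 := sum_bures_weights hp (q := fun k l => ‖F v k l‖ ^ 2) fun k l => by
    have : (F v).IsHermitian := by
      refine IsHermitian.ext fun k l => ?_
      simp only [F, dirComb_apply, star_sum, star_mul', Complex.star_def, Complex.conj_ofReal]
      exact Finset.sum_congr rfl fun i _ => congrArg _ ((isHermitian_conjTranspose_mul_mul _
        (partialState_isHermitian ρ x i)).apply k l)
    rw [← this.apply l k, norm_star]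
  have e2 := sum_qfi_mul ρ x v
  have e3 : ∑ i, ∑ j, ((1 / 4 : ℝ) • (qfi ρ x +
      (2 : ℝ) • hessian (vanishingSum ρ x) x)) i j * v i * v j =
      1 / 4 * ∑ i, ∑ j, qfi ρ x i j * v i * v j +
        1 / 2 * ∑ i, ∑ j, hessian (vanishingSum ρ x) x i j * v i * v j := by
    simp only [Finset.mul_sum, ← Finset.sum_add_distrib]
    refine Finset.sum_congr rfl fun i _ => Finset.sum_congr rfl fun j _ => ?_
    simp only [Matrix.smul_apply, Matrix.add_apply, smul_eq_mul]
    ring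
  rw [e3, e2, hdist v]
  simp only [Finset.sum_sub_distrib]
  linarith

end BuresAsymptotics

/-! ### Symmetric logarithmic derivatives -/

section SLD

open Matrix

variable {n d : ℕ} {ρ : (Fin n → ℝ) → DensityMatrix d} {x : Fin n → ℝ}

theorem eigenPartial_isHermitian (ρ : (Fin n → ℝ) → DensityMatrix d) (x : Fin n → ℝ) (i : Fin n) :
    (eigenPartial ρ x i).IsHermitian :=
  isHermitian_conjTranspose_mul_mul _ (partialState_isHermitian ρ x i)

theorem sldMatrix_isHermitian (p : Fin d → ℝ) {A : Matrix (Fin d) (Fin d) ℂ} (hA : A.IsHermitian) :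
    (sldMatrix p A).IsHermitian :=
  IsHermitian.ext fun k l => by
    simp only [sldMatrix, of_apply, star_mul', Complex.star_def, Complex.conj_ofReal]
    rw [← Complex.star_def, hA.apply k l, add_comm]

theorem partialState_eq_conj (ρ : (Fin n → ℝ) → DensityMatrix d) (x : Fin n → ℝ) (i : Fin n) :
    partialState ρ x i =
      (ρ x).eigenUnitary * eigenPartial ρ x i * (ρ x).eigenUnitaryᴴ := by
  have h := (ρ x).eigenUnitary_mul_conjTranspose
  rw [eigenPartial]
  simp only [← Matrix.mul_assoc, h, Matrix.one_mul]
  rw [Matrix.mul_assoc, h, Matrix.mul_one]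

/-- In the eigenbasis the equation reads `(p_k + p_l) L_kl = 2 E_kl`, with `E` the matrix of `∂_i
ρ`; it is solvable because `E_kl = 0` whenever `p_k + p_l = 0`. -/
theorem exists_isSLD (hρ : ∀ a b, ContDiffAt ℝ 2 (fun y => (ρ y).mat a b) x) (i : Fin n) :
    ∃ L, IsSLD ρ x i L := by
  set U := (ρ x).eigenUnitary
  have hU : Uᴴ * U = 1 := (ρ x).eigenUnitary_conjTranspose_mul
  set p := (ρ x).eigenvalue
  set D : Matrix (Fin d) (Fin d) ℂ := diagonal fun k => (p k : ℂ) with hD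
  set S := sldMatrix p (eigenPartial ρ x i) with hS
  refine ⟨U * S * Uᴴ,
    isHermitian_mul_mul_conjTranspose _ (sldMatrix_isHermitian p (eigenPartial_isHermitian ρ x i)),
    ?_⟩
  have h1 : (ρ x).mat = U * D * Uᴴ := (ρ x).mat_eq
  have h2 : (1 / 2 : ℂ) • (S * D + D * S) = eigenPartial ρ x i := by
    ext k l
    rw [Matrix.smul_apply, Matrix.add_apply, hD, mul_diagonal, diagonal_mul, hS, sldMatrix,
      of_apply, smul_eq_mul]
    by_cases h : p k + p l = 0
    · rw [eigenPartial_eq_zero hρ i h]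
      simp
    · have h' : (p k : ℂ) + p l ≠ 0 := by exact_mod_cast h
      push_cast
      field_simp
      ring
  have e1 : U * S * Uᴴ * (U * D * Uᴴ) = U * (S * D) * Uᴴ := by
    calc _ = U * S * (Uᴴ * U) * D * Uᴴ := by simp only [Matrix.mul_assoc]
      _ = _ := by rw [hU, Matrix.mul_one]; simp only [Matrix.mul_assoc]
  have e2 : U * D * Uᴴ * (U * S * Uᴴ) = U * (D * S) * Uᴴ := by
    calc _ = U * D * (Uᴴ * U) * S * Uᴴ := by simp only [Matrix.mul_assoc]
      _ = _ := by rw [hU, Matrix.mul_one]; simp only [Matrix.mul_assoc]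
  rw [h1, e1, e2, ← Matrix.add_mul, ← Matrix.mul_add, ← Matrix.smul_mul, ← Matrix.mul_smul, h2,
    ← partialState_eq_conj]

theorem Matrix.IsHermitian.trace_mul_eq_re {A B : Matrix (Fin d) (Fin d) ℂ} (hA : A.IsHermitian)
    (hB : B.IsHermitian) : (A * B).trace = (((A * B).trace.re : ℝ) : ℂ) := by
  have : star (A * B).trace = (A * B).trace := by
    rw [← trace_conjTranspose, conjTranspose_mul, hA.eq, hB.eq, trace_mul_comm]
  exact (Complex.conj_eq_iff_re.1 this).symm

/-- By cyclicity the trace equals `tr (L_i ∂_j ρ)`. The only entries of `L_i` that the equation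
leaves free lie in the kernel block, where `∂_j ρ` vanishes, so the choice of solution does not
matter. -/
theorem IsSLD.trace_eq_qfi (hρ : ∀ a b, ContDiffAt ℝ 2 (fun y => (ρ y).mat a b) x) {i j : Fin n}
    {Li Lj : Matrix (Fin d) (Fin d) ℂ} (hi : IsSLD ρ x i Li) (hj : IsSLD ρ x j Lj) :
    ((1 / 2 : ℂ) • ((Li * Lj + Lj * Li) * (ρ x).mat)).trace = ((qfi ρ x i j : ℝ) : ℂ) := by
  set U := (ρ x).eigenUnitary
  have hU : Uᴴ * U = 1 := (ρ x).eigenUnitary_conjTranspose_mul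
  have hU' : U * Uᴴ = 1 := (ρ x).eigenUnitary_mul_conjTranspose
  set p := (ρ x).eigenvalue
  set D : Matrix (Fin d) (Fin d) ℂ := diagonal fun k => (p k : ℂ) with hD
  have h1 : (ρ x).mat = U * D * Uᴴ := (ρ x).mat_eq
  set M := Uᴴ * Li * U with hM
  have hLi : Li = U * M * Uᴴ := by
    rw [hM]
    simp only [← Matrix.mul_assoc, hU', Matrix.one_mul]
    rw [Matrix.mul_assoc, hU', Matrix.mul_one]
  have hME : (1 / 2 : ℂ) • (M * D + D * M) = eigenPartial ρ x i := by
    have e1 : Uᴴ * (Li * (ρ x).mat) * U = M * D := by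
      calc Uᴴ * (Li * (ρ x).mat) * U = Uᴴ * Li * U * D * (Uᴴ * U) := by
            rw [h1]; simp only [Matrix.mul_assoc]
        _ = _ := by rw [hU, Matrix.mul_one]
    have e2 : Uᴴ * ((ρ x).mat * Li) * U = D * M := by
      calc Uᴴ * ((ρ x).mat * Li) * U = (Uᴴ * U) * D * (Uᴴ * Li * U) := by
            rw [h1]; simp only [Matrix.mul_assoc]
        _ = _ := by rw [hU, Matrix.one_mul]
    rw [eigenPartial, ← hi.2, ← e1, ← e2]
    simp only [Matrix.mul_smul, Matrix.smul_mul, Matrix.mul_add, Matrix.add_mul]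
    rfl
  have ht1 : ((1 / 2 : ℂ) • ((Li * Lj + Lj * Li) * (ρ x).mat)).trace =
      (Li * partialState ρ x j).trace := by
    rw [← hj.2, Matrix.mul_smul, trace_smul, trace_smul, Matrix.add_mul, Matrix.mul_add, trace_add,
      trace_add, Matrix.mul_assoc Li, Matrix.mul_assoc Lj, trace_mul_comm Lj, Matrix.mul_assoc Li]
  have ht2 : (Li * partialState ρ x j).trace = (M * eigenPartial ρ x j).trace := by
    rw [partialState_eq_conj, hLi]
    calc _ = (U * (M * (Uᴴ * U) * eigenPartial ρ x j * Uᴴ)).trace := by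
          simp only [U, Matrix.mul_assoc]
      _ = _ := by rw [trace_mul_comm, hU, Matrix.mul_one, Matrix.mul_assoc _ Uᴴ, hU, Matrix.mul_one]
  have ht3 : (M * eigenPartial ρ x j).trace =
      (sldMatrix p (eigenPartial ρ x i) * eigenPartial ρ x j).trace := by
    simp only [trace, diag, mul_apply]
    refine Finset.sum_congr rfl fun k _ => Finset.sum_congr rfl fun l _ => ?_
    by_cases h : p k + p l = 0
    · rw [eigenPartial_eq_zero hρ j (k := l) (l := k) (by rwa [add_comm]), mul_zero, mul_zero]
    · have h' : (p k : ℂ) + p l ≠ 0 := by exact_mod_cast h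
      have e := congrFun (congrFun hME k) l
      rw [Matrix.smul_apply, Matrix.add_apply, hD, mul_diagonal, diagonal_mul, smul_eq_mul] at e
      rw [sldMatrix, of_apply, ← e]
      congr 1
      push_cast
      field_simp
      ring
  rw [ht1, ht2, ht3, (sldMatrix_isHermitian p (eigenPartial_isHermitian ρ x i)).trace_mul_eq_re
    (eigenPartial_isHermitian ρ x j), qfi_eq_sldForm, sldForm_eq_trace (ρ x).eigenvalue_nonneg]
  rfl

end SLD

/-! ### Existence and uniqueness of the metric and of the limits -/

section Limits

variable {n d : ℕ} {ρ : (Fin n → ℝ) → DensityMatrix d} {x : Fin n → ℝ}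

/-- The matrix `H + 2 ∂∂S`. -/
noncomputable def regularizedQFI (ρ : (Fin n → ℝ) → DensityMatrix d) (x : Fin n → ℝ) :
    Matrix (Fin n) (Fin n) ℝ :=
  qfi ρ x + (2 : ℝ) • hessian (vanishingSum ρ x) x

theorem contDiffAt_vanishingSum (hρ : ∀ a b, ContDiffAt ℝ 2 (fun y => (ρ y).mat a b) x) :
    ContDiffAt ℝ 2 (vanishingSum ρ x) x := by
  obtain ⟨V, N, h⟩ := exists_isBlockFrame hρ
  exact h.contDiffAt_vanishingSum hρ

theorem qfi_isSymm (ρ : (Fin n → ℝ) → DensityMatrix d) (x : Fin n → ℝ) : (qfi ρ x).IsSymm := by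
  ext i j
  rw [Matrix.transpose_apply, qfi_symm]

theorem regularizedQFI_isSymm (hρ : ∀ a b, ContDiffAt ℝ 2 (fun y => (ρ y).mat a b) x) :
    (regularizedQFI ρ x).IsSymm :=
  (qfi_isSymm ρ x).add
    ((contDiffAt_vanishingSum hρ).twiceDifferentiableAt.hessian_isSymm.smul _)

theorem isBuresMetricAt_iff (hρ : ∀ a b, ContDiffAt ℝ 2 (fun y => (ρ y).mat a b) x)
    (m : Matrix (Fin n) (Fin n) ℝ) :
    IsBuresMetricAt ρ x m ↔ m = (1 / 4 : ℝ) • regularizedQFI ρ x := by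
  have hs : ((1 / 4 : ℝ) • regularizedQFI ρ x).IsSymm := (regularizedQFI_isSymm hρ).smul _
  constructor
  · rintro ⟨hm, h⟩
    have h1 := (isLittleO_buresDistSq hρ).sub h
    rw [← sub_eq_zero]
    refine eq_zero_of_isSymm_of_quadratic (hm.sub hs) fun v => ?_
    refine quadratic_eq_zero_of_isLittleO (h1.congr_left fun v => ?_) v
    simp only [Matrix.sub_apply, sub_mul, Finset.sum_sub_distrib, regularizedQFI]
    ring
  · rintro rfl
    exact ⟨hs, isLittleO_buresDistSq hρ⟩

/-- Once `s` is fixed, the points with small remaining displacements lie in a neighbourhood of `x +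
s e_i`, so an estimate on such a neighbourhood covers both inner limits. -/
theorem hasIteratedLimit_of_near {F : (Fin n → ℝ) → ℝ} {i j : Fin n} {a : ℝ}
    (h : ∀ ε > 0, ∀ᶠ s in 𝓝[≠] (0 : ℝ), ∀ᶠ y in 𝓝 (x + Pi.single i s), |F y - a| < ε) :
    HasIteratedLimit F x i j a := by
  rw [HasIteratedLimit, Metric.tendsto_nhds]
  intro ε hε
  rw [eventually_curry_iff]
  filter_upwards [h ε hε] with s hs
  have ht : Tendsto (fun w : ℝ × (Fin n → ℝ) => x + displacement i j s w.1 w.2)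
      ((𝓝[≠] (0 : ℝ)).curry (𝓝 0)) (𝓝 (x + Pi.single i s)) := by
    refine tendsto_const_nhds.add (Tendsto.mono_left ?_
      (curry_le_prod.trans (prod_mono nhdsWithin_le_nhds le_rfl)))
    rw [← nhds_prod_eq]
    have hc : Continuous fun w : ℝ × (Fin n → ℝ) => displacement i j s w.1 w.2 := by
      refine continuous_pi fun r => ?_
      simp only [displacement]
      split_ifs <;> fun_prop
    refine hc.tendsto' _ _ ?_
    funext r
    by_cases hr : r = i
    · subst hr
      simp [displacement]
    · simp [displacement, hr]
  exact ht.eventually hs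

theorem Filter.curry_neBot {α β : Type*} (f : Filter α) (g : Filter β) [f.NeBot] [g.NeBot] :
    (f.curry g).NeBot := by
  refine neBot_iff.2 fun h => ?_
  have h1 : ∀ᶠ _ in f.curry g, False := by
    rw [h]
    exact eventually_bot
  rw [eventually_curry_iff] at h1
  obtain ⟨_, h2⟩ := h1.exists
  exact h2.exists.elim fun _ h => h

theorem isContinuousQFIAt_iff (hρ : ∀ a b, ContDiffAt ℝ 2 (fun y => (ρ y).mat a b) x)
    (m : Matrix (Fin n) (Fin n) ℝ) : IsContinuousQFIAt ρ x m ↔ m = regularizedQFI ρ x := by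
  have h : IsContinuousQFIAt ρ x (regularizedQFI ρ x) := fun i j =>
    hasIteratedLimit_of_near fun ε hε => eventually_abs_qfi_sub_lt hρ i j hε
  constructor
  · intro hm
    ext i j
    have := Filter.curry_neBot (𝓝[≠] (0 : ℝ)) (𝓝 (0 : Fin n → ℝ))
    have := Filter.curry_neBot (𝓝[≠] (0 : ℝ)) ((𝓝[≠] (0 : ℝ)).curry (𝓝 (0 : Fin n → ℝ)))
    exact tendsto_nhds_unique (hm i j) (h i j)
  · rintro rfl
    exact h

theorem update_eq_add_single (x : Fin n → ℝ) (r : Fin n) (t : ℝ) :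
    Function.update x r t = x + Pi.single r (t - x r) := by
  funext k
  by_cases hk : k = r
  · subst hk
    simp
  · simp [hk]

theorem tendsto_sub_nhdsNE (a : ℝ) : Tendsto (fun t => t - a) (𝓝[≠] a) (𝓝[≠] 0) := by
  refine tendsto_nhdsWithin_of_tendsto_nhds_of_eventually_within _ ?_ ?_
  · have : Tendsto (fun t => t - a) (𝓝 a) (𝓝 (a - a)) := (continuous_id.sub continuous_const).tendsto a
    rw [sub_self] at this
    exact this.mono_left nhdsWithin_le_nhds
  · filter_upwards [self_mem_nhdsWithin] with t ht
    exact sub_ne_zero.2 ht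

theorem eventually_abs_qfi_update_sub_lt (hρ : ∀ a b, ContDiffAt ℝ 2 (fun y => (ρ y).mat a b) x)
    {i j r : Fin n} (hr : r = i ∨ r = j) {ε : ℝ} (hε : 0 < ε) :
    ∀ᶠ t in 𝓝[≠] (x r), ∀ᶠ y in 𝓝 (Function.update x r t),
      |qfi ρ y i j - regularizedQFI ρ x i j| < ε := by
  simp only [update_eq_add_single]
  rcases hr with rfl | rfl
  · exact (tendsto_sub_nhdsNE _).eventually (eventually_abs_qfi_sub_lt hρ r j hε)
  · have h := (tendsto_sub_nhdsNE (x r)).eventually (eventually_abs_qfi_sub_lt hρ r i hε)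
    filter_upwards [h] with t ht
    filter_upwards [ht] with y hy
    rw [qfi_symm ρ y i r, ← (regularizedQFI_isSymm hρ).apply i r]
    exact hy

theorem tendsto_qfi_update (hρ : ∀ a b, ContDiffAt ℝ 2 (fun y => (ρ y).mat a b) x)
    {i j r : Fin n} (hr : r = i ∨ r = j) :
    Tendsto (fun t => qfi ρ (Function.update x r t) i j) (𝓝[≠] (x r))
      (𝓝 (regularizedQFI ρ x i j)) := by
  rw [Metric.tendsto_nhds]
  intro ε hε
  filter_upwards [eventually_abs_qfi_update_sub_lt hρ hr hε] with t ht
  exact ht.self_of_nhds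

/-- At a nearby point of the line, the regularized matrix is itself the limit of `H` along the same
line. These values of `H` are within `ε / 2` of the limit at `x`, because the estimate at `x` holds
on neighbourhoods of the points of the line. -/
theorem continuousAt_regularizedQFI_update {U : Set (Fin n → ℝ)} (hU : IsOpen U)
    (hρ : ∀ y ∈ U, ∀ a b, ContDiffAt ℝ 2 (fun y => (ρ y).mat a b) y) (hx : x ∈ U)
    {i j r : Fin n} (hr : r = i ∨ r = j) :
    ContinuousAt (fun t => regularizedQFI ρ (Function.update x r t) i j) (x r) := by
  rw [continuousAt_iff_punctured_nhds, Function.update_eq_self, Metric.tendsto_nhds]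
  intro ε hε
  have hcont : Tendsto (fun t => Function.update x r t) (𝓝[≠] (x r)) (𝓝 x) := by
    have : Continuous fun t => Function.update x r t := continuous_const.update r continuous_id
    exact (this.tendsto' _ _ (Function.update_eq_self r x)).mono_left nhdsWithin_le_nhds
  filter_upwards [eventually_abs_qfi_update_sub_lt (hρ x hx) hr (half_pos hε),
    hcont.eventually (hU.mem_nhds hx)] with t ht htU
  have h1 := tendsto_qfi_update (hρ _ htU) hr
  have h2 : Tendsto (fun s => Function.update (Function.update x r t) r s)
      (𝓝[≠] (Function.update x r t r)) (𝓝 (Function.update x r t)) := by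
    have : Continuous fun s => Function.update (Function.update x r t) r s :=
      continuous_const.update r continuous_id
    exact (this.tendsto' _ _ (Function.update_eq_self r _)).mono_left nhdsWithin_le_nhds
  have h3 := le_of_tendsto (h1.sub_const (regularizedQFI ρ x i j)).abs
    ((h2.eventually ht).mono fun s hs => hs.le)
  rw [Real.dist_eq]
  linarith

end Limits

/-! ### The case of equality -/

section Equality

variable {n d : ℕ} {ρ : (Fin n → ℝ) → DensityMatrix d} {x : Fin n → ℝ}

theorem hessian_vanishingSum_posSemidef
    (hρ : ∀ a b, ContDiffAt ℝ 2 (fun y => (ρ y).mat a b) x) :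
    (hessian (vanishingSum ρ x) x).PosSemidef :=
  (contDiffAt_vanishingSum hρ).twiceDifferentiableAt.hessian_posSemidef
    (Eventually.of_forall (vanishingSum_nonneg ρ x)) (vanishingSum_self ρ x)

/-- To second order `S` is half its Hessian form, so the Hessian vanishes iff `S = o(|v|²)`; as `0 ≤
p_k ≤ S` for each vanishing branch, this is the same as every such `p_k` being `o(|v|²)`. -/
theorem hessian_vanishingSum_eq_zero_iff
    (hρ : ∀ a b, ContDiffAt ℝ 2 (fun y => (ρ y).mat a b) x) :
    hessian (vanishingSum ρ x) x = 0 ↔ ∀ k, (ρ x).eigenvalue k = 0 →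
      (fun y => (ρ y).eigenvalue k) =o[𝓝 x] fun y => ‖y - x‖ ^ 2 := by
  have hS := (contDiffAt_vanishingSum hρ).twiceDifferentiableAt
  have htaylor := hS.isLittleO_of_nonneg (Eventually.of_forall (vanishingSum_nonneg ρ x))
    (vanishingSum_self ρ x)
  have hsub : Tendsto (fun y => y - x) (𝓝 x) (𝓝 0) :=
    (continuous_id.sub continuous_const).tendsto' _ _ (sub_self x)
  have hadd : Tendsto (fun v => x + v) (𝓝 0) (𝓝 x) :=
    (continuous_const.add continuous_id).tendsto' _ _ (by simp)
  constructor
  · intro h k hk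
    have h1 : (fun v => vanishingSum ρ x (x + v)) =o[𝓝 0] fun v => ‖v‖ ^ 2 := by
      simpa [h] using htaylor
    have h2 : vanishingSum ρ x =o[𝓝 x] fun y => ‖y - x‖ ^ 2 := by
      refine (h1.comp_tendsto hsub).congr_left fun y => ?_
      simp
    refine IsBigO.trans_isLittleO (IsBigO.of_bound 1 (Eventually.of_forall fun y => ?_)) h2
    rw [one_mul, Real.norm_of_nonneg ((ρ y).eigenvalue_nonneg k),
      Real.norm_of_nonneg (vanishingSum_nonneg ρ x y)]
    exact Finset.single_le_sum (f := fun k => (ρ y).eigenvalue k)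
      (fun k _ => (ρ y).eigenvalue_nonneg k) (by simpa using hk)
  · intro h
    have h1 : vanishingSum ρ x =o[𝓝 x] fun y => ‖y - x‖ ^ 2 :=
      IsLittleO.fun_sum fun k hk => h k (by simpa using hk)
    have h2 : (fun v => vanishingSum ρ x (x + v)) =o[𝓝 0] fun v => ‖v‖ ^ 2 := by
      refine (h1.comp_tendsto hadd).congr_right fun v => ?_
      simp
    refine eq_zero_of_isSymm_of_quadratic hS.hessian_isSymm fun v => ?_
    refine quadratic_eq_zero_of_isLittleO ?_ v
    refine ((h2.sub htaylor).const_mul_left 2).congr_left fun v => ?_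
    ring

end Equality

/-! ### Arbitrary labellings of the eigenvalues -/

section Labelling

variable {n d : ℕ} {ρ : (Fin n → ℝ) → DensityMatrix d} {x : Fin n → ℝ}
  {U : Set (Fin n → ℝ)} {p : Fin d → (Fin n → ℝ) → ℝ}

namespace IsEigenvalueLabelling

theorem map_eq (hp : IsEigenvalueLabelling ρ U p) {y : Fin n → ℝ} (hy : y ∈ U) :
    Multiset.map (fun k => p k y) Finset.univ.val =
      Multiset.map (ρ y).eigenvalue Finset.univ.val := by
  have h := (hp y hy).symm.trans (ρ y).charpoly_eq
  have h1 := congrArg Polynomial.roots h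
  rw [Polynomial.roots_prod _ _ (Finset.prod_ne_zero_iff.2 fun k _ => Polynomial.X_sub_C_ne_zero _),
    Polynomial.roots_prod _ _ (Finset.prod_ne_zero_iff.2 fun k _ => Polynomial.X_sub_C_ne_zero _)]
    at h1
  simp only [Polynomial.roots_X_sub_C, Multiset.bind_singleton] at h1
  refine Multiset.map_injective Complex.ofReal_injective ?_
  simpa only [Multiset.map_map, Function.comp_def] using h1

theorem sum_eq (hp : IsEigenvalueLabelling ρ U p) {y : Fin n → ℝ} (hy : y ∈ U) (φ : ℝ → ℝ) :
    ∑ k, φ (p k y) = ∑ k, φ ((ρ y).eigenvalue k) := by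
  have h := congrArg (fun s => (Multiset.map φ s).sum) (hp.map_eq hy)
  simp only [Multiset.map_map, Function.comp_def] at h
  exact h

theorem nonneg (hp : IsEigenvalueLabelling ρ U p) {y : Fin n → ℝ} (hy : y ∈ U) (k : Fin d) :
    0 ≤ p k y := by
  have h : p k y ∈ Multiset.map (fun k => p k y) Finset.univ.val :=
    Multiset.mem_map_of_mem _ (Finset.mem_univ k)
  rw [hp.map_eq hy] at h
  obtain ⟨l, -, hl⟩ := Multiset.mem_map.1 h
  rw [← hl]
  exact (ρ y).eigenvalue_nonneg l

/-- Near `x`, the sum of the vanishing eigenvalues does not depend on the labelling. -/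
theorem eventually_sum_eq_vanishingSum (hp : IsEigenvalueLabelling ρ U p) (hU : IsOpen U)
    (hx : x ∈ U) (hρ : ∀ a b, ContDiffAt ℝ 2 (fun y => (ρ y).mat a b) x)
    (hc : ∀ k, p k x = 0 → ContinuousAt (p k) x) :
    vanishingSum ρ x =ᶠ[𝓝 x] fun y => ∑ k with p k x = 0, p k y := by
  obtain ⟨c, hc0, hgap⟩ := (ρ x).exists_gap
  have h1 : ∀ᶠ y in 𝓝 x, ∀ k, (ρ y).eigenvalue k < c / 2 ↔ (ρ x).eigenvalue k = 0 := by
    refine Filter.eventually_all.2 fun k => ?_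
    have ht := IsBlockFrame.tendsto_eigenvalue hρ k
    by_cases hk : (ρ x).eigenvalue k = 0
    · filter_upwards [ht.eventually_lt_const (u := c / 2) (by rw [hk]; positivity)] with y hy
      exact iff_of_true hy hk
    · filter_upwards [ht.eventually_const_lt (u := c / 2) (by linarith [hgap k hk])] with y hy
      exact iff_of_false (not_lt.2 hy.le) hk
  have h2 : ∀ᶠ y in 𝓝 x, ∀ k, p k x = 0 → p k y < c / 2 := by
    refine Filter.eventually_all.2 fun k => ?_
    by_cases hk : p k x = 0
    · filter_upwards [(hc k hk).tendsto.eventually_lt_const (u := c / 2)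
        (by rw [hk]; positivity)] with y hy _ using hy
    · exact Eventually.of_forall fun y h => absurd h hk
  filter_upwards [h1, h2, hU.mem_nhds hx] with y hy1 hy2 hyU
  -- The number of eigenvalues below half the gap is the same for every labelling and equals the
  -- multiplicity of zero at `x`. By continuity the labels vanishing at `x` are among them, hence
  -- are all of them, and the sum below the threshold is again independent of the labelling.
  have hcard : ((Finset.univ.filter fun k => p k y < c / 2).card : ℝ) =
      (Finset.univ.filter fun k => p k x = 0).card := by
    have e1 := hp.sum_eq hyU fun t => if t < c / 2 then 1 else 0
    have e2 := hp.sum_eq hx fun t => if t = 0 then 1 else 0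
    simp only [hy1] at e1
    rw [← e2] at e1
    simpa only [Finset.sum_boole] using e1
  have hset : (Finset.univ.filter fun k => p k x = 0) =
      Finset.univ.filter fun k => p k y < c / 2 := by
    refine Finset.eq_of_subset_of_card_le (fun k hk => ?_) (by exact_mod_cast hcard.le)
    simpa using hy2 k (by simpa using hk)
  have e := hp.sum_eq hyU fun t => if t < c / 2 then t else 0
  simp only [hy1] at e
  rw [vanishingSum, Finset.sum_filter, ← e, ← Finset.sum_filter, hset]

theorem hessian_vanishingSum (hp : IsEigenvalueLabelling ρ U p) (hU : IsOpen U) (hx : x ∈ U)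
    (hρ : ∀ a b, ContDiffAt ℝ 2 (fun y => (ρ y).mat a b) x)
    (hc : ∀ k, p k x = 0 → TwiceDifferentiableAt (p k) x) :
    hessian (vanishingSum ρ x) x = ∑ k with p k x = 0, hessian (p k) x := by
  rw [hessian_congr (hp.eventually_sum_eq_vanishingSum hU hx hρ fun k hk =>
    (hc k hk).1.self_of_nhds.continuousAt)]
  exact (TwiceDifferentiableAt.sum fun k hk => hc k (by simpa using hk)).2

theorem hessian_posSemidef (hp : IsEigenvalueLabelling ρ U p) (hU : IsOpen U) (hx : x ∈ U)
    {k : Fin d} (hk : p k x = 0) (hc : TwiceDifferentiableAt (p k) x) :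
    (hessian (p k) x).PosSemidef :=
  hc.hessian_posSemidef (by filter_upwards [hU.mem_nhds hx] with y hy using hp.nonneg hy k) hk

end IsEigenvalueLabelling

end Labelling

/-! ### The main theorem -/

theorem mainTheorem2 {n d : ℕ} (U : Set (Fin n → ℝ)) (hU : IsOpen U)
    (ρ : (Fin n → ℝ) → DensityMatrix d)
    (hρ : ∀ a b, ContDiffOn ℝ 2 (fun x => (ρ x).mat a b) U) :
    -- symmetric logarithmic derivatives exist, and `H^{ij} = tr[(L_i L_j + L_j L_i) ρ / 2]`
    (∀ x ∈ U, (∀ i, ∃ L, IsSLD ρ x i L) ∧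
      ∀ i j Li Lj, IsSLD ρ x i Li → IsSLD ρ x j Lj →
        ((1 / 2 : ℂ) • ((Li * Lj + Lj * Li) * (ρ x).mat)).trace = ((qfi ρ x i j : ℝ) : ℂ)) ∧
    -- the Bures metric `g` and the continuous quantum Fisher information matrix `Hc`
    ∃ g Hc : (Fin n → ℝ) → Matrix (Fin n) (Fin n) ℝ,
      (∀ x ∈ U, ∀ m, IsBuresMetricAt ρ x m ↔ m = g x) ∧
      (∀ x ∈ U, ∀ m, IsContinuousQFIAt ρ x m ↔ m = Hc x) ∧
      -- `Hc = 4 g = H + 2 ∂∂(sum of the vanishing eigenvalues)`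
      (∀ x ∈ U, ContDiffAt ℝ 2 (vanishingSum ρ x) x ∧
        g x = (1 / 4 : ℝ) • (qfi ρ x + (2 : ℝ) • hessian (vanishingSum ρ x) x) ∧
        Hc x = (4 : ℝ) • g x) ∧
      -- the same with the Hessians of the individual vanishing eigenvalues, whenever they exist
      (∀ p, IsEigenvalueLabelling ρ U p → ∀ x ∈ U,
        (∀ k, p k x = 0 → TwiceDifferentiableAt (p k) x) →
          g x = (1 / 4 : ℝ) • (qfi ρ x + (2 : ℝ) • ∑ k with p k x = 0, hessian (p k) x) ∧
          (∀ k, p k x = 0 → (hessian (p k) x).PosSemidef) ∧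
          ((4 : ℝ) • g x = qfi ρ x ↔ ∀ k, p k x = 0 → hessian (p k) x = 0)) ∧
      -- `4 g ≥ H`, with equality iff every vanishing eigenvalue vanishes to second order
      (∀ x ∈ U, ((4 : ℝ) • g x - qfi ρ x).PosSemidef ∧
        ((4 : ℝ) • g x = qfi ρ x ↔ ∀ k, (ρ x).eigenvalue k = 0 →
          (fun y => (ρ y).eigenvalue k) =o[𝓝 x] fun y => ‖y - x‖ ^ 2)) ∧
      -- `Hc^{ij}` is the one-parameter limit of `H^{ij}` in `ε_i` and in `ε_j`, and is continuous
      -- in each of these two parameters when all the others are kept fixed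
      (∀ x ∈ U, ∀ i j, ∀ r, r = i ∨ r = j →
        Tendsto (fun t => qfi ρ (Function.update x r t) i j) (𝓝[≠] (x r)) (𝓝 (Hc x i j)) ∧
        ContinuousAt (fun t => Hc (Function.update x r t) i j) (x r)) := by
  have hρ' : ∀ x ∈ U, ∀ a b, ContDiffAt ℝ 2 (fun y => (ρ y).mat a b) x := fun x hx a b =>
    (hρ a b).contDiffAt (hU.mem_nhds hx)
  have h4 : ∀ x, (4 : ℝ) • ((1 / 4 : ℝ) • regularizedQFI ρ x) = regularizedQFI ρ x := fun x => by
    rw [smul_smul]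
    norm_num
  have hsub : ∀ x, regularizedQFI ρ x - qfi ρ x = (2 : ℝ) • hessian (vanishingSum ρ x) x :=
    fun x => by rw [regularizedQFI, add_sub_cancel_left]
  have hiff : ∀ x, regularizedQFI ρ x = qfi ρ x ↔ hessian (vanishingSum ρ x) x = 0 := fun x => by
    rw [← sub_eq_zero, hsub, smul_eq_zero_iff_right two_ne_zero]
  refine ⟨fun x hx => ⟨exists_isSLD (hρ' x hx), fun i j Li Lj hi hj => hi.trace_eq_qfi (hρ' x hx) hj⟩,
    fun x => (1 / 4 : ℝ) • regularizedQFI ρ x, regularizedQFI ρ,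
    fun x hx => isBuresMetricAt_iff (hρ' x hx), fun x hx => isContinuousQFIAt_iff (hρ' x hx),
    fun x hx => ⟨contDiffAt_vanishingSum (hρ' x hx), rfl, (h4 x).symm⟩, ?_, fun x hx => ?_,
    fun x hx i j r hr => ⟨tendsto_qfi_update (hρ' x hx) hr,
      continuousAt_regularizedQFI_update hU hρ' hx hr⟩⟩
  · intro p hp x hx hc
    have hsum := hp.hessian_vanishingSum hU hx (hρ' x hx) hc
    have hpos : ∀ k, p k x = 0 → (hessian (p k) x).PosSemidef := fun k hk =>
      hp.hessian_posSemidef hU hx hk (hc k hk)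
    refine ⟨by rw [← hsum]; rfl, hpos, ?_⟩
    -- A sum of positive semidefinite matrices is zero only if each summand is.
    rw [h4, hiff, hsum, Finset.sum_eq_zero_iff_of_nonneg fun k hk =>
      Matrix.nonneg_iff_posSemidef.2 (hpos k (by simpa using hk))]
    simp
  · rw [h4, hsub, hiff, ← hessian_vanishingSum_eq_zero_iff (hρ' x hx)]
    exact ⟨(hessian_vanishingSum_posSemidef (hρ' x hx)).smul zero_le_two, Iff.rfl⟩
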